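/- A map is a rooted planar map, that is, a proper embedding in the sphere of a connected finite multigraph with at least one edge, with one distinguished half-edge, considered up to orientation-preserving homeomorphism; its size $|\mathfrak m|$ is its number of edges. A map is loopless if it has no loops, and simple if it moreover has no multiple edges. It is separable if its edge set can be partitioned into two non-empty sets such that exactly one vertex is incident to members of both, and $2$-connected otherwise. A pure $\ell$-gon of a map is a face of degree $\ell$ (that is, with $\ell$ corners) that is incident to $\ell$ distinct vertices; in particular, the face of the map that consists of a single non-loop edge is a pure $2$-gon. Let $L$ be a finite set of positive integers, let $\mathbf x=(x_\ell)_{\ell\in L}$ be indeterminates, and for a family $\mathcal F$ of maps put $$F(z;\mathbf x)=\sum_{\mathfrak m\in\mathcal F} z^{|\mathfrak m|}\prod_{\ell\in L}x_\ell^{\,g_\ell(\mathfrak m)},$$ where $g_\ell(\mathfrak m)$ is the number of faces of $\mathfrak m$, the root face included, that are pure $\ell$-gons. Let $M_{2l}$, $M_3$, $M_4$, $M_5$ be these series for, respectively, the loopless maps, the simple maps, the $2$-connected maps other than the map whose only edge is a loop, and the $2$-connected simple maps. Then, as formal power series in $z$ over $\mathbb Z[x_\ell:\ell\in L]$, $$M_{2l}(z;\mathbf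 x)=M_3\bigl(z(1+M_{2l}(z;\mathbf x));\mathbf x\bigr)\qquad\text{and}\qquad M_4(z;\mathbf x)=M_5\bigl(z(1+M_4(z;\mathbf x));\mathbf x\bigr).$$ -/

import Mathlib

/-- A rooted planar map with set of half-edges `D`, given by its rotation system.
`σ` sends a half-edge to the next one anticlockwise around its initial vertex, `α` reverses a
half-edge.  Vertices, edges and faces are the cycles of `σ`, `α` and `σ⁻¹ * α`; the cycle of
`σ⁻¹ * α` through `d` is the face on the left of `d`.  The underlying graph is connected, and
the surface is the sphere (Euler's formula). As there is a root half-edge, the vertex map is not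
of this form. -/
@[ext]
structure RootedPlanarMap (D : Type*) where
  σ : Equiv.Perm D
  α : Equiv.Perm D
  root : D
  involutive : ∀ d, α (α d) = d
  fixedPointFree : ∀ d, α d ≠ d
  connected : ∀ d d' : D, ∃ g ∈ Subgroup.closure {σ, α}, g d = d'
  euler :
    Nat.card (Quotient (Equiv.Perm.SameCycle.setoid σ)) +
      Nat.card (Quotient (Equiv.Perm.SameCycle.setoid (σ⁻¹ * α))) =
    Nat.card (Quotient (Equiv.Perm.SameCycle.setoid α)) + 2

namespace RootedPlanarMap

variable {D D' : Type*}

/-- The face permutation: the successor of a half-edge along the face on its left. -/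
def φ (m : RootedPlanarMap D) : Equiv.Perm D := m.σ⁻¹ * m.α

abbrev Vertex (m : RootedPlanarMap D) := Quotient (Equiv.Perm.SameCycle.setoid m.σ)

abbrev Edge (m : RootedPlanarMap D) := Quotient (Equiv.Perm.SameCycle.setoid m.α)

abbrev Face (m : RootedPlanarMap D) := Quotient (Equiv.Perm.SameCycle.setoid m.φ)

/-- The initial vertex of a half-edge. -/
def origin (m : RootedPlanarMap D) (d : D) : m.Vertex := Quotient.mk _ d

/-- The edge that carries a half-edge. -/
def edge (m : RootedPlanarMap D) (d : D) : m.Edge := Quotient.mk _ d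

/-- The face on the left of a half-edge. -/
def face (m : RootedPlanarMap D) (d : D) : m.Face := Quotient.mk _ d

def Incident (m : RootedPlanarMap D) (v : m.Vertex) (e : m.Edge) : Prop :=
  ∃ d, m.origin d = v ∧ m.edge d = e

/-- No edge has equal end points. -/
def IsLoopless (m : RootedPlanarMap D) : Prop :=
  ∀ d, m.origin d ≠ m.origin (m.α d)

/-- Loopless, and two half-edges with the same initial and the same terminal vertex are equal:
there are no multiple edges. -/
def IsSimple (m : RootedPlanarMap D) : Prop :=
  m.IsLoopless ∧ ∀ d d', m.origin d = m.origin d' →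
    m.origin (m.α d) = m.origin (m.α d') → d = d'

/-- The edges can be partitioned into two non-empty sets such that exactly one vertex is incident
to members of both. -/
def IsSeparable (m : RootedPlanarMap D) : Prop :=
  ∃ E₁ E₂ : Set m.Edge, E₁.Nonempty ∧ E₂.Nonempty ∧ E₁ ∪ E₂ = Set.univ ∧ Disjoint E₁ E₂ ∧
    ∃! v : m.Vertex, (∃ e ∈ E₁, m.Incident v e) ∧ (∃ e ∈ E₂, m.Incident v e)

def IsTwoConnected (m : RootedPlanarMap D) : Prop := ¬ m.IsSeparable

/-- The degree of a face: the number of its corners (equivalently of its edge sides). -/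
noncomputable def degree (m : RootedPlanarMap D) (f : m.Face) : ℕ :=
  {d : D | m.face d = f}.ncard

/-- The vertices incident to a face. -/
def faceVertices (m : RootedPlanarMap D) (f : m.Face) : Set m.Vertex :=
  m.origin '' {d : D | m.face d = f}

/-- A face of degree `ℓ` that is incident to `ℓ` distinct vertices. -/
def IsPureGon (m : RootedPlanarMap D) (ℓ : ℕ) (f : m.Face) : Prop :=
  m.degree f = ℓ ∧ (m.faceVertices f).ncard = ℓ

/-- The number of pure `ℓ`-gons among all faces, the root face included. -/
noncomputable def pureGons (m : RootedPlanarMap D) (ℓ : ℕ) : ℕ :=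
  {f : m.Face | m.IsPureGon ℓ f}.ncard

/-- Isomorphism of rooted maps: a relabelling of the half-edges that respects the structure and
the root. -/
def Iso (m : RootedPlanarMap D) (m' : RootedPlanarMap D') : Prop :=
  ∃ e : D ≃ D', (∀ d, e (m.σ d) = m'.σ (e d)) ∧ (∀ d, e (m.α d) = m'.α (e d)) ∧
    e m.root = m'.root

theorem Iso.refl (m : RootedPlanarMap D) : m.Iso m :=
  ⟨Equiv.refl D, fun _ => rfl, fun _ => rfl, rfl⟩

theorem Iso.symm {m : RootedPlanarMap D} {m' : RootedPlanarMap D'} (h : m.Iso m') : m'.Iso m := by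
  obtain ⟨e, hσ, hα, hr⟩ := h
  refine ⟨e.symm, fun d => ?_, fun d => ?_, ?_⟩
  · rw [Equiv.symm_apply_eq, hσ, Equiv.apply_symm_apply]
  · rw [Equiv.symm_apply_eq, hα, Equiv.apply_symm_apply]
  · rw [Equiv.symm_apply_eq, hr]

theorem Iso.trans {D'' : Type*} {m : RootedPlanarMap D} {m' : RootedPlanarMap D'}
    {m'' : RootedPlanarMap D''} (h : m.Iso m') (h' : m'.Iso m'') : m.Iso m'' := by
  obtain ⟨e, hσ, hα, hr⟩ := h
  obtain ⟨e', hσ', hα', hr'⟩ := h'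
  exact ⟨e.trans e', fun d => by simp [hσ, hσ'], fun d => by simp [hα, hα'], by simp [hr, hr']⟩

theorem sameCycle_iff_of_conj {p : Equiv.Perm D} {p' : Equiv.Perm D'} (e : D ≃ D')
    (h : ∀ d, e (p d) = p' (e d)) (a b : D) :
    p'.SameCycle (e a) (e b) ↔ p.SameCycle a b := by
  have hp : p' = e.permCongr p := by
    ext x
    rw [Equiv.permCongr_apply, h, Equiv.apply_symm_apply]
  have hz : ∀ i : ℤ, (p' ^ i) (e a) = e ((p ^ i) a) := by
    intro i
    have : p' ^ i = e.permCongrHom (p ^ i) := by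
      rw [map_zpow]
      congr 1
    rw [this]
    simp [Equiv.permCongrHom]
  constructor
  · rintro ⟨i, hi⟩
    exact ⟨i, e.injective (by rw [← hz, hi])⟩
  · rintro ⟨i, hi⟩
    exact ⟨i, by rw [hz, hi]⟩

/-- The bijection between cycles that an intertwining relabelling induces. -/
def cycleEquiv {p : Equiv.Perm D} {p' : Equiv.Perm D'} (e : D ≃ D')
    (h : ∀ d, e (p d) = p' (e d)) :
    Quotient (Equiv.Perm.SameCycle.setoid p) ≃ Quotient (Equiv.Perm.SameCycle.setoid p') :=
  Quotient.congr e fun a b => (sameCycle_iff_of_conj e h a b).symm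

theorem conj_φ {m : RootedPlanarMap D} {m' : RootedPlanarMap D'} {e : D ≃ D'}
    (hσ : ∀ d, e (m.σ d) = m'.σ (e d)) (hα : ∀ d, e (m.α d) = m'.α (e d)) (d : D) :
    e (m.φ d) = m'.φ (e d) := by
  simp only [φ, Equiv.Perm.mul_apply]
  rw [Equiv.Perm.eq_inv_iff_eq, ← hσ, ← Equiv.Perm.mul_apply m.σ, mul_inv_cancel, Equiv.Perm.one_apply, hα]

theorem origin_eq_iff {m : RootedPlanarMap D} {m' : RootedPlanarMap D'} {e : D ≃ D'}
    (hσ : ∀ d, e (m.σ d) = m'.σ (e d)) (a b : D) :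
    m'.origin (e a) = m'.origin (e b) ↔ m.origin a = m.origin b :=
  (cycleEquiv e hσ).apply_eq_iff_eq (x := m.origin a) (y := m.origin b)

theorem IsLoopless.of_iso {m : RootedPlanarMap D} {m' : RootedPlanarMap D'} (h : m.Iso m')
    (hm : m.IsLoopless) : m'.IsLoopless := by
  obtain ⟨e, hσ, hα, -⟩ := h
  intro d
  obtain ⟨d, rfl⟩ := e.surjective d
  rw [← hα, Ne, origin_eq_iff hσ]
  exact hm d

theorem IsSimple.of_iso {m : RootedPlanarMap D} {m' : RootedPlanarMap D'} (h : m.Iso m')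
    (hm : m.IsSimple) : m'.IsSimple := by
  refine ⟨hm.1.of_iso h, ?_⟩
  obtain ⟨e, hσ, hα, -⟩ := h
  intro d d'
  obtain ⟨d, rfl⟩ := e.surjective d
  obtain ⟨d', rfl⟩ := e.surjective d'
  rw [← hα, ← hα, origin_eq_iff hσ, origin_eq_iff hσ]
  intro h1 h2
  rw [hm.2 d d' h1 h2]

theorem IsSeparable.of_iso {m : RootedPlanarMap D} {m' : RootedPlanarMap D'} (h : m.Iso m')
    (hm : m.IsSeparable) : m'.IsSeparable := by
  obtain ⟨e, hσ, hα, -⟩ := h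
  obtain ⟨E₁, E₂, h₁, h₂, hu, hd, hv⟩ := hm
  have hinc : ∀ (v : m.Vertex) (a : m.Edge),
      m'.Incident (cycleEquiv e hσ v) (cycleEquiv e hα a) ↔ m.Incident v a := by
    intro v a
    constructor
    · rintro ⟨d, hd₁, hd₂⟩
      obtain ⟨d, rfl⟩ := e.surjective d
      exact ⟨d, (cycleEquiv e hσ).injective hd₁, (cycleEquiv e hα).injective hd₂⟩
    · rintro ⟨d, rfl, rfl⟩
      exact ⟨e d, rfl, rfl⟩
  have hex : ∀ (E : Set m.Edge) (v : m.Vertex),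
      (∃ a ∈ cycleEquiv e hα '' E, m'.Incident (cycleEquiv e hσ v) a) ↔
        ∃ a ∈ E, m.Incident v a := by
    intro E v
    rw [Set.exists_mem_image]
    simp only [hinc]
  refine ⟨cycleEquiv e hα '' E₁, cycleEquiv e hα '' E₂, h₁.image _, h₂.image _, ?_, ?_, ?_⟩
  · rw [← Set.image_union, hu, Set.image_univ, Equiv.range_eq_univ]
  · exact (Set.disjoint_image_iff (cycleEquiv e hα).injective).2 hd
  · obtain ⟨v, hv, huniq⟩ := hv
    refine ⟨cycleEquiv e hσ v, ⟨(hex E₁ v).2 hv.1, (hex E₂ v).2 hv.2⟩, ?_⟩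
    intro w hw
    obtain ⟨w, rfl⟩ := (cycleEquiv e hσ).surjective w
    rw [huniq w ⟨(hex E₁ w).1 hw.1, (hex E₂ w).1 hw.2⟩]

theorem pureGons_eq_of_iso {m : RootedPlanarMap D} {m' : RootedPlanarMap D'} (h : m.Iso m')
    (ℓ : ℕ) : m.pureGons ℓ = m'.pureGons ℓ := by
  obtain ⟨e, hσ, hα, -⟩ := h
  have hφ := conj_φ hσ hα
  have hset : ∀ f : m.Face,
      {d : D' | m'.face d = cycleEquiv e hφ f} = e '' {d : D | m.face d = f} := by
    intro f
    ext d
    obtain ⟨d, rfl⟩ := e.surjective d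
    simp only [Set.mem_ofPred_eq, e.injective.mem_set_image]
    exact (cycleEquiv e hφ).apply_eq_iff_eq (x := m.face d) (y := f)
  have hvert : ∀ f : m.Face,
      m'.faceVertices (cycleEquiv e hφ f) = cycleEquiv e hσ '' m.faceVertices f := by
    intro f
    unfold faceVertices
    rw [hset, Set.image_image, Set.image_image]
    rfl
  have hpure : ∀ f : m.Face, m'.IsPureGon ℓ (cycleEquiv e hφ f) ↔ m.IsPureGon ℓ f := by
    intro f
    unfold IsPureGon degree
    rw [hset, hvert, Set.ncard_image_of_injective _ e.injective,
      Set.ncard_image_of_injective _ (cycleEquiv e hσ).injective]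
  unfold pureGons
  rw [← Set.ncard_image_of_injective _ (cycleEquiv e hφ).injective]
  congr 1
  ext f
  obtain ⟨f, rfl⟩ := (cycleEquiv e hφ).surjective f
  simp only [(cycleEquiv e hφ).injective.mem_set_image, Set.mem_ofPred_eq, hpure]

instance [Finite D] : Finite (RootedPlanarMap D) :=
  Finite.of_injective
    (fun m : RootedPlanarMap D => ((m.σ, m.α, m.root) : Equiv.Perm D × Equiv.Perm D × D))
    (fun m m' h => by
      simp only [Prod.mk.injEq] at h
      exact RootedPlanarMap.ext h.1 h.2.1 h.2.2)

instance isoSetoid (D : Type*) : Setoid (RootedPlanarMap D) where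
  r m m' := m.Iso m'
  iseqv := ⟨Iso.refl, Iso.symm, Iso.trans⟩

end RootedPlanarMap

/-- Rooted planar maps with `n` edges (that is, `2 * n` half-edges), up to isomorphism. -/
def MapClass (n : ℕ) : Type := Quotient (RootedPlanarMap.isoSetoid (Fin (2 * n)))

namespace MapClass

variable {n : ℕ}

instance : Finite (MapClass n) := Quotient.finite _

noncomputable instance : Fintype (MapClass n) := Fintype.ofFinite _

def IsLoopless : MapClass n → Prop :=
  Quotient.lift (fun m => m.IsLoopless) fun _ _ h =>
    propext ⟨fun k => k.of_iso h, fun k => k.of_iso h.symm⟩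

def IsSimple : MapClass n → Prop :=
  Quotient.lift (fun m => m.IsSimple) fun _ _ h =>
    propext ⟨fun k => k.of_iso h, fun k => k.of_iso h.symm⟩

def IsTwoConnected : MapClass n → Prop :=
  Quotient.lift (fun m => m.IsTwoConnected) fun _ _ h =>
    propext (not_congr ⟨fun k => k.of_iso h, fun k => k.of_iso h.symm⟩)

noncomputable def pureGons (ℓ : ℕ) : MapClass n → ℕ :=
  Quotient.lift (fun m => m.pureGons ℓ) fun _ _ h => RootedPlanarMap.pureGons_eq_of_iso h ℓ

end MapClass

open Classical in
/-- The generating function `∑ z ^ |m| * ∏_{ℓ ∈ L} x_ℓ ^ (number of pure ℓ-gons of m)` of the maps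
`m` in the family `C`: a formal power series in `z` over the ring `ℤ[x_ℓ : ℓ ∈ L]`. -/
noncomputable def gonGF (L : Finset ℕ) (C : ∀ n : ℕ, MapClass n → Prop) :
    PowerSeries (MvPolynomial L ℤ) :=
  PowerSeries.mk fun n =>
    ∑ m : MapClass n with C n m, ∏ ℓ : L, MvPolynomial.X ℓ ^ m.pureGons (ℓ : ℕ)

/-- Loopless maps. -/
noncomputable def M2l (L : Finset ℕ) : PowerSeries (MvPolynomial L ℤ) :=
  gonGF L fun _ m => m.IsLoopless

/-- Simple maps. -/
noncomputable def M3 (L : Finset ℕ) : PowerSeries (MvPolynomial L ℤ) :=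
  gonGF L fun _ m => m.IsSimple

/-- `2`-connected maps, except the map whose only edge is a loop. -/
noncomputable def M4 (L : Finset ℕ) : PowerSeries (MvPolynomial L ℤ) :=
  gonGF L fun n m => m.IsTwoConnected ∧ (n = 1 → m.IsLoopless)

/-- `2`-connected simple maps. -/
noncomputable def M5 (L : Finset ℕ) : PowerSeries (MvPolynomial L ℤ) :=
  gonGF L fun _ m => m.IsTwoConnected ∧ m.IsSimple

open Equiv hiding sumCongr
open Equiv.Perm

/-! A loopless map is a simple core in which some edges have been opened and filled with loopless
maps. Filling the edge of a half-edge `a` of `m₁` with `m₂`, whose root is `r`, replaces the edges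
{a, α a} and {r, α r} by {a, α r} and {r, α a} and leaves the face permutations untouched (`glue`).
Hence the numbers of edges add, the faces are those of the two parts, the pure gons add
(`glue_pureGons`), and the result is 2-connected exactly when both parts are
(`glue_isTwoConnected_iff`).

Conversely, two parallel edges form a closed curve, and the same switch `sw` cuts along it. The cut
splits both end vertices, so the number of vertices grows by two while edges and faces stay the
same; since the genus is nonnegative (`numClasses_cyc_add_le`), the map must fall apart
(`not_conn_sw`). The side without the root is a bigon region. The maximal regions are the inserted
maps (`exists_glue`), and a map without regions is simple.

The decomposition removes one region at a time. Let C(k,t) be the series of the loopless maps with k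
maximal regions and t core edges left unfilled, and M the series of all loopless maps. Marking a
region is the same as marking an unfilled edge of a map with one region less and choosing the map
that fills it, so (k+1) C(k+1,t) = (t+1) C(k,t+1) M. Thus C(k,t) = binom(k+t,k) C(0,k+t) M^k
(`coreSeries_eq`). Moreover C(0,j) = s_j z^j, where s_j is the total weight of the simple maps with
j edges (`coreSeries_zero`). Summing over k+t = j gives s_j (z(1+M))^j, and summing over j gives the
substitution (`looplessSeries_eq_subst`).

Marking and cutting are carried out on maps with labelled half-edges: a rooted map has no nontrivial
automorphism, so a class with n edges has exactly (2n)! labellings. The argument uses only a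
property compatible with gluing and a multiplicative weight, so the two identities are two instances
of it. -/

theorem perm_apply_inv {D : Type*} (p : Perm D) (x : D) : p (p⁻¹ x) = x := p.apply_symm_apply x

theorem perm_inv_apply {D : Type*} (p : Perm D) (x : D) : p⁻¹ (p x) = x := p.symm_apply_apply x

/-! ### Cycles of a permutation under multiplication by a transposition -/

section Cycles

variable {D : Type*}

/-- The number of classes of an equivalence relation. -/
noncomputable def Setoid.numClasses (r : Setoid D) : ℕ := Nat.card (Quotient r)

/-- The equivalence relation obtained from `r` by uniting the classes of `x` and `y`. -/
def Setoid.joinPair (r : Setoid D) (x y : D) : Setoid D where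
  r u v := r u v ∨ (r u x ∧ r y v) ∨ (r u y ∧ r x v)
  iseqv := by
    refine ⟨fun u => Or.inl (r.refl' u), ?_, ?_⟩
    · rintro u v (h | ⟨h, h'⟩ | ⟨h, h'⟩)
      · exact Or.inl (r.symm' h)
      · exact Or.inr (Or.inr ⟨r.symm' h', r.symm' h⟩)
      · exact Or.inr (Or.inl ⟨r.symm' h', r.symm' h⟩)
    · rintro u v w (h | ⟨h, h'⟩ | ⟨h, h'⟩) (k | ⟨k, k'⟩ | ⟨k, k'⟩)
      · exact Or.inl (r.trans' h k)
      · exact Or.inr (Or.inl ⟨r.trans' h k, k'⟩)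
      · exact Or.inr (Or.inr ⟨r.trans' h k, k'⟩)
      · exact Or.inr (Or.inl ⟨h, r.trans' h' k⟩)
      · exact Or.inr (Or.inl ⟨h, k'⟩)
      · exact Or.inl (r.trans' h k')
      · exact Or.inr (Or.inr ⟨h, r.trans' h' k⟩)
      · exact Or.inl (r.trans' h k')
      · exact Or.inr (Or.inr ⟨h, k'⟩)

theorem Setoid.joinPair_apply (r : Setoid D) (x y u v : D) :
    r.joinPair x y u v ↔ r u v ∨ (r u x ∧ r y v) ∨ (r u y ∧ r x v) := Iff.rfl

theorem Setoid.le_joinPair (r : Setoid D) (x y : D) : r ≤ r.joinPair x y := fun _ _ h => Or.inl h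

theorem Setoid.joinPair_self (r : Setoid D) (x y : D) : r.joinPair x y x y :=
  Or.inr (Or.inl ⟨r.refl' x, r.refl' y⟩)

theorem Setoid.joinPair_le {r s : Setoid D} {x y : D} (h : r ≤ s) (hxy : s x y) :
    r.joinPair x y ≤ s := by
  rintro u v (k | ⟨k, k'⟩ | ⟨k, k'⟩)
  · exact h k
  · exact s.trans' (h k) (s.trans' hxy (h k'))
  · exact s.trans' (h k) (s.trans' (s.symm' hxy) (h k'))

theorem Setoid.joinPair_eq_self {r : Setoid D} {x y : D} (h : r x y) : r.joinPair x y = r :=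
  le_antisymm (Setoid.joinPair_le le_rfl h) (r.le_joinPair x y)

/-- Every class of the joined relation is represented exactly once by a class of `r` other than that
of `y`. -/
theorem Setoid.numClasses_joinPair [Finite D] {r : Setoid D} {x y : D} (h : ¬ r x y) :
    (r.joinPair x y).numClasses + 1 = r.numClasses := by
  classical
  unfold Setoid.numClasses
  rw [← Nat.card_congr (Equiv.optionSubtypeNe (Quotient.mk r y)), Finite.card_option]
  congr 1
  symm
  let f : {q : Quotient r // q ≠ Quotient.mk r y} → Quotient (r.joinPair x y) :=
    fun q => Setoid.map_of_le (r.le_joinPair x y) q.1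
  refine Nat.card_eq_of_bijective f ⟨?_, ?_⟩
  · rintro ⟨u, hu⟩ ⟨v, hv⟩ huv
    induction u using Quotient.inductionOn with | _ u
    induction v using Quotient.inductionOn with | _ v
    have hu' : ¬ r u y := fun k => hu (Quotient.sound k)
    have hv' : ¬ r v y := fun k => hv (Quotient.sound k)
    have : r.joinPair x y u v := Quotient.exact huv
    rcases this with k | ⟨k, k'⟩ | ⟨k, k'⟩
    · exact Subtype.ext (Quotient.sound k)
    · exact absurd (r.symm' k') hv'
    · exact absurd k hu'
  · intro q
    induction q using Quotient.inductionOn with | _ u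
    by_cases hu : r u y
    · refine ⟨⟨Quotient.mk r x, fun k => h (Quotient.exact k)⟩, ?_⟩
      exact Quotient.sound (Or.inr (Or.inl ⟨r.refl' x, r.symm' hu⟩))
    · exact ⟨⟨Quotient.mk r u, fun k => hu (Quotient.exact k)⟩, rfl⟩

/-- The partition into the cycles of a permutation. -/
abbrev cyc (p : Perm D) : Setoid D := SameCycle.setoid p

theorem cyc_self_apply (p : Perm D) (x : D) : cyc p x (p x) :=
  (sameCycle_apply_right (f := p)).2 (SameCycle.refl p x)

theorem cyc_le_iff {p : Perm D} {r : Setoid D} : cyc p ≤ r ↔ ∀ x, r x (p x) := by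
  refine ⟨fun h x => h (cyc_self_apply p x), ?_⟩
  rintro h u v ⟨i, rfl⟩
  have key : ∀ n : ℕ, ∀ w, r w ((p ^ n) w) := by
    intro n
    induction n with
    | zero => exact fun w => r.refl' w
    | succ n ih =>
      intro w
      rw [pow_succ', Perm.mul_apply]
      exact r.trans' (ih w) (h _)
  obtain ⟨n, rfl | rfl⟩ := i.eq_nat_or_neg
  · exact key n u
  · have := key n ((p ^ (-(n : ℤ))) u)
    rw [← zpow_natCast, ← Perm.mul_apply, ← zpow_add] at this
    simp only [add_neg_cancel, zpow_zero, Perm.one_apply] at this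
    exact r.symm' this

variable [DecidableEq D]

theorem joinPair_cyc_swap_mul_le (p : Perm D) (x y : D) :
    (cyc (swap x y * p)).joinPair x y ≤ (cyc p).joinPair x y := by
  refine Setoid.joinPair_le (cyc_le_iff.2 fun z => ?_) (Setoid.joinPair_self _ x y)
  have h1 : (cyc p).joinPair x y z (p z) := Setoid.le_joinPair _ _ _ (cyc_self_apply p z)
  have h2 : (cyc p).joinPair x y x y := Setoid.joinPair_self _ x y
  rw [Perm.mul_apply, swap_apply_def]
  split_ifs with h h'
  · rw [h] at h1
    exact Setoid.trans' _ h1 h2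
  · rw [h'] at h1
    exact Setoid.trans' _ h1 (Setoid.symm' _ h2)
  · exact h1

theorem joinPair_cyc_swap_mul (p : Perm D) (x y : D) :
    (cyc (swap x y * p)).joinPair x y = (cyc p).joinPair x y := by
  refine le_antisymm (joinPair_cyc_swap_mul_le p x y) ?_
  have := joinPair_cyc_swap_mul_le (swap x y * p) x y
  rwa [swap_mul_self_mul] at this

theorem cyc_eq_joinPair_cyc_swap_mul {p : Perm D} {x y : D} (h : cyc p x y) :
    cyc p = (cyc (swap x y * p)).joinPair x y := by
  rw [joinPair_cyc_swap_mul, Setoid.joinPair_eq_self h]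

variable [Finite D]

/-- The cycle of `x` under `p` never meets `y`, so up to its first return to `x` both permutations
agree; at the return the transposition sends the point to `y` instead. -/
theorem cyc_swap_mul_of_not_cyc {p : Perm D} {x y : D} (h : ¬ cyc p x y) :
    cyc (swap x y * p) x y := by
  obtain ⟨n, hn, hx⟩ : ∃ n : ℕ, 0 < n ∧ (p ^ n) x = x :=
    ⟨orderOf p, orderOf_pos p, by rw [pow_orderOf_eq_one]; rfl⟩
  have hex : ∃ n : ℕ, 0 < n ∧ (p ^ n) x = x := ⟨n, hn, hx⟩
  classical
  obtain ⟨hpos, hret⟩ := Nat.find_spec hex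
  have hmin : ∀ k, k < Nat.find hex → ¬ (0 < k ∧ (p ^ k) x = x) := fun k hk => Nat.find_min hex hk
  generalize Nat.find hex = k at hpos hret hmin
  have hy : ∀ i : ℕ, (p ^ i) x ≠ y := fun i hi => h ⟨i, by rw [zpow_natCast, hi]⟩
  have key : ∀ i < k, ((swap x y * p) ^ i) x = (p ^ i) x := by
    intro i
    induction i with
    | zero => intro; rfl
    | succ i ih =>
      intro hi
      rw [pow_succ', Perm.mul_apply, ih (by omega), Perm.mul_apply, ← Perm.mul_apply p,
        ← pow_succ', swap_apply_of_ne_of_ne (fun h' => hmin _ hi ⟨by omega, h'⟩) (hy _)]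
  obtain ⟨j, rfl⟩ : ∃ j, k = j + 1 := ⟨k - 1, by omega⟩
  refine ⟨(j + 1 : ℕ), ?_⟩
  rw [zpow_natCast, pow_succ', Perm.mul_apply, key j (by omega), Perm.mul_apply,
    ← Perm.mul_apply p, ← pow_succ', hret, swap_apply_left]

/-- If `k` is the first time at which `p` takes `x` to `y`, the new permutation jumps back to `x` at
that time. The new cycle of `x` therefore stays among the first `k` points of the old one. -/
theorem not_cyc_swap_mul_of_cyc {p : Perm D} {x y : D} (hxy : x ≠ y) (h : cyc p x y) :
    ¬ cyc (swap x y * p) x y := by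
  obtain ⟨n, hn⟩ := SameCycle.exists_nat_pow_eq h
  have hex : ∃ n : ℕ, (p ^ n) x = y := ⟨n, hn⟩
  classical
  have hret := Nat.find_spec hex
  have hmin : ∀ k, k < Nat.find hex → ¬ (p ^ k) x = y := fun k hk => Nat.find_min hex hk
  generalize Nat.find hex = k at hret hmin
  have hk : 0 < k := by
    rcases Nat.eq_zero_or_pos k with rfl | h'
    · exact absurd hret hxy
    · exact h'
  intro hc
  obtain ⟨m, hm⟩ := SameCycle.exists_nat_pow_eq hc
  have key : ∀ m : ℕ, ∃ i < k, ((swap x y * p) ^ m) x = (p ^ i) x := by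
    intro m
    induction m with
    | zero => exact ⟨0, hk, rfl⟩
    | succ m ih =>
      obtain ⟨i, hi, h'⟩ := ih
      rw [pow_succ', Perm.mul_apply, h', Perm.mul_apply, ← Perm.mul_apply p, ← pow_succ']
      by_cases hi' : i + 1 = k
      · rw [hi', hret, swap_apply_right]
        exact ⟨0, hk, rfl⟩
      · by_cases hx : (p ^ (i + 1)) x = x
        · exfalso
          have hlt : k - (i + 1) < k := by omega
          apply hmin _ hlt
          have : (p ^ (k - (i + 1))) ((p ^ (i + 1)) x) = y := by
            rw [← Perm.mul_apply, ← pow_add, Nat.sub_add_cancel (by omega), hret]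
          rwa [hx] at this
        · rw [swap_apply_of_ne_of_ne hx (hmin _ (by omega))]
          exact ⟨i + 1, by omega, rfl⟩
  obtain ⟨i, hi, h'⟩ := key m
  exact hmin i hi (by rw [← h', hm])

theorem cyc_swap_mul_eq_joinPair {p : Perm D} {x y : D} (h : ¬ cyc p x y) :
    cyc (swap x y * p) = (cyc p).joinPair x y := by
  rw [← joinPair_cyc_swap_mul, Setoid.joinPair_eq_self (cyc_swap_mul_of_not_cyc h)]

theorem numClasses_cyc_swap_mul_of_not_cyc {p : Perm D} {x y : D} (h : ¬ cyc p x y) :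
    (cyc (swap x y * p)).numClasses + 1 = (cyc p).numClasses := by
  rw [cyc_swap_mul_eq_joinPair h, Setoid.numClasses_joinPair h]

theorem numClasses_cyc_swap_mul_of_cyc {p : Perm D} {x y : D} (hxy : x ≠ y) (h : cyc p x y) :
    (cyc (swap x y * p)).numClasses = (cyc p).numClasses + 1 := by
  rw [cyc_eq_joinPair_cyc_swap_mul h, Setoid.numClasses_joinPair (not_cyc_swap_mul_of_cyc hxy h)]

theorem numClasses_cyc_swap_mul_le (p : Perm D) (x y : D) :
    (cyc (swap x y * p)).numClasses ≤ (cyc p).numClasses + 1 := by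
  by_cases hxy : x = y
  · subst hxy
    rw [swap_self]
    change (cyc (1 * p)).numClasses ≤ _
    rw [one_mul]
    exact Nat.le_succ _
  by_cases h : cyc p x y
  · rw [numClasses_cyc_swap_mul_of_cyc hxy h]
  · have := numClasses_cyc_swap_mul_of_not_cyc h
    omega

end Cycles

/-! ### Connected components and the genus inequality -/

section Euler

variable {D : Type*}

/-- The partition into the orbits of the group that two permutations generate. -/
def conn (p q : Perm D) : Setoid D := cyc p ⊔ cyc q

theorem conn_le_iff {p q : Perm D} {r : Setoid D} :
    conn p q ≤ r ↔ (∀ x, r x (p x)) ∧ ∀ x, r x (q x) := by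
  rw [conn, sup_le_iff, cyc_le_iff, cyc_le_iff]

theorem conn_apply_left (p q : Perm D) (x : D) : conn p q x (p x) := (conn_le_iff.1 le_rfl).1 x

theorem conn_apply_right (p q : Perm D) (x : D) : conn p q x (q x) := (conn_le_iff.1 le_rfl).2 x

theorem cyc_le_conn_left (p q : Perm D) : cyc p ≤ conn p q := le_sup_left

theorem cyc_le_conn_right (p q : Perm D) : cyc q ≤ conn p q := le_sup_right

/-- `p⁻¹ * q` and `q` generate the same group as `p` and `q`, so connectedness can be tested with
faces in place of vertices. -/
theorem conn_inv_mul (p q : Perm D) : conn (p⁻¹ * q) q = conn p q := by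
  refine le_antisymm (conn_le_iff.2 ⟨fun x => ?_, conn_apply_right p q⟩)
    (conn_le_iff.2 ⟨fun x => ?_, conn_apply_right _ q⟩)
  · rw [Perm.mul_apply]
    refine Setoid.trans' _ (conn_apply_right p q x) (Setoid.symm' _ ?_)
    have := conn_apply_left p q (p⁻¹ (q x))
    rwa [perm_apply_inv] at this
  · have h1 := conn_apply_left (p⁻¹ * q) q (q⁻¹ (p x))
    have h2 := conn_apply_right (p⁻¹ * q) q (q⁻¹ (p x))
    rw [Perm.mul_apply, perm_apply_inv, perm_inv_apply] at h1
    rw [perm_apply_inv] at h2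
    exact Setoid.trans' _ (Setoid.symm' _ h1) h2

theorem numClasses_cyc_one (D : Type*) : (cyc (1 : Perm D)).numClasses = Nat.card D := by
  symm
  refine Nat.card_eq_of_bijective (Quotient.mk _) ⟨fun x y h => ?_, Quotient.mk_surjective⟩
  exact sameCycle_one.1 (Quotient.exact h)

theorem conn_one_left (q : Perm D) : conn 1 q = cyc q :=
  le_antisymm (conn_le_iff.2 ⟨fun x => Setoid.refl' _ x, cyc_self_apply q⟩)
    (cyc_le_conn_right 1 q)

theorem Setoid.numClasses_le_card [Finite D] (r : Setoid D) : r.numClasses ≤ Nat.card D :=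
  Nat.card_le_card_of_surjective (Quotient.mk r) Quotient.mk_surjective

theorem Setoid.numClasses_le_one {D : Type*} [Finite D] {t : Setoid D} (ht : ∀ x y, t x y) :
    t.numClasses ≤ 1 := by
  have : Subsingleton (Quotient t) := ⟨fun x y => by
    induction x using Quotient.inductionOn with | _ x
    induction y using Quotient.inductionOn with | _ y
    exact Quotient.sound (ht x y)⟩
  exact Finite.card_le_one_iff_subsingleton.2 this

theorem conn_eq_joinPair_conn_swap_mul [DecidableEq D] [Finite D] {p : Perm D} (q : Perm D)
    {x y : D} (h : cyc p x y) : conn p q = (conn (swap x y * p) q).joinPair x y := by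
  apply le_antisymm
  · refine sup_le ?_ ((cyc_le_conn_right _ q).trans (Setoid.le_joinPair _ x y))
    rw [cyc_eq_joinPair_cyc_swap_mul h]
    exact Setoid.joinPair_le ((cyc_le_conn_left _ q).trans (Setoid.le_joinPair _ x y))
      (Setoid.joinPair_self _ x y)
  · refine Setoid.joinPair_le (sup_le ?_ (cyc_le_conn_right p q)) (cyc_le_conn_left p q h)
    have : cyc (swap x y * p) ≤ cyc p := by
      conv_rhs => rw [cyc_eq_joinPair_cyc_swap_mul h]
      exact Setoid.le_joinPair _ x y
    exact this.trans (cyc_le_conn_left p q)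

/-- The genus of a rotation system is nonnegative. -/
theorem numClasses_cyc_add_le [Finite D] (p q : Perm D) :
    (cyc p).numClasses + (cyc q).numClasses + (cyc (p⁻¹ * q)).numClasses ≤
      Nat.card D + 2 * (conn p q).numClasses := by
  classical
  -- Induction on the number of points minus the number of cycles of `p`: splitting a fixed point
  -- off a cycle lowers it by one, and `p = 1` gives equality.
  obtain ⟨n, hn⟩ : ∃ n, Nat.card D ≤ (cyc p).numClasses + n := ⟨_, Nat.le_add_left _ _⟩
  induction n generalizing p with
  | zero =>
    by_cases hp : p = 1
    · subst hp
      rw [inv_one, one_mul, conn_one_left, numClasses_cyc_one]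
      omega
    · obtain ⟨x, hx⟩ : ∃ x, p x ≠ x := by
        by_contra! h
        exact hp (Equiv.ext h)
      have := numClasses_cyc_swap_mul_of_cyc hx.symm (cyc_self_apply p x)
      have := Setoid.numClasses_le_card (cyc (swap x (p x) * p))
      omega
  | succ n ih =>
    by_cases hp : p = 1
    · subst hp
      rw [inv_one, one_mul, conn_one_left, numClasses_cyc_one]
      omega
    obtain ⟨x, hx⟩ : ∃ x, p x ≠ x := by
      by_contra! h
      exact hp (Equiv.ext h)
    have h1 := numClasses_cyc_swap_mul_of_cyc hx.symm (cyc_self_apply p x)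
    have h2 := ih (swap x (p x) * p) (by omega)
    -- The transposition applied to the vertices reappears, conjugated by `p`, as a transposition
    -- applied to the faces.
    have h3 : p⁻¹ * q = swap (p⁻¹ x) x * ((swap x (p x) * p)⁻¹ * q) := by
      have : swap (p⁻¹ x) x = p⁻¹ * swap x (p x) * p := by
        have := Equiv.swap_apply_apply p⁻¹ x (p x)
        rwa [perm_inv_apply, inv_inv] at this
      rw [this, mul_inv_rev, swap_inv]
      simp only [mul_assoc]
      rw [mul_inv_cancel_left, swap_mul_self_mul]
    have h4 := conn_eq_joinPair_conn_swap_mul q (cyc_self_apply p x)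
    -- If no component splits, the face count changes by at most one, which the vertex count
    -- compensates. If one splits, `p⁻¹ x` and `x` are in different components, so undoing the split
    -- merges two faces as well as two vertices, and this matches the term `2 * numClasses`.
    by_cases hc : conn (swap x (p x) * p) q x (p x)
    · rw [Setoid.joinPair_eq_self hc] at h4
      have := numClasses_cyc_swap_mul_le ((swap x (p x) * p)⁻¹ * q) (p⁻¹ x) x
      rw [← h3] at this
      rw [h4]
      omega
    · have h5 := Setoid.numClasses_joinPair hc
      rw [← h4] at h5
      have : ¬ cyc ((swap x (p x) * p)⁻¹ * q) (p⁻¹ x) x := by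
        intro k
        apply hc
        have k1 : conn (swap x (p x) * p) q (p⁻¹ x) x := by
          rw [← conn_inv_mul]
          exact cyc_le_conn_left _ q k
        have k2 := conn_apply_left (swap x (p x) * p) q (p⁻¹ x)
        rw [Perm.mul_apply, perm_apply_inv, swap_apply_left] at k2
        exact Setoid.trans' _ (Setoid.symm' _ k1) k2
      have := numClasses_cyc_swap_mul_of_not_cyc this
      rw [← h3] at this
      omega

end Euler

/-! ### Relabelling invariance and the switch of two edges -/

section Switch

variable {D D' : Type*}

theorem conn_iff_of_conj {p q : Perm D} {p' q' : Perm D'} (e : D ≃ D')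
    (hp : ∀ x, e (p x) = p' (e x)) (hq : ∀ x, e (q x) = q' (e x)) (x y : D) :
    conn p' q' (e x) (e y) ↔ conn p q x y := by
  constructor
  · have : conn p' q' ≤ Setoid.comap e.symm (conn p q) := by
      refine conn_le_iff.2 ⟨fun z => ?_, fun z => ?_⟩
      · obtain ⟨z, rfl⟩ := e.surjective z
        rw [Setoid.comap_rel, ← hp, e.symm_apply_apply, e.symm_apply_apply]
        exact conn_apply_left p q z
      · obtain ⟨z, rfl⟩ := e.surjective z
        rw [Setoid.comap_rel, ← hq, e.symm_apply_apply, e.symm_apply_apply]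
        exact conn_apply_right p q z
    intro h
    have := this h
    rwa [Setoid.comap_rel, e.symm_apply_apply, e.symm_apply_apply] at this
  · have : conn p q ≤ Setoid.comap e (conn p' q') := by
      refine conn_le_iff.2 ⟨fun z => ?_, fun z => ?_⟩
      · rw [Setoid.comap_rel, hp]
        exact conn_apply_left p' q' (e z)
      · rw [Setoid.comap_rel, hq]
        exact conn_apply_right p' q' (e z)
    exact fun h => this h

theorem numClasses_cyc_of_conj {p : Perm D} {p' : Perm D'} (e : D ≃ D')
    (hp : ∀ x, e (p x) = p' (e x)) : (cyc p').numClasses = (cyc p).numClasses :=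
  (Nat.card_congr (RootedPlanarMap.cycleEquiv e hp)).symm

/-- A fixed-point-free involution has half as many cycles as there are points. -/
theorem two_mul_numClasses_cyc [Finite D] {α : Perm D} (h1 : ∀ x, α (α x) = x)
    (h2 : ∀ x, α x ≠ x) : 2 * (cyc α).numClasses = Nat.card D := by
  classical
  have := Fintype.ofFinite D
  rw [Nat.card_eq_fintype_card, ← Finset.card_univ, Setoid.numClasses, Nat.card_eq_fintype_card,
    Finset.card_eq_sum_card_fiberwise (f := Quotient.mk (cyc α)) (t := Finset.univ)
      (fun _ _ => Finset.mem_coe.2 (Finset.mem_univ _)), Finset.sum_const_nat (m := 2),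
    Finset.card_univ, mul_comm]
  intro q _
  induction q using Quotient.inductionOn with | _ x
  have : ({y ∈ Finset.univ | Quotient.mk (cyc α) y = Quotient.mk (cyc α) x} : Finset D) =
      {x, α x} := by
    ext y
    simp only [Finset.mem_filter, Finset.mem_univ, true_and, Finset.mem_insert,
      Finset.mem_singleton]
    constructor
    · intro h
      -- The set {z, α z} is constant along the cycles of `α`, which shows that a cycle has no
      -- further points.
      let r : Setoid D := Setoid.ker fun z => ({z, α z} : Finset D)
      have hr : cyc α ≤ r := cyc_le_iff.2 fun z => by
        change ({z, α z} : Finset D) = {α z, α (α z)}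
        rw [h1, Finset.pair_comm]
      have : ({y, α y} : Finset D) = {x, α x} := hr (Quotient.exact h)
      have hy : y ∈ ({x, α x} : Finset D) := this ▸ Finset.mem_insert_self _ _
      simpa using hy
    · rintro (rfl | rfl)
      · rfl
      · exact Quotient.sound ((cyc α).symm' (cyc_self_apply α x))
  rw [this, Finset.card_pair (h2 x).symm]

/-- The involution obtained from `α` by replacing the edges `{c, α c}` and `{d, α d}` by
`{c, α d}` and `{d, α c}`. -/
noncomputable def sw (α : Perm D) (c d : D) : Perm D := by
  classical exact swap c d * swap (α c) (α d) * α

theorem sw_def [DecidableEq D] (α : Perm D) (c d : D) :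
    sw α c d = swap c d * swap (α c) (α d) * α := by
  unfold sw
  congr!

/-- `c` and `d` lie on different edges of the involution `α`. -/
structure Switchable (α : Perm D) (c d : D) : Prop where
  invol : ∀ x, α (α x) = x
  ne_self : ∀ x, α x ≠ x
  ne : c ≠ d
  ne_apply : c ≠ α d

namespace Switchable

variable {α : Perm D} {c d : D} (h : Switchable α c d)

theorem cases_on (_ : Switchable α c d) {P : D → Prop} (hc : P c) (hd : P d) (hc' : P (α c)) (hd' : P (α d))
    (ho : ∀ x, x ≠ c → x ≠ d → x ≠ α c → x ≠ α d → P x) (x : D) : P x := by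
  by_cases h1 : x = c
  · rwa [h1]
  by_cases h2 : x = d
  · rwa [h2]
  by_cases h3 : x = α c
  · rwa [h3]
  by_cases h4 : x = α d
  · rwa [h4]
  exact ho x h1 h2 h3 h4

include h

theorem symm : Switchable α d c :=
  ⟨h.invol, h.ne_self, h.ne.symm, fun k => h.ne_apply (by rw [k, h.invol])⟩

theorem rev : Switchable α (α c) (α d) :=
  ⟨h.invol, h.ne_self, fun k => h.ne (α.injective k), fun k => h.ne_apply (α.injective k)⟩

theorem apply_ne : α c ≠ d := fun k => h.ne_apply (by rw [← k, h.invol])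

theorem apply_ne_apply : α c ≠ α d := fun k => h.ne (α.injective k)

theorem sw_left : sw α c d c = α d := by
  classical
  rw [sw_def, Perm.mul_apply, Perm.mul_apply, swap_apply_left,
    swap_apply_of_ne_of_ne h.ne_apply.symm (h.ne_self d)]

theorem sw_right : sw α c d d = α c := by
  classical
  rw [sw_def, Perm.mul_apply, Perm.mul_apply, swap_apply_right,
    swap_apply_of_ne_of_ne (h.ne_self c) h.apply_ne]

theorem sw_apply_left : sw α c d (α c) = d := by
  classical
  rw [sw_def, Perm.mul_apply, Perm.mul_apply, h.invol,
    swap_apply_of_ne_of_ne (h.ne_self c).symm h.ne_apply, swap_apply_left]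

theorem sw_apply_right : sw α c d (α d) = c := by
  classical
  rw [sw_def, Perm.mul_apply, Perm.mul_apply, h.invol,
    swap_apply_of_ne_of_ne h.apply_ne.symm (h.ne_self d).symm, swap_apply_right]

theorem sw_other {x : D} (h1 : x ≠ c) (h2 : x ≠ d) (h3 : x ≠ α c) (h4 : x ≠ α d) :
    sw α c d x = α x := by
  classical
  have h5 : α x ≠ α c := fun k => h1 (α.injective k)
  have h6 : α x ≠ α d := fun k => h2 (α.injective k)
  have h7 : α x ≠ c := fun k => h3 (by rw [← k, h.invol])
  have h8 : α x ≠ d := fun k => h4 (by rw [← k, h.invol])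
  rw [sw_def, Perm.mul_apply, Perm.mul_apply, swap_apply_of_ne_of_ne h5 h6,
    swap_apply_of_ne_of_ne h7 h8]

theorem sw_sw_apply (x : D) : sw α c d (sw α c d x) = x := by
  refine h.cases_on (P := fun x => sw α c d (sw α c d x) = x) ?_ ?_ ?_ ?_ (fun x h1 h2 h3 h4 => ?_) x
  · rw [h.sw_left, h.sw_apply_right]
  · rw [h.sw_right, h.sw_apply_left]
  · rw [h.sw_apply_left, h.sw_right]
  · rw [h.sw_apply_right, h.sw_left]
  · have h5 : α x ≠ α c := fun k => h1 (α.injective k)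
    have h6 : α x ≠ α d := fun k => h2 (α.injective k)
    have h7 : α x ≠ c := fun k => h3 (by rw [← k, h.invol])
    have h8 : α x ≠ d := fun k => h4 (by rw [← k, h.invol])
    rw [h.sw_other h1 h2 h3 h4, h.sw_other h7 h8 h5 h6, h.invol]

theorem sw_ne_self (x : D) : sw α c d x ≠ x := by
  refine h.cases_on (P := fun x => sw α c d x ≠ x) ?_ ?_ ?_ ?_ (fun x h1 h2 h3 h4 => ?_) x
  · rw [h.sw_left]
    exact h.ne_apply.symm
  · rw [h.sw_right]
    exact h.apply_ne
  · rw [h.sw_apply_left]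
    exact h.apply_ne.symm
  · rw [h.sw_apply_right]
    exact h.ne_apply
  · rw [h.sw_other h1 h2 h3 h4]
    exact h.ne_self x

theorem sw_symm : sw α d c = sw α c d := by
  ext x
  refine h.cases_on (P := fun x => sw α d c x = sw α c d x) ?_ ?_ ?_ ?_ (fun x h1 h2 h3 h4 => ?_) x
  · rw [h.sw_left, h.symm.sw_right]
  · rw [h.sw_right, h.symm.sw_left]
  · rw [h.sw_apply_left, h.symm.sw_apply_right]
  · rw [h.sw_apply_right, h.symm.sw_apply_left]
  · rw [h.sw_other h1 h2 h3 h4, h.symm.sw_other h2 h1 h4 h3]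

theorem sw_rev : sw α (α c) (α d) = sw α c d := by
  have h' := h.rev
  ext x
  refine h.cases_on (P := fun x => sw α (α c) (α d) x = sw α c d x) ?_ ?_ ?_ ?_
    (fun x h1 h2 h3 h4 => ?_) x
  · have := h'.sw_apply_left
    rw [h.invol] at this
    rw [this, h.sw_left]
  · have := h'.sw_apply_right
    rw [h.invol] at this
    rw [this, h.sw_right]
  · rw [h'.sw_left, h.invol, h.sw_apply_left]
  · rw [h'.sw_right, h.invol, h.sw_apply_right]
  · rw [h.sw_other h1 h2 h3 h4, h'.sw_other h3 h4 (by rwa [h.invol]) (by rwa [h.invol])]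

theorem switchable_sw : Switchable (sw α c d) c d :=
  ⟨h.sw_sw_apply, h.sw_ne_self, h.ne, by rw [h.sw_right]; exact (h.ne_self c).symm⟩

theorem sw_sw : sw (sw α c d) c d = α := by
  have h' := h.switchable_sw
  ext x
  refine h.cases_on (P := fun x => sw (sw α c d) c d x = α x) ?_ ?_ ?_ ?_
    (fun x h1 h2 h3 h4 => ?_) x
  · rw [h'.sw_left, h.sw_right]
  · rw [h'.sw_right, h.sw_left]
  · have := h'.sw_apply_right
    rw [h.sw_right] at this
    rw [this, h.invol]
  · have := h'.sw_apply_left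
    rw [h.sw_left] at this
    rw [this, h.invol]
  · rw [h'.sw_other h1 h2 (by rwa [h.sw_left]) (by rwa [h.sw_right]), h.sw_other h1 h2 h3 h4]

end Switchable

theorem sw_conj {α : Perm D} {α' : Perm D'} {c d : D} (e : D ≃ D')
    (he : ∀ x, e (α x) = α' (e x)) (x : D) :
    e (sw α c d x) = sw α' (e c) (e d) (e x) := by
  classical
  rw [sw_def, sw_def]
  simp only [Perm.mul_apply]
  rw [← he, ← he, ← he, e.injective.swap_apply, e.injective.swap_apply]

end Switch

/-! ### Maps described by their faces; parallel edges -/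

namespace RootedPlanarMap

variable {D D' : Type*} (m : RootedPlanarMap D)

theorem σ_eq : m.σ = m.α * m.φ⁻¹ := by
  rw [φ, mul_inv_rev, inv_inv, mul_inv_cancel_left]

theorem α_φ_inv_apply (x : D) : m.α (m.φ⁻¹ x) = m.σ x := by
  rw [m.σ_eq, Perm.mul_apply]

theorem origin_eq {x y : D} : m.origin x = m.origin y ↔ cyc m.σ x y := Quotient.eq

theorem face_eq {x y : D} : m.face x = m.face y ↔ cyc m.φ x y := Quotient.eq

/-- Transitivity of the generated group becomes a statement about the join of two equivalence
relations, whose universal property serves as induction principle below. -/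
theorem connected_iff {σ α : Perm D} :
    (∀ d d' : D, ∃ g ∈ Subgroup.closure {σ, α}, g d = d') ↔ ∀ x y, conn σ α x y := by
  constructor
  · intro h x y
    obtain ⟨g, hg, rfl⟩ := h x y
    have : ∀ x, conn σ α x (g x) := by
      induction hg using Subgroup.closure_induction with
      | mem g hg =>
        rcases hg with rfl | rfl
        · exact conn_apply_left g α
        · exact conn_apply_right σ g
      | one => exact fun x => Setoid.refl' _ x
      | mul f g _ _ hf hg => exact fun x => Setoid.trans' _ (hg x) (hf (g x))
      | inv g _ hg =>
        intro x
        have := hg (g⁻¹ x)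
        rw [perm_apply_inv] at this
        exact Setoid.symm' _ this
    exact this x
  · intro h
    let r : Setoid D :=
      { r := fun x y => ∃ g ∈ Subgroup.closure {σ, α}, g x = y
        iseqv := by
          refine ⟨fun x => ⟨1, one_mem _, rfl⟩, ?_, ?_⟩
          · rintro x y ⟨g, hg, rfl⟩
            exact ⟨g⁻¹, inv_mem hg, perm_inv_apply g x⟩
          · rintro x y z ⟨g, hg, rfl⟩ ⟨f, hf, rfl⟩
            exact ⟨f * g, mul_mem hf hg, rfl⟩ }
    have : conn σ α ≤ r := conn_le_iff.2
      ⟨fun x => ⟨σ, Subgroup.subset_closure (Or.inl rfl), rfl⟩,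
        fun x => ⟨α, Subgroup.subset_closure (Or.inr rfl), rfl⟩⟩
    exact fun x y => this (h x y)

theorem conn_φ_α_apply (x y : D) : conn m.φ m.α x y := by
  rw [φ, conn_inv_mul]
  exact connected_iff.1 m.connected x y

/-- Connectedness as an induction principle on equivalence relations. -/
theorem rel_of_closed {r : Setoid D} (h1 : ∀ x, r x (m.φ x)) (h2 : ∀ x, r x (m.α x)) (x y : D) :
    r x y := conn_le_iff.2 ⟨h1, h2⟩ (m.conn_φ_α_apply x y)

theorem euler_card [Finite D] : (cyc m.σ).numClasses + (cyc m.α).numClasses +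
    (cyc m.φ).numClasses = Nat.card D + 2 := by
  have h := m.euler
  have h' := two_mul_numClasses_cyc m.involutive m.fixedPointFree
  change (cyc m.σ).numClasses + (cyc m.φ).numClasses = (cyc m.α).numClasses + 2 at h
  omega

/-- A rooted planar map given by its face permutation. -/
@[simps α root]
def ofFaces [Finite D] (p q : Perm D) (root : D) (h1 : ∀ x, q (q x) = x) (h2 : ∀ x, q x ≠ x)
    (h3 : ∀ x y, conn p q x y)
    (h4 : (cyc (q * p⁻¹)).numClasses + (cyc q).numClasses + (cyc p).numClasses =
      Nat.card D + 2) : RootedPlanarMap D where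
  σ := q * p⁻¹
  α := q
  root := root
  involutive := h1
  fixedPointFree := h2
  connected := by
    rw [connected_iff, ← conn_inv_mul, mul_inv_rev, inv_inv, inv_mul_cancel_right]
    exact h3
  euler := by
    have h' := two_mul_numClasses_cyc h1 h2
    rw [mul_inv_rev, inv_inv, inv_mul_cancel_right]
    change (cyc (q * p⁻¹)).numClasses + (cyc p).numClasses = (cyc q).numClasses + 2
    omega

theorem ofFaces_φ [Finite D] {p q : Perm D} {root : D} {h1 : ∀ x, q (q x) = x}
    {h2 : ∀ x, q x ≠ x} {h3 : ∀ x y, conn p q x y}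
    {h4 : (cyc (q * p⁻¹)).numClasses + (cyc q).numClasses + (cyc p).numClasses =
      Nat.card D + 2} : (ofFaces p q root h1 h2 h3 h4).φ = p := by
  change (q * p⁻¹)⁻¹ * q = p
  rw [mul_inv_rev, inv_inv, inv_mul_cancel_right]

variable {m} in
theorem ext_faces {m' : RootedPlanarMap D} (h1 : m.φ = m'.φ) (h2 : m.α = m'.α)
    (h3 : m.root = m'.root) : m = m' :=
  RootedPlanarMap.ext (by rw [m.σ_eq, m'.σ_eq, h1, h2]) h2 h3

/-- `c` and `d` are distinct half-edges with the same initial and the same terminal vertex. -/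
def Parallel (c d : D) : Prop :=
  c ≠ d ∧ m.origin c = m.origin d ∧ m.origin (m.α c) = m.origin (m.α d)

/-- The half-edges that the cycle formed by two parallel edges separates from the root. -/
def inner (c d : D) : Set D := {x | ¬ conn m.φ (sw m.α c d) m.root x}

variable {m}

theorem Parallel.symm {c d : D} (h : m.Parallel c d) : m.Parallel d c :=
  ⟨h.1.symm, h.2.1.symm, h.2.2.symm⟩

theorem Parallel.rev {c d : D} (h : m.Parallel c d) : m.Parallel (m.α c) (m.α d) :=
  ⟨fun k => h.1 (m.α.injective k), h.2.2, by rw [m.involutive, m.involutive]; exact h.2.1⟩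

theorem Parallel.switchable {c d : D} (h : m.Parallel c d) (hm : m.IsLoopless) :
    Switchable m.α c d :=
  ⟨m.involutive, m.fixedPointFree, h.1, fun k => hm d (by rw [← k, h.2.1])⟩

theorem mem_inner {c d x : D} : x ∈ m.inner c d ↔ ¬ conn m.φ (sw m.α c d) m.root x := Iff.rfl

/-! ### Cutting along two parallel edges -/

section Jordan

variable [Finite D] {c d : D}

/-- With the faces kept fixed, the new vertex permutation is `swap c d * swap (α c) (α d) * σ`, and
each transposition cuts one of the two end vertices. These vertices are distinct because there are
no loops, so the first cut leaves `c` and `d` in one cycle. -/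
theorem numClasses_sw (h : m.Parallel c d) (hl : m.IsLoopless) :
    (cyc (sw m.α c d * m.φ⁻¹)).numClasses = (cyc m.σ).numClasses + 2 := by
  classical
  have h1 : cyc m.σ (m.α c) (m.α d) := m.origin_eq.1 h.2.2
  have h2 : cyc m.σ c d := m.origin_eq.1 h.2.1
  have hs := h.switchable hl
  have h3 := cyc_eq_joinPair_cyc_swap_mul h1
  have h4 : cyc (swap (m.α c) (m.α d) * m.σ) c d := by
    rw [h3] at h2
    have hle : cyc (swap (m.α c) (m.α d) * m.σ) ≤ cyc m.σ := by
      conv_rhs => rw [h3]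
      exact Setoid.le_joinPair _ _ _
    rcases h2 with k | ⟨k, -⟩ | ⟨k, -⟩
    · exact k
    · exact absurd (m.origin_eq.2 (hle k)) (hl c)
    · refine absurd (m.origin_eq.2 (hle k)) ?_
      rw [← h.2.2]
      exact hl c
  rw [sw_def, mul_assoc, ← m.σ_eq, mul_assoc, numClasses_cyc_swap_mul_of_cyc h.1 h4,
    numClasses_cyc_swap_mul_of_cyc hs.apply_ne_apply h1]

omit [Finite D] in
-- Once `c` and `d` are identified, the switched edges connect everything that the original edges
-- did. The cut therefore produces at most two components.
theorem conn_sw_joinPair (h : m.Parallel c d) (hl : m.IsLoopless) (x y : D) :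
    (conn m.φ (sw m.α c d)).joinPair c d x y := by
  have hs := h.switchable hl
  have hle := Setoid.le_joinPair (conn m.φ (sw m.α c d)) c d
  have hcd := Setoid.joinPair_self (conn m.φ (sw m.α c d)) c d
  refine m.rel_of_closed (fun z => hle (conn_apply_left _ _ z)) (fun z => ?_) x y
  have key : ∀ z, (conn m.φ (sw m.α c d)).joinPair c d z (sw m.α c d z) :=
    fun z => hle (conn_apply_right _ _ z)
  have kc := key c
  have kd := key d
  rw [hs.sw_left] at kc
  rw [hs.sw_right] at kd
  refine hs.cases_on (P := fun z => (conn m.φ (sw m.α c d)).joinPair c d z (m.α z))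
    ?_ ?_ ?_ ?_ (fun x h1 h2 h3 h4 => ?_) z
  · exact Setoid.trans' _ hcd kd
  · exact Setoid.trans' _ (Setoid.symm' _ hcd) kc
  · rw [m.involutive]
    exact Setoid.symm' _ (Setoid.trans' _ hcd kd)
  · rw [m.involutive]
    exact Setoid.symm' _ (Setoid.trans' _ (Setoid.symm' _ hcd) kc)
  · rw [← hs.sw_other h1 h2 h3 h4]
    exact key x

/-- A combinatorial Jordan curve theorem: two parallel edges separate the map. -/
theorem not_conn_sw (h : m.Parallel c d) (hl : m.IsLoopless) :
    ¬ conn m.φ (sw m.α c d) c d := by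
  intro hc
  have h1 := m.euler_card
  have h2 := numClasses_sw h hl
  have hs := h.switchable hl
  have h3 := numClasses_cyc_add_le (sw m.α c d * m.φ⁻¹) (sw m.α c d)
  have h4 := two_mul_numClasses_cyc hs.sw_sw_apply hs.sw_ne_self
  have h5 := two_mul_numClasses_cyc m.involutive m.fixedPointFree
  rw [← conn_inv_mul, mul_inv_rev, inv_inv, inv_mul_cancel_right] at h3
  have h6 : (conn m.φ (sw m.α c d)).numClasses ≤ 1 := by
    have h7 := conn_sw_joinPair h hl
    rw [Setoid.joinPair_eq_self hc] at h7
    exact Setoid.numClasses_le_one h7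
  omega

theorem conn_sw_or (h : m.Parallel c d) (hl : m.IsLoopless) (x : D) :
    conn m.φ (sw m.α c d) c x ∨ conn m.φ (sw m.α c d) d x := by
  rcases conn_sw_joinPair h hl c x with k | ⟨-, k⟩ | ⟨k, -⟩
  · exact Or.inl k
  · exact Or.inr k
  · exact absurd k (not_conn_sw h hl)

/-- Exactly one of two parallel half-edges is on the root side. -/
theorem mem_inner_iff_not_mem (h : m.Parallel c d) (hl : m.IsLoopless) :
    c ∈ m.inner c d ↔ d ∉ m.inner c d := by
  rw [mem_inner, mem_inner, not_not]
  have h1 := not_conn_sw h hl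
  rcases conn_sw_or h hl m.root with k | k
  · refine ⟨fun k' => absurd (Setoid.symm' _ k) k', fun k' => absurd (Setoid.trans' _ k k') h1⟩
  · exact ⟨fun _ => Setoid.symm' _ k, fun _ k' => h1 (Setoid.symm' _ (Setoid.trans' _ k k'))⟩

theorem inner_nonempty (h : m.Parallel c d) (hl : m.IsLoopless) : (m.inner c d).Nonempty := by
  by_cases hc : c ∈ m.inner c d
  · exact ⟨c, hc⟩
  · exact ⟨d, by_contra fun hd => hc ((mem_inner_iff_not_mem h hl).2 hd)⟩

omit [Finite D] in
theorem inner_rev (h : m.Parallel c d) (hl : m.IsLoopless) :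
    m.inner (m.α c) (m.α d) = m.inner c d := by
  rw [inner, (h.switchable hl).sw_rev, inner]

omit [Finite D] in
theorem inner_symm (h : m.Parallel c d) (hl : m.IsLoopless) : m.inner d c = m.inner c d := by
  rw [inner, (h.switchable hl).sw_symm, inner]

end Jordan

/-! ### Maximal bigon regions and the unfilled core edges -/

section Core

variable (m)

/-- The pairs of parallel half-edges `(c, d)` that bound a maximal bigon region, with `c` on the
root side of the cut. -/
def maxBigons : Set (D × D) :=
  {p | m.Parallel p.1 p.2 ∧ p.1 ∉ m.inner p.1 p.2 ∧
    ∀ c d, m.Parallel c d → m.inner p.1 p.2 ⊆ m.inner c d → m.inner c d ⊆ m.inner p.1 p.2}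

/-- The half-edges outside all bigon regions. -/
def outer : Set D :=
  {x | ∀ c d, m.Parallel c d → x ∉ m.inner c d ∧ m.α x ∉ m.inner c d}

variable {m}

theorem mem_maxBigons {c d : D} : (c, d) ∈ m.maxBigons ↔
    m.Parallel c d ∧ c ∉ m.inner c d ∧
      ∀ c' d', m.Parallel c' d' → m.inner c d ⊆ m.inner c' d' → m.inner c' d' ⊆ m.inner c d :=
  Iff.rfl

theorem isSimple_iff (hl : m.IsLoopless) : m.IsSimple ↔ ∀ c d, ¬ m.Parallel c d := by
  refine ⟨fun h c d k => k.1 (h.2 c d k.2.1 k.2.2), fun h => ⟨hl, fun c d h1 h2 => ?_⟩⟩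
  by_contra hne
  exact h c d ⟨hne, h1, h2⟩

/-- By finiteness, a parallel pair yields one with a region maximal under inclusion. Exactly one of
its two half-edges is on the root side, so one of the two orderings is admissible. -/
theorem isSimple_iff_maxBigons_eq_empty [Finite D] (hl : m.IsLoopless) :
    m.IsSimple ↔ m.maxBigons = ∅ := by
  rw [isSimple_iff hl]
  constructor
  · intro h
    ext ⟨c, d⟩
    exact ⟨fun k => absurd k.1 (h c d), fun k => absurd k (Set.notMem_empty _)⟩
  · intro h c d hcd
    let S : Set (Set D) := {I | ∃ c d, m.Parallel c d ∧ I = m.inner c d}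
    obtain ⟨I, hI⟩ := (Set.toFinite S).exists_maximal ⟨_, c, d, hcd, rfl⟩
    obtain ⟨c', d', h', rfl⟩ := hI.1
    have key : ∀ c d, m.Parallel c d → m.inner c' d' ⊆ m.inner c d →
        m.inner c d ⊆ m.inner c' d' := fun c d k hk => hI.2 ⟨c, d, k, rfl⟩ hk
    by_cases hc : c' ∈ m.inner c' d'
    · have : (d', c') ∈ m.maxBigons := by
        refine ⟨h'.symm, ?_, ?_⟩
        · change d' ∉ m.inner d' c'
          rw [inner_symm h' hl]
          exact (mem_inner_iff_not_mem h' hl).1 hc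
        · change ∀ c d, m.Parallel c d → m.inner d' c' ⊆ m.inner c d → m.inner c d ⊆ m.inner d' c'
          rw [inner_symm h' hl]
          exact key
      rw [h] at this
      exact this
    · have : (c', d') ∈ m.maxBigons := ⟨h', hc, key⟩
      rw [h] at this
      exact this

theorem outer_eq_univ (h : m.IsSimple) : m.outer = Set.univ :=
  Set.eq_univ_of_forall fun _ c d k => absurd k ((isSimple_iff h.1).1 h c d)

end Core

/-! ### Invariance of regions and core under isomorphism -/

section Transport

variable {m : RootedPlanarMap D} {m' : RootedPlanarMap D'}

theorem parallel_iff_of_conj {e : D ≃ D'} (hσ : ∀ d, e (m.σ d) = m'.σ (e d))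
    (hα : ∀ d, e (m.α d) = m'.α (e d)) (c d : D) :
    m'.Parallel (e c) (e d) ↔ m.Parallel c d := by
  unfold Parallel
  rw [← hα, ← hα, origin_eq_iff hσ, origin_eq_iff hσ, e.injective.ne_iff]

theorem mem_inner_iff_of_conj {e : D ≃ D'} (hσ : ∀ d, e (m.σ d) = m'.σ (e d))
    (hα : ∀ d, e (m.α d) = m'.α (e d)) (hr : e m.root = m'.root) (c d x : D) :
    e x ∈ m'.inner (e c) (e d) ↔ x ∈ m.inner c d := by
  rw [mem_inner, mem_inner, ← hr, conn_iff_of_conj e (conj_φ hσ hα) (sw_conj e hα)]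

theorem inner_eq_image_of_conj {e : D ≃ D'} (hσ : ∀ d, e (m.σ d) = m'.σ (e d))
    (hα : ∀ d, e (m.α d) = m'.α (e d)) (hr : e m.root = m'.root) (c d : D) :
    m'.inner (e c) (e d) = e '' m.inner c d := by
  ext x
  obtain ⟨x, rfl⟩ := e.surjective x
  rw [mem_inner_iff_of_conj hσ hα hr, e.injective.mem_set_image]

theorem mem_maxBigons_iff_of_conj {e : D ≃ D'} (hσ : ∀ d, e (m.σ d) = m'.σ (e d))
    (hα : ∀ d, e (m.α d) = m'.α (e d)) (hr : e m.root = m'.root) (c d : D) :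
    (e c, e d) ∈ m'.maxBigons ↔ (c, d) ∈ m.maxBigons := by
  rw [mem_maxBigons, mem_maxBigons, parallel_iff_of_conj hσ hα, mem_inner_iff_of_conj hσ hα hr]
  simp only [← e.forall_congr_right (q := fun _ => _), parallel_iff_of_conj hσ hα,
    inner_eq_image_of_conj hσ hα hr, Set.image_subset_image_iff e.injective]

theorem mem_outer_iff_of_conj {e : D ≃ D'} (hσ : ∀ d, e (m.σ d) = m'.σ (e d))
    (hα : ∀ d, e (m.α d) = m'.α (e d)) (hr : e m.root = m'.root) (x : D) :
    e x ∈ m'.outer ↔ x ∈ m.outer := by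
  constructor
  · intro h c d k
    have := h (e c) (e d) ((parallel_iff_of_conj hσ hα c d).2 k)
    rwa [← hα, mem_inner_iff_of_conj hσ hα hr, mem_inner_iff_of_conj hσ hα hr] at this
  · intro h c d k
    obtain ⟨c, rfl⟩ := e.surjective c
    obtain ⟨d, rfl⟩ := e.surjective d
    rw [← hα, mem_inner_iff_of_conj hσ hα hr, mem_inner_iff_of_conj hσ hα hr]
    exact h c d ((parallel_iff_of_conj hσ hα c d).1 k)

theorem ncard_maxBigons_of_iso (h : m.Iso m') : m.maxBigons.ncard = m'.maxBigons.ncard := by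
  obtain ⟨e, hσ, hα, hr⟩ := h
  rw [← Set.ncard_image_of_injective _ (e.prodCongr e).injective]
  congr 1
  ext ⟨c, d⟩
  obtain ⟨c, rfl⟩ := e.surjective c
  obtain ⟨d, rfl⟩ := e.surjective d
  rw [mem_maxBigons_iff_of_conj hσ hα hr]
  exact (e.prodCongr e).injective.mem_set_image (a := (c, d))

theorem ncard_outer_of_iso (h : m.Iso m') : m.outer.ncard = m'.outer.ncard := by
  obtain ⟨e, hσ, hα, hr⟩ := h
  rw [← Set.ncard_image_of_injective _ e.injective]
  congr 1
  ext c
  obtain ⟨c, rfl⟩ := e.surjective c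
  rw [mem_outer_iff_of_conj hσ hα hr, e.injective.mem_set_image]

end Transport

end RootedPlanarMap

/-! ### Permutations of a disjoint union -/

section Sum

variable {D₁ D₂ : Type*}

/-- The disjoint union of two equivalence relations. -/
def Setoid.sum (r : Setoid D₁) (s : Setoid D₂) : Setoid (D₁ ⊕ D₂) where
  r := Sum.LiftRel r s
  iseqv := by
    refine ⟨?_, ?_, ?_⟩
    · rintro (x | x)
      · exact .inl (r.refl' x)
      · exact .inr (s.refl' x)
    · rintro _ _ (h | h)
      · exact .inl (r.symm' h)
      · exact .inr (s.symm' h)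
    · rintro _ _ _ (h | h) (k | k)
      · exact .inl (r.trans' h k)
      · exact .inr (s.trans' h k)

variable (r : Setoid D₁) (s : Setoid D₂)

@[simp] theorem Setoid.sum_inl_inl {x y : D₁} : r.sum s (Sum.inl x) (Sum.inl y) ↔ r x y :=
  Sum.liftRel_inl_inl

@[simp] theorem Setoid.sum_inr_inr {x y : D₂} : r.sum s (Sum.inr x) (Sum.inr y) ↔ s x y :=
  Sum.liftRel_inr_inr

@[simp] theorem Setoid.not_sum_inl_inr {x : D₁} {y : D₂} : ¬ r.sum s (Sum.inl x) (Sum.inr y) :=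
  Sum.not_liftRel_inl_inr

@[simp] theorem Setoid.not_sum_inr_inl {x : D₁} {y : D₂} : ¬ r.sum s (Sum.inr y) (Sum.inl x) :=
  Sum.not_liftRel_inr_inl

theorem Setoid.sum_le_iff {r : Setoid D₁} {s : Setoid D₂} {t : Setoid (D₁ ⊕ D₂)} :
    r.sum s ≤ t ↔ r ≤ t.comap Sum.inl ∧ s ≤ t.comap Sum.inr := by
  refine ⟨fun h => ⟨fun x y k => h (.inl k), fun x y k => h (.inr k)⟩, ?_⟩
  rintro ⟨h1, h2⟩ _ _ (k | k)
  · exact h1 k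
  · exact h2 k

theorem Setoid.numClasses_sum [Finite D₁] [Finite D₂] :
    (r.sum s).numClasses = r.numClasses + s.numClasses := by
  unfold Setoid.numClasses
  rw [← Nat.card_sum]
  symm
  let f : Quotient r ⊕ Quotient s → Quotient (r.sum s) :=
    Sum.elim (Quotient.map Sum.inl fun _ _ h => .inl h) (Quotient.map Sum.inr fun _ _ h => .inr h)
  refine Nat.card_eq_of_bijective f ⟨?_, ?_⟩
  · rintro (x | x) (y | y) <;> induction x using Quotient.inductionOn with | _ x <;>
      induction y using Quotient.inductionOn with | _ y <;> intro h <;> have h := Quotient.exact h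
    · exact congrArg Sum.inl (Quotient.sound ((r.sum_inl_inl s).1 h))
    · exact absurd h (r.not_sum_inl_inr s)
    · exact absurd h (r.not_sum_inr_inl s)
    · exact congrArg Sum.inr (Quotient.sound ((r.sum_inr_inr s).1 h))
  · intro q
    induction q using Quotient.inductionOn with | _ x
    rcases x with x | x
    · exact ⟨Sum.inl (Quotient.mk r x), rfl⟩
    · exact ⟨Sum.inr (Quotient.mk s x), rfl⟩

theorem cyc_sumCongr (p : Perm D₁) (q : Perm D₂) : cyc (sumCongr p q) = (cyc p).sum (cyc q) := by
  apply le_antisymm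
  · rw [cyc_le_iff]
    rintro (x | x)
    · exact .inl (cyc_self_apply p x)
    · exact .inr (cyc_self_apply q x)
  · rw [Setoid.sum_le_iff, cyc_le_iff, cyc_le_iff]
    exact ⟨fun x => cyc_self_apply (sumCongr p q) (Sum.inl x),
      fun x => cyc_self_apply (sumCongr p q) (Sum.inr x)⟩

theorem conn_sumCongr (p p' : Perm D₁) (q q' : Perm D₂) :
    conn (sumCongr p q) (sumCongr p' q') = (conn p p').sum (conn q q') := by
  apply le_antisymm
  · rw [conn_le_iff]
    constructor <;> rintro (x | x)
    · exact .inl (conn_apply_left p p' x)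
    · exact .inr (conn_apply_left q q' x)
    · exact .inl (conn_apply_right p p' x)
    · exact .inr (conn_apply_right q q' x)
  · rw [Setoid.sum_le_iff, conn_le_iff, conn_le_iff]
    exact ⟨⟨fun x => conn_apply_left _ (sumCongr p' q') (Sum.inl x),
      fun x => conn_apply_right _ (sumCongr p' q') (Sum.inl x)⟩,
      ⟨fun x => conn_apply_left _ (sumCongr p' q') (Sum.inr x),
      fun x => conn_apply_right _ (sumCongr p' q') (Sum.inr x)⟩⟩

end Sum

/-! ### Inserting a map into an edge: connectedness -/

namespace RootedPlanarMap

variable {D : Type*}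

/-- A map stays connected when an edge that is not a bridge of the dual map is deleted from the
dual map. -/
theorem rel_of_closed_off_edge [Finite D] (m : RootedPlanarMap D) {a : D}
    (ha : m.origin a ≠ m.origin (m.α a)) {r : Setoid D} (h1 : ∀ x, r x (m.φ x))
    (h2 : ∀ x, x ≠ a → x ≠ m.α a → r x (m.α x)) (x y : D) : r x y := by
  classical
  -- This product joins the two end vertices of `a` into one cycle. Each of its steps is `φ⁻¹`
  -- followed by `α`, with `α` omitted on the edge of `a`, so its cycles lie within the classes of
  -- `r`, and `a` is related to `α a` without use of that edge.
  have hc : cyc (swap a (m.α a) * m.σ) a (m.α a) :=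
    cyc_swap_mul_of_not_cyc fun k => ha (m.origin_eq.2 k)
  have hle : cyc (swap a (m.α a) * m.σ) ≤ r := by
    refine cyc_le_iff.2 fun z => ?_
    obtain ⟨w, rfl⟩ := m.φ.surjective z
    rw [Perm.mul_apply, ← m.α_φ_inv_apply, perm_inv_apply]
    by_cases hw : w = a
    · rw [hw, swap_apply_right]
      exact r.symm' (h1 a)
    by_cases hw' : w = m.α a
    · rw [hw', m.involutive, swap_apply_left]
      exact r.symm' (h1 _)
    rw [swap_apply_of_ne_of_ne (fun k => hw' (by rw [← k, m.involutive]))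
      (fun k => hw (m.α.injective k))]
    exact r.trans' (r.symm' (h1 w)) (h2 w hw hw')
  have ha' : r a (m.α a) := hle hc
  refine m.rel_of_closed h1 (fun z => ?_) x y
  by_cases hz : z = a
  · rwa [hz]
  by_cases hz' : z = m.α a
  · rw [hz', m.involutive]
    exact r.symm' ha'
  exact h2 z hz hz'

variable {D₁ D₂ : Type*}

theorem switchable_sumCongr {q : Perm D₁} (h1 : ∀ x, q (q x) = x) (h2 : ∀ x, q x ≠ x) (a : D₁)
    (m₂ : RootedPlanarMap D₂) (b : D₂) :
    Switchable (sumCongr q m₂.α) (Sum.inl a) (Sum.inr b) where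
  invol := by
    rintro (x | x)
    · exact congrArg Sum.inl (h1 x)
    · exact congrArg Sum.inr (m₂.involutive x)
  ne_self := by
    rintro (x | x)
    · exact fun k => h2 x (Sum.inl_injective k)
    · exact fun k => m₂.fixedPointFree x (Sum.inr_injective k)
  ne := Sum.inl_ne_inr
  ne_apply := Sum.inl_ne_inr

section Splice

variable [Finite D₂] (p : Perm D₁) {q : Perm D₁} (h1 : ∀ x, q (q x) = x) (h2 : ∀ x, q x ≠ x)
  (a : D₁) (m₂ : RootedPlanarMap D₂) {b : D₂}
  (hm₂ : m₂.origin b ≠ m₂.origin (m₂.α b))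

include h1 h2 hm₂

/-- As `b` is not a loop, `m₂` stays connected in the dual sense without the edge of `b`, and the
switched edge attaches it to `a`. The involution `q` is arbitrary so that it can also be the
involution of a map already cut along a pair of parallel edges. -/
theorem conn_splice_inl_inr (y : D₂) : conn (sumCongr p m₂.φ)
    (sw (sumCongr q m₂.α) (Sum.inl a) (Sum.inr b)) (Sum.inl a) (Sum.inr y) := by
  have hs := switchable_sumCongr h1 h2 a m₂ b
  set R := conn (sumCongr p m₂.φ) (sw (sumCongr q m₂.α) (Sum.inl a) (Sum.inr b)) with hR
  have h3 : ∀ x y, R.comap Sum.inr x y := by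
    refine m₂.rel_of_closed_off_edge hm₂ (fun x => ?_) (fun x hx hx' => ?_)
    · exact conn_apply_left (sumCongr p m₂.φ) _ (Sum.inr x)
    · have := conn_apply_right (sumCongr p m₂.φ)
        (sw (sumCongr q m₂.α) (Sum.inl a) (Sum.inr b)) (Sum.inr x)
      rwa [hs.sw_other Sum.inr_ne_inl (fun k => hx (Sum.inr_injective k)) Sum.inr_ne_inl
        (fun k => hx' (Sum.inr_injective k))] at this
  have h4 := conn_apply_right (sumCongr p m₂.φ)
    (sw (sumCongr q m₂.α) (Sum.inl a) (Sum.inr b)) (Sum.inl a)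
  rw [hs.sw_left] at h4
  exact R.trans' h4 (h3 _ y)

/-- The inserted map acts as a longer edge: collapsing it onto `a` turns connections in the union
into connections of `p` and `q`, and conversely a passage through `m₂` replaces the edge {a, q a}.
-/
theorem conn_splice_inl_inl {x y : D₁} : conn (sumCongr p m₂.φ)
    (sw (sumCongr q m₂.α) (Sum.inl a) (Sum.inr b)) (Sum.inl x) (Sum.inl y) ↔
      conn p q x y := by
  have hs := switchable_sumCongr h1 h2 a m₂ b
  constructor
  · let f : D₁ ⊕ D₂ → D₁ := Sum.elim id fun _ => a
    have : conn (sumCongr p m₂.φ) (sw (sumCongr q m₂.α) (Sum.inl a) (Sum.inr b)) ≤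
        (conn p q).comap f := by
      refine conn_le_iff.2 ⟨?_, ?_⟩
      · rintro (z | z)
        · exact conn_apply_left p q z
        · exact Setoid.refl' (conn p q) a
      · refine hs.cases_on ?_ ?_ ?_ ?_ ?_
        · rw [hs.sw_left]
          exact Setoid.refl' (conn p q) a
        · rw [hs.sw_right]
          exact conn_apply_right p q a
        · rw [hs.sw_apply_left]
          exact Setoid.symm' _ (conn_apply_right p q a)
        · rw [hs.sw_apply_right]
          exact Setoid.refl' (conn p q) a
        · intro z k1 k2 k3 k4
          rw [hs.sw_other k1 k2 k3 k4]
          rcases z with z | z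
          · exact conn_apply_right p q z
          · exact Setoid.refl' (conn p q) a
    exact fun h => this h
  · have key := conn_splice_inl_inr p h1 h2 a m₂ hm₂
    set R := conn (sumCongr p m₂.φ) (sw (sumCongr q m₂.α) (Sum.inl a) (Sum.inr b)) with hR
    have h5 : R (Sum.inl a) (Sum.inl (q a)) := by
      have h4 := conn_apply_right (sumCongr p m₂.φ)
        (sw (sumCongr q m₂.α) (Sum.inl a) (Sum.inr b)) (Sum.inr b)
      rw [hs.sw_right] at h4
      exact R.trans' (key _) h4
    have : conn p q ≤ R.comap Sum.inl := by
      refine conn_le_iff.2 ⟨fun z => ?_, fun z => ?_⟩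
      · exact conn_apply_left (sumCongr p m₂.φ) _ (Sum.inl z)
      · by_cases hz : z = a
        · rw [hz]
          exact h5
        by_cases hz' : z = q a
        · rw [hz', h1]
          exact R.symm' h5
        have := conn_apply_right (sumCongr p m₂.φ)
          (sw (sumCongr q m₂.α) (Sum.inl a) (Sum.inr b)) (Sum.inl z)
        rwa [hs.sw_other (fun k => hz (Sum.inl_injective k)) Sum.inl_ne_inr
          (fun k => hz' (Sum.inl_injective k)) Sum.inl_ne_inr] at this
    exact fun h => this h

end Splice

/-! ### The glued map: planarity, vertices, loops -/

section Glue

/-- The involution of the map `glue h₁ h₂ a`. -/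
noncomputable def glueα (m₁ : RootedPlanarMap D₁) (m₂ : RootedPlanarMap D₂) (a : D₁) :
    Perm (D₁ ⊕ D₂) := sw (sumCongr m₁.α m₂.α) (Sum.inl a) (Sum.inr m₂.root)

theorem switchable_glue (m₁ : RootedPlanarMap D₁) (m₂ : RootedPlanarMap D₂) (a : D₁) :
    Switchable (sumCongr m₁.α m₂.α) (Sum.inl a) (Sum.inr m₂.root) :=
  switchable_sumCongr m₁.involutive m₁.fixedPointFree a m₂ m₂.root

section

variable {m₁ : RootedPlanarMap D₁} {m₂ : RootedPlanarMap D₂} (a : D₁)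

theorem glueα_left : glueα m₁ m₂ a (Sum.inl a) = Sum.inr (m₂.α m₂.root) :=
  (switchable_glue m₁ m₂ a).sw_left

theorem glueα_right : glueα m₁ m₂ a (Sum.inr m₂.root) = Sum.inl (m₁.α a) :=
  (switchable_glue m₁ m₂ a).sw_right

theorem glueα_apply_left : glueα m₁ m₂ a (Sum.inl (m₁.α a)) = Sum.inr m₂.root :=
  (switchable_glue m₁ m₂ a).sw_apply_left

theorem glueα_apply_right : glueα m₁ m₂ a (Sum.inr (m₂.α m₂.root)) = Sum.inl a :=
  (switchable_glue m₁ m₂ a).sw_apply_right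

theorem glueα_inl {x : D₁} (hx : x ≠ a) (hx' : x ≠ m₁.α a) :
    glueα m₁ m₂ a (Sum.inl x) = Sum.inl (m₁.α x) :=
  (switchable_glue m₁ m₂ a).sw_other (fun k => hx (Sum.inl_injective k)) Sum.inl_ne_inr
    (fun k => hx' (Sum.inl_injective k)) Sum.inl_ne_inr

theorem glueα_inr {x : D₂} (hx : x ≠ m₂.root) (hx' : x ≠ m₂.α m₂.root) :
    glueα m₁ m₂ a (Sum.inr x) = Sum.inr (m₂.α x) :=
  (switchable_glue m₁ m₂ a).sw_other Sum.inr_ne_inl (fun k => hx (Sum.inr_injective k))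
    Sum.inr_ne_inl (fun k => hx' (Sum.inr_injective k))

theorem sw_glueα : sw (glueα m₁ m₂ a) (Sum.inl a) (Sum.inr m₂.root) = sumCongr m₁.α m₂.α :=
  (switchable_glue m₁ m₂ a).sw_sw

end

variable [Finite D₁] [Finite D₂] {m₁ : RootedPlanarMap D₁} {m₂ : RootedPlanarMap D₂}
  (h₁ : m₁.IsLoopless) (h₂ : m₂.IsLoopless) (a : D₁)

include h₁ in
-- Both transpositions join different cycles: the first links the two disjoint parts, and the second
-- links classes that the first has not united, since the ends of `a` are distinct vertices. So
-- exactly two vertices are lost, as Euler's formula requires.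
theorem cyc_glue : ¬ ((cyc m₁.σ).sum (cyc m₂.σ)).joinPair (Sum.inl (m₁.α a))
      (Sum.inr (m₂.α m₂.root)) (Sum.inl a) (Sum.inr m₂.root) ∧
    cyc (glueα m₁ m₂ a * (sumCongr m₁.φ m₂.φ)⁻¹) =
      (((cyc m₁.σ).sum (cyc m₂.σ)).joinPair (Sum.inl (m₁.α a))
        (Sum.inr (m₂.α m₂.root))).joinPair (Sum.inl a) (Sum.inr m₂.root) := by
  classical
  have k1 : ¬ cyc m₁.σ a (m₁.α a) := fun k => h₁ a (m₁.origin_eq.2 k)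
  have e1 : sumCongr m₁.α m₂.α * (sumCongr m₁.φ m₂.φ)⁻¹ = sumCongr m₁.σ m₂.σ := by
    rw [sumCongr_inv, sumCongr_mul, ← m₁.σ_eq, ← m₂.σ_eq]
  have k2 : ¬ ((cyc m₁.σ).sum (cyc m₂.σ)).joinPair (Sum.inl (m₁.α a))
      (Sum.inr (m₂.α m₂.root)) (Sum.inl a) (Sum.inr m₂.root) := by
    rw [Setoid.joinPair_apply]
    simp only [Setoid.not_sum_inl_inr, Setoid.sum_inl_inl, false_and, or_false, false_or]
    exact fun k => k1 k.1
  refine ⟨k2, ?_⟩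
  have k3 : ¬ cyc (sumCongr m₁.σ m₂.σ) (Sum.inl (m₁.α a)) (Sum.inr (m₂.α m₂.root)) := by
    rw [cyc_sumCongr]
    exact Setoid.not_sum_inl_inr _ _
  rw [glueα, sw_def, mul_assoc, e1, mul_assoc]
  have k4 := cyc_swap_mul_eq_joinPair k3
  rw [cyc_sumCongr] at k4
  have k5 : ¬ cyc (swap (Sum.inl (m₁.α a)) (Sum.inr (m₂.α m₂.root)) * sumCongr m₁.σ m₂.σ)
      (Sum.inl a) (Sum.inr m₂.root) := by
    rwa [k4]
  have := cyc_swap_mul_eq_joinPair k5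
  rwa [k4] at this

/-- The map obtained from `m₁` by replacing the edge of `a` by the map `m₂`, opened at its root
edge. -/
noncomputable def glue : RootedPlanarMap (D₁ ⊕ D₂) :=
  ofFaces (sumCongr m₁.φ m₂.φ) (glueα m₁ m₂ a) (Sum.inl m₁.root)
    (switchable_glue m₁ m₂ a).sw_sw_apply (switchable_glue m₁ m₂ a).sw_ne_self
    (by
      have k1 := conn_splice_inl_inr m₁.φ m₁.involutive m₁.fixedPointFree a m₂ (h₂ m₂.root)
      have k2 : ∀ x, conn (sumCongr m₁.φ m₂.φ) (glueα m₁ m₂ a) (Sum.inl a) x := by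
        rintro (x | x)
        · exact (conn_splice_inl_inl m₁.φ m₁.involutive m₁.fixedPointFree a m₂ (h₂ m₂.root)).2
            (m₁.conn_φ_α_apply a x)
        · exact k1 x
      exact fun x y => Setoid.trans' _ (Setoid.symm' _ (k2 x)) (k2 y))
    (by
      obtain ⟨k1, k2⟩ := cyc_glue h₁ (m₂ := m₂) a
      have k3 := Setoid.numClasses_joinPair k1
      rw [← k2] at k3
      have k4 := Setoid.numClasses_joinPair
        (Setoid.not_sum_inl_inr (cyc m₁.σ) (cyc m₂.σ) (x := m₁.α a) (y := m₂.α m₂.root))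
      rw [Setoid.numClasses_sum] at k4
      have k5 := m₁.euler_card
      have k6 := m₂.euler_card
      have k7 := two_mul_numClasses_cyc m₁.involutive m₁.fixedPointFree
      have k8 := two_mul_numClasses_cyc m₂.involutive m₂.fixedPointFree
      have k9 := two_mul_numClasses_cyc (switchable_glue m₁ m₂ a).sw_sw_apply
        (switchable_glue m₁ m₂ a).sw_ne_self
      rw [cyc_sumCongr, Setoid.numClasses_sum]
      change 2 * (cyc (glueα m₁ m₂ a)).numClasses = _ at k9
      rw [Nat.card_sum] at k9 ⊢
      omega)

@[simp] theorem glue_α : (glue h₁ h₂ a).α = glueα m₁ m₂ a := rfl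

@[simp] theorem glue_root : (glue h₁ h₂ a).root = Sum.inl m₁.root := rfl

@[simp] theorem glue_φ : (glue h₁ h₂ a).φ = sumCongr m₁.φ m₂.φ := ofFaces_φ

theorem cyc_glue_σ : cyc (glue h₁ h₂ a).σ =
    (((cyc m₁.σ).sum (cyc m₂.σ)).joinPair (Sum.inl (m₁.α a))
        (Sum.inr (m₂.α m₂.root))).joinPair (Sum.inl a) (Sum.inr m₂.root) :=
  (cyc_glue h₁ a).2

/-- Two vertices of `m₁` could be merged only through one vertex of `m₂` that is both ends of its
root edge, which looplessness of `m₂` excludes. -/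
theorem glue_origin_inl_inl {x y : D₁} : (glue h₁ h₂ a).origin (Sum.inl x) =
    (glue h₁ h₂ a).origin (Sum.inl y) ↔ m₁.origin x = m₁.origin y := by
  have k2 : ¬ cyc m₂.σ m₂.root (m₂.α m₂.root) := fun k => h₂ _ (m₂.origin_eq.2 k)
  have k3 : ¬ cyc m₂.σ (m₂.α m₂.root) m₂.root := fun k => k2 ((cyc m₂.σ).symm' k)
  rw [origin_eq, origin_eq, cyc_glue_σ]
  simp only [Setoid.joinPair_apply, Setoid.not_sum_inl_inr, Setoid.sum_inl_inl,
    Setoid.not_sum_inr_inl, Setoid.sum_inr_inr, false_and, and_false, or_false, k2, k3]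

theorem glue_origin_inr_inr {x y : D₂} : (glue h₁ h₂ a).origin (Sum.inr x) =
    (glue h₁ h₂ a).origin (Sum.inr y) ↔ m₂.origin x = m₂.origin y := by
  have k2 : ¬ cyc m₁.σ a (m₁.α a) := fun k => h₁ _ (m₁.origin_eq.2 k)
  have k3 : ¬ cyc m₁.σ (m₁.α a) a := fun k => k2 ((cyc m₁.σ).symm' k)
  rw [origin_eq, origin_eq, cyc_glue_σ]
  simp only [Setoid.joinPair_apply, Setoid.not_sum_inl_inr, Setoid.sum_inl_inl,
    Setoid.not_sum_inr_inl, Setoid.sum_inr_inr, false_and, and_false, or_false, k2, k3]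

theorem glue_origin_inl_inr {x : D₁} {y : D₂} : (glue h₁ h₂ a).origin (Sum.inl x) =
    (glue h₁ h₂ a).origin (Sum.inr y) ↔
      (m₁.origin x = m₁.origin a ∧ m₂.origin y = m₂.origin m₂.root) ∨
      (m₁.origin x = m₁.origin (m₁.α a) ∧ m₂.origin y = m₂.origin (m₂.α m₂.root)) := by
  have k2 : ¬ cyc m₁.σ a (m₁.α a) := fun k => h₁ _ (m₁.origin_eq.2 k)
  have k3 : ¬ cyc m₁.σ (m₁.α a) a := fun k => k2 ((cyc m₁.σ).symm' k)
  rw [origin_eq, origin_eq, origin_eq, origin_eq, origin_eq, cyc_glue_σ, (cyc m₂.σ).comm',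
    (cyc m₂.σ).comm' (x := y)]
  simp only [Setoid.joinPair_apply, Setoid.not_sum_inl_inr, Setoid.sum_inl_inl,
    Setoid.not_sum_inr_inl, Setoid.sum_inr_inr, false_and, and_false, or_false, k2, k3]
  tauto

/-- The terminal vertices of half-edges of the first part are unchanged. -/
theorem glue_origin_α_inl (x : D₁) : (glue h₁ h₂ a).origin ((glue h₁ h₂ a).α (Sum.inl x)) =
    (glue h₁ h₂ a).origin (Sum.inl (m₁.α x)) := by
  rw [glue_α]
  by_cases hx : x = a
  · rw [hx, glueα_left, eq_comm, glue_origin_inl_inr]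
    exact Or.inr ⟨rfl, rfl⟩
  by_cases hx' : x = m₁.α a
  · rw [hx', glueα_apply_left, eq_comm, glue_origin_inl_inr, m₁.involutive]
    exact Or.inl ⟨rfl, rfl⟩
  rw [glueα_inl a hx hx']

theorem glue_origin_α_inr (x : D₂) : (glue h₁ h₂ a).origin ((glue h₁ h₂ a).α (Sum.inr x)) =
    (glue h₁ h₂ a).origin (Sum.inr (m₂.α x)) := by
  rw [glue_α]
  by_cases hx : x = m₂.root
  · rw [hx, glueα_right, glue_origin_inl_inr]
    exact Or.inr ⟨rfl, rfl⟩
  by_cases hx' : x = m₂.α m₂.root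
  · rw [hx', glueα_apply_right, glue_origin_inl_inr, m₂.involutive]
    exact Or.inl ⟨rfl, rfl⟩
  rw [glueα_inr a hx hx']

theorem glue_isLoopless : (glue h₁ h₂ a).IsLoopless := by
  rintro (x | x)
  · rw [glue_origin_α_inl, Ne, glue_origin_inl_inl]
    exact h₁ x
  · rw [glue_origin_α_inr, Ne, glue_origin_inr_inr]
    exact h₂ x

end Glue

end RootedPlanarMap

/-! ### Compositions of two switches -/

section SwitchTwice

variable {D D₁ D₂ : Type*}

theorem Switchable.of_ne {α : Perm D} {a b c d : D} (h : Switchable α a b) (h1 : c ≠ d)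
    (h2 : c ≠ α d) : Switchable α c d := ⟨h.invol, h.ne_self, h1, h2⟩

/-- Switches on disjoint pairs of edges commute. -/
theorem sw_sw_comm {α : Perm D} {a r c d : D} (h1 : Switchable α a r) (h2 : Switchable α c d)
    (h3 : Switchable α c a) (h4 : Switchable α c r) (h5 : Switchable α d a)
    (h6 : Switchable α d r) : sw (sw α a r) c d = sw (sw α c d) a r := by
  classical
  have e1 : sw α a r c = α c := h1.sw_other h3.ne h4.ne h3.ne_apply h4.ne_apply
  have e2 : sw α a r d = α d := h1.sw_other h5.ne h6.ne h5.ne_apply h6.ne_apply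
  have e3 : sw α c d a = α a :=
    h2.sw_other h3.ne.symm h5.ne.symm h3.apply_ne.symm h5.apply_ne.symm
  have e4 : sw α c d r = α r :=
    h2.sw_other h4.ne.symm h6.ne.symm h4.apply_ne.symm h6.apply_ne.symm
  rw [sw_def, e1, e2, sw_def (sw α c d), e3, e4, sw_def, sw_def]
  have k : ∀ {x y : D}, x ≠ a → x ≠ r → x ≠ α a → x ≠ α r → y ≠ a → y ≠ r → y ≠ α a →
      y ≠ α r → swap a r * swap (α a) (α r) * swap x y =
        swap x y * (swap a r * swap (α a) (α r)) := by
    intro x y x1 x2 x3 x4 y1 y2 y3 y4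
    rw [mul_swap_eq_swap_mul]
    simp only [Perm.mul_apply]
    rw [swap_apply_of_ne_of_ne x3 x4, swap_apply_of_ne_of_ne x1 x2,
      swap_apply_of_ne_of_ne y3 y4, swap_apply_of_ne_of_ne y1 y2]
  have k1 := k h3.ne h4.ne h3.ne_apply h4.ne_apply h5.ne h6.ne h5.ne_apply h6.ne_apply
  have k2 := k h3.apply_ne h4.apply_ne h3.apply_ne_apply h4.apply_ne_apply h5.apply_ne
    h6.apply_ne h5.apply_ne_apply h6.apply_ne_apply
  calc swap c d * swap (α c) (α d) * (swap a r * swap (α a) (α r) * α)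
      = swap c d * (swap (α c) (α d) * (swap a r * swap (α a) (α r))) * α := by
        simp only [mul_assoc]
    _ = swap c d * (swap a r * swap (α a) (α r)) * swap (α c) (α d) * α := by
        rw [← k2]
        simp only [mul_assoc]
    _ = _ := by
        rw [← k1]
        simp only [mul_assoc]

/-- The composition of two switches on three edges, in two ways. -/
theorem sw_sw_right {α : Perm D} {a r d : D} (h1 : Switchable α a r) (h2 : Switchable α a d)
    (h3 : Switchable α d r) : sw (sw α a r) r d = sw (sw α a d) a r := by
  have e1 : sw α a r d = α d := h1.sw_other h2.ne.symm h3.ne h2.apply_ne.symm h3.ne_apply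
  have e2 : sw α a d r = α r :=
    h2.sw_other h1.ne.symm h3.ne.symm h1.apply_ne.symm h3.apply_ne.symm
  have hs1 : Switchable (sw α a r) r d :=
    ⟨h1.sw_sw_apply, h1.sw_ne_self, h3.ne.symm, by rw [e1]; exact h3.apply_ne.symm⟩
  have hs2 : Switchable (sw α a d) a r :=
    ⟨h2.sw_sw_apply, h2.sw_ne_self, h1.ne, by rw [e2]; exact h1.ne_apply⟩
  ext x
  by_cases xa : x = a
  · rw [xa, hs2.sw_left, hs1.sw_other h1.ne h2.ne
      (by rw [h1.sw_right]; exact (h1.ne_self a).symm) (by rw [e1]; exact h2.ne_apply),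
      h1.sw_left, e2]
  by_cases xr : x = r
  · rw [xr, hs1.sw_left, hs2.sw_right, e1, h2.sw_left]
  by_cases xd : x = d
  · rw [xd, hs1.sw_right, hs2.sw_other h2.ne.symm h3.ne
      (by rw [h2.sw_left]; exact (h2.ne_self d).symm) (by rw [e2]; exact h3.ne_apply),
      h1.sw_right, h2.sw_right]
  by_cases xa' : x = α a
  · have := hs1.sw_apply_left
    rw [h1.sw_right] at this
    rw [xa', this, hs2.sw_other (h1.ne_self a) h1.apply_ne
      (by rw [h2.sw_left]; exact h2.apply_ne_apply) (by rw [e2]; exact h1.apply_ne_apply),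
      h2.sw_apply_left]
  by_cases xd' : x = α d
  · have k1 := hs1.sw_apply_right
    have k2 := hs2.sw_apply_left
    rw [e1] at k1
    rw [h2.sw_left] at k2
    rw [xd', k1, k2]
  by_cases xr' : x = α r
  · have k2 := hs2.sw_apply_right
    rw [e2] at k2
    rw [xr', k2, hs1.sw_other (h1.ne_self r) h3.ne_apply.symm
      (by rw [h1.sw_right]; exact h1.apply_ne_apply.symm)
      (by rw [e1]; exact h3.apply_ne_apply.symm), h1.sw_apply_right]
  rw [hs1.sw_other xr xd (by rwa [h1.sw_right]) (by rwa [e1]),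
    hs2.sw_other xa xr (by rwa [h2.sw_left]) (by rwa [e2]), h1.sw_other xa xr xa' xr',
    h2.sw_other xa xd xa' xd']

theorem sw_sw_left {α : Perm D} {a r d : D} (h1 : Switchable α a r) (h2 : Switchable α a d)
    (h3 : Switchable α d r) : sw (sw α a r) a d = sw (sw α a d) (α a) (α r) := by
  have e1 : sw α a r d = α d := h1.sw_other h2.ne.symm h3.ne h2.apply_ne.symm h3.ne_apply
  have hs : Switchable (sw α a r) a d :=
    ⟨h1.sw_sw_apply, h1.sw_ne_self, h2.ne, by rw [e1]; exact h2.ne_apply⟩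
  rw [← h2.sw_rev, ← sw_sw_right h1.rev h2.rev h3.rev, h1.sw_rev, ← hs.sw_rev, h1.sw_left, e1]

theorem sw_sumCongr_inl {q : Perm D₁} (q' : Perm D₂) {c d : D₁} :
    sw (sumCongr q q') (Sum.inl c) (Sum.inl d) = sumCongr (sw q c d) q' := by
  classical
  ext x
  rw [sw_def, sw_def]
  rcases x with x | x
  · change swap (Sum.inl c) (Sum.inl d) (swap (Sum.inl (q c)) (Sum.inl (q d)) (Sum.inl (q x))) =
      Sum.inl (swap c d (swap (q c) (q d) (q x)))
    rw [Sum.inl_injective.swap_apply, Sum.inl_injective.swap_apply]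
  · change swap (Sum.inl c) (Sum.inl d) (swap (Sum.inl (q c)) (Sum.inl (q d)) (Sum.inr (q' x))) =
      Sum.inr (q' x)
    rw [swap_apply_of_ne_of_ne Sum.inr_ne_inl Sum.inr_ne_inl,
      swap_apply_of_ne_of_ne Sum.inr_ne_inl Sum.inr_ne_inl]

end SwitchTwice

/-! ### Regions of a glued map -/

namespace RootedPlanarMap

variable {D₁ D₂ : Type*} [Finite D₁] [Finite D₂] {m₁ : RootedPlanarMap D₁}
  {m₂ : RootedPlanarMap D₂} (h₁ : m₁.IsLoopless) (h₂ : m₂.IsLoopless) {a : D₁}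

/-- If a cut of the glued map can be rewritten as a cut of `m₁` with `m₂` spliced in at `a'`, its
region is that of `m₁`, with `m₂` on the side of `a'`. The positions of a parallel pair relative to
`a` differ only in the choice of `a'`. -/
theorem mem_inner_glue {c d : D₁} (hs : Switchable m₁.α c d) {c' d' : D₁ ⊕ D₂} {a' : D₁} {b : D₂}
    (h : sw (glue h₁ h₂ a).α c' d' =
      sw (sumCongr (sw m₁.α c d) m₂.α) (Sum.inl a') (Sum.inr b)) :
    (∀ x, Sum.inl x ∈ (glue h₁ h₂ a).inner c' d' ↔ x ∈ m₁.inner c d) ∧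
      ∀ y, Sum.inr y ∈ (glue h₁ h₂ a).inner c' d' ↔ a' ∈ m₁.inner c d := by
  have e : ∀ x, x ∈ (glue h₁ h₂ a).inner c' d' ↔ ¬ conn (sumCongr m₁.φ m₂.φ)
      (sw (sumCongr (sw m₁.α c d) m₂.α) (Sum.inl a') (Sum.inr b)) (Sum.inl m₁.root) x := by
    intro x
    rw [mem_inner, h, glue_φ, glue_root]
  simp only [e, mem_inner]
  refine ⟨fun x => ?_, fun y => ?_⟩
  · rw [conn_splice_inl_inl m₁.φ hs.sw_sw_apply hs.sw_ne_self a' m₂ (h₂ b)]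
  · rw [← conn_splice_inl_inl m₁.φ hs.sw_sw_apply hs.sw_ne_self a' m₂ (h₂ b)]
    have := conn_splice_inl_inr m₁.φ hs.sw_sw_apply hs.sw_ne_self a' m₂ (h₂ b) y
    refine not_congr ⟨fun k => Setoid.trans' _ k (Setoid.symm' _ this),
      fun k => Setoid.trans' _ k this⟩

theorem parallel_glue_inl_inl {c d : D₁} :
    (glue h₁ h₂ a).Parallel (Sum.inl c) (Sum.inl d) ↔ m₁.Parallel c d := by
  unfold Parallel
  rw [glue_origin_α_inl, glue_origin_α_inl, glue_origin_inl_inl, glue_origin_inl_inl,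
    Sum.inl_injective.ne_iff]

theorem parallel_glue_root : (glue h₁ h₂ a).Parallel (Sum.inl a) (Sum.inr m₂.root) := by
  refine ⟨Sum.inl_ne_inr, ?_, ?_⟩
  · rw [glue_origin_inl_inr]
    exact Or.inl ⟨rfl, rfl⟩
  · rw [glue_origin_α_inl, glue_origin_α_inr, glue_origin_inl_inr]
    exact Or.inr ⟨rfl, rfl⟩

theorem parallel_glue_root' :
    (glue h₁ h₂ a).Parallel (Sum.inl (m₁.α a)) (Sum.inr (m₂.α m₂.root)) := by
  have := (parallel_glue_root h₁ h₂ (a := a)).rev.symm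
  rwa [glue_α, glueα_left, glueα_right] at this

/-- This switch undoes the gluing and leaves the disjoint union of two connected maps, the root
being in the first. -/
theorem inner_glue_root :
    (glue h₁ h₂ a).inner (Sum.inl a) (Sum.inr m₂.root) = Set.range Sum.inr := by
  ext x
  rw [mem_inner, glue_α, sw_glueα, glue_φ, glue_root, conn_sumCongr]
  rcases x with x | x
  · simp only [Setoid.sum_inl_inl, Set.mem_range, reduceCtorEq, exists_false, iff_false, not_not]
    exact m₁.conn_φ_α_apply _ _
  · simp

theorem inner_glue_root' :
    (glue h₁ h₂ a).inner (Sum.inl (m₁.α a)) (Sum.inr (m₂.α m₂.root)) = Set.range Sum.inr := by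
  have := inner_rev (parallel_glue_root h₁ h₂ (a := a)) (glue_isLoopless h₁ h₂ a)
  rw [glue_α, glueα_left, glueα_right, inner_glue_root] at this
  rw [← this, inner_symm (parallel_glue_root' h₁ h₂).symm (glue_isLoopless h₁ h₂ a)]

/-- A cycle of two edges away from the edge of `a` bounds the same region, with `m₂` inserted
if it surrounds `a`. -/
theorem mem_inner_glue_of_ne {c d : D₁} (h : m₁.Parallel c d) (h1 : c ≠ a) (h2 : c ≠ m₁.α a)
    (h3 : d ≠ a) (h4 : d ≠ m₁.α a) :
    (∀ x, Sum.inl x ∈ (glue h₁ h₂ a).inner (Sum.inl c) (Sum.inl d) ↔ x ∈ m₁.inner c d) ∧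
      ∀ y, Sum.inr y ∈ (glue h₁ h₂ a).inner (Sum.inl c) (Sum.inl d) ↔ a ∈ m₁.inner c d := by
  have hs := h.switchable h₁
  refine mem_inner_glue h₁ h₂ hs (b := m₂.root) ?_
  have hA := switchable_glue m₁ m₂ a
  rw [glue_α, glueα, sw_sw_comm hA
    (hA.of_ne (fun k => hs.ne (Sum.inl_injective k)) (fun k => hs.ne_apply (Sum.inl_injective k)))
    (hA.of_ne (fun k => h1 (Sum.inl_injective k)) (fun k => h2 (Sum.inl_injective k)))
    (hA.of_ne Sum.inl_ne_inr Sum.inl_ne_inr)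
    (hA.of_ne (fun k => h3 (Sum.inl_injective k)) (fun k => h4 (Sum.inl_injective k)))
    (hA.of_ne Sum.inl_ne_inr Sum.inl_ne_inr), sw_sumCongr_inl]

/-- The edge of `a` has become two edges. Pairing `d` with one of them or with the other leaves `m₂`
on the side of `a`, as here, or on the side of `α a`, as in `mem_inner_glue_left`. -/
theorem mem_inner_glue_right {d : D₁} (h : m₁.Parallel a d) :
    (∀ x, Sum.inl x ∈ (glue h₁ h₂ a).inner (Sum.inr m₂.root) (Sum.inl d) ↔ x ∈ m₁.inner a d) ∧
      ∀ y, Sum.inr y ∈ (glue h₁ h₂ a).inner (Sum.inr m₂.root) (Sum.inl d) ↔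
        a ∈ m₁.inner a d := by
  have hs := h.switchable h₁
  refine mem_inner_glue h₁ h₂ hs (b := m₂.root) ?_
  have hA := switchable_glue m₁ m₂ a
  rw [glue_α, glueα, sw_sw_right hA
    (hA.of_ne (fun k => hs.ne (Sum.inl_injective k)) (fun k => hs.ne_apply (Sum.inl_injective k)))
    (hA.of_ne Sum.inl_ne_inr Sum.inl_ne_inr), sw_sumCongr_inl]

theorem mem_inner_glue_left {d : D₁} (h : m₁.Parallel a d) :
    (∀ x, Sum.inl x ∈ (glue h₁ h₂ a).inner (Sum.inl a) (Sum.inl d) ↔ x ∈ m₁.inner a d) ∧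
      ∀ y, Sum.inr y ∈ (glue h₁ h₂ a).inner (Sum.inl a) (Sum.inl d) ↔
        m₁.α a ∈ m₁.inner a d := by
  have hs := h.switchable h₁
  refine mem_inner_glue h₁ h₂ hs (b := m₂.α m₂.root) ?_
  have hA := switchable_glue m₁ m₂ a
  rw [glue_α, glueα, sw_sw_left hA
    (hA.of_ne (fun k => hs.ne (Sum.inl_injective k)) (fun k => hs.ne_apply (Sum.inl_injective k)))
    (hA.of_ne Sum.inl_ne_inr Sum.inl_ne_inr), sw_sumCongr_inl]
  rfl

theorem parallel_glue_right {d : D₁} (h : m₁.Parallel a d) :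
    (glue h₁ h₂ a).Parallel (Sum.inr m₂.root) (Sum.inl d) := by
  refine ⟨Sum.inr_ne_inl, ?_, ?_⟩
  · rw [eq_comm, glue_origin_inl_inr]
    exact Or.inl ⟨h.2.1.symm, rfl⟩
  · rw [glue_origin_α_inl, glue_origin_α_inr, eq_comm, glue_origin_inl_inr]
    exact Or.inr ⟨h.2.2.symm, rfl⟩

/-- If the glued region is maximal then `a` is on the root side of all cycles of two edges. -/
theorem mem_outer_of_mem_maxBigons
    (h : (Sum.inl a, Sum.inr m₂.root) ∈ (glue h₁ h₂ a).maxBigons) : a ∈ m₁.outer := by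
  obtain ⟨-, -, hmax⟩ := h
  simp only [inner_glue_root] at hmax
  -- By maximality, no region that contains all of `m₂` contains a half-edge of `m₁`.
  have key : ∀ c d, (glue h₁ h₂ a).Parallel c d → (∀ y, Sum.inr y ∈ (glue h₁ h₂ a).inner c d) →
      ∀ x, Sum.inl x ∉ (glue h₁ h₂ a).inner c d := by
    intro c d hcd hy x hx
    have := hmax c d hcd (by rintro _ ⟨y, rfl⟩; exact hy y) hx
    simp at this
  -- For a curve through the edge of `a`, the copy of that edge is chosen that leaves `m₂` on the
  -- side of the offending half-edge.
  have key1 : ∀ d, m₁.Parallel a d → a ∉ m₁.inner a d ∧ m₁.α a ∉ m₁.inner a d := by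
    intro d hd
    constructor
    · intro ha
      obtain ⟨k1, k2⟩ := mem_inner_glue_right h₁ h₂ hd
      exact key _ _ (parallel_glue_right h₁ h₂ hd) (fun y => (k2 y).2 ha) a ((k1 a).2 ha)
    · intro ha
      obtain ⟨k1, k2⟩ := mem_inner_glue_left h₁ h₂ hd
      exact key _ _ ((parallel_glue_inl_inl h₁ h₂).2 hd) (fun y => (k2 y).2 ha) _ ((k1 _).2 ha)
  have key2 : ∀ d, m₁.Parallel (m₁.α a) d →
      a ∉ m₁.inner (m₁.α a) d ∧ m₁.α a ∉ m₁.inner (m₁.α a) d := by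
    intro d hd
    have hd' := hd.rev
    rw [m₁.involutive] at hd'
    rw [← inner_rev hd h₁, m₁.involutive]
    exact key1 _ hd'
  intro c d hcd
  by_cases h1 : c = a
  · subst h1
    exact key1 d hcd
  by_cases h2 : c = m₁.α a
  · subst h2
    exact key2 d hcd
  rw [← inner_symm hcd h₁]
  by_cases h3 : d = a
  · subst h3
    exact key1 c hcd.symm
  by_cases h4 : d = m₁.α a
  · subst h4
    exact key2 c hcd.symm
  rw [inner_symm hcd h₁]
  obtain ⟨k1, k2⟩ := mem_inner_glue_of_ne h₁ h₂ hcd h1 h2 h3 h4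
  have ha : a ∉ m₁.inner c d := fun ha =>
    key _ _ ((parallel_glue_inl_inl h₁ h₂).2 hcd) (fun y => (k2 y).2 ha) _ ((k1 _).2 ha)
  -- The curve avoids the edge of `a`, so both of its half-edges are on the same side.
  refine ⟨ha, fun hb => ha ?_⟩
  have hs := hcd.switchable h₁
  have h5 := conn_apply_right m₁.φ (sw m₁.α c d) a
  rw [hs.sw_other (Ne.symm h1) (Ne.symm h3) (fun k => h2 (by rw [k, m₁.involutive]))
    (fun k => h4 (by rw [k, m₁.involutive]))] at h5
  exact fun k => hb (Setoid.trans' _ k h5)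

/-! ### Gluing at a core edge: effect on regions and core -/

section Outer

variable (ha : a ∈ m₁.outer)

include ha

omit [Finite D₁] in
theorem apply_mem_outer : m₁.α a ∈ m₁.outer := by
  intro c d h
  rw [m₁.involutive]
  exact (ha c d h).symm

include h₁

/-- The switch makes {d, α a} an edge, so `d` is on the root side together with `α a`. But of `a`
and `d` exactly one is on the root side. -/
theorem not_parallel_of_mem_outer (d : D₁) : ¬ m₁.Parallel a d := by
  intro h
  obtain ⟨h1, h2⟩ := ha a d h
  have h3 : d ∈ m₁.inner a d := by
    by_contra h3
    exact h1 ((mem_inner_iff_not_mem h h₁).2 h3)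
  have h4 := conn_apply_right m₁.φ (sw m₁.α a d) d
  rw [(h.switchable h₁).sw_right] at h4
  rw [mem_inner, not_not] at h2
  exact h3 (Setoid.trans' _ h2 (Setoid.symm' _ h4))

theorem ne_of_parallel {c d : D₁} (h : m₁.Parallel c d) :
    c ≠ a ∧ c ≠ m₁.α a ∧ d ≠ a ∧ d ≠ m₁.α a := by
  have ha' := apply_mem_outer ha
  refine ⟨?_, ?_, ?_, ?_⟩ <;> rintro rfl
  · exact not_parallel_of_mem_outer h₁ ha _ h
  · exact not_parallel_of_mem_outer h₁ ha' _ h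
  · exact not_parallel_of_mem_outer h₁ ha _ h.symm
  · exact not_parallel_of_mem_outer h₁ ha' _ h.symm

theorem inner_glue_inl_inl {c d : D₁} (h : m₁.Parallel c d) :
    (glue h₁ h₂ a).inner (Sum.inl c) (Sum.inl d) = Sum.inl '' m₁.inner c d := by
  obtain ⟨k1, k2, k3, k4⟩ := ne_of_parallel h₁ ha h
  obtain ⟨k5, k6⟩ := mem_inner_glue_of_ne h₁ h₂ h k1 k2 k3 k4
  ext (x | x)
  · rw [k5, Sum.inl_injective.mem_set_image]
  · rw [k6]
    simpa using (ha c d h).1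

omit ha in
-- The curve meets `m₁` at most in the edge of `a`. Without that edge `m₁` is still connected in the
-- dual sense, because `a` is not a loop, so all of it remains on the root side.
theorem inner_glue_subset {c d : D₁ ⊕ D₂} (h : (glue h₁ h₂ a).Parallel c d)
    (hc : ∀ x, c = Sum.inl x → x = a ∨ x = m₁.α a)
    (hd : ∀ x, d = Sum.inl x → x = a ∨ x = m₁.α a) :
    (glue h₁ h₂ a).inner c d ⊆ Set.range Sum.inr := by
  have hs := h.switchable (glue_isLoopless h₁ h₂ a)
  have key : ∀ x y, (conn (glue h₁ h₂ a).φ (sw (glue h₁ h₂ a).α c d)).comap Sum.inl x y := by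
    refine m₁.rel_of_closed_off_edge (h₁ a) (fun x => ?_) (fun x hx hx' => ?_)
    · have := conn_apply_left (glue h₁ h₂ a).φ (sw (glue h₁ h₂ a).α c d) (Sum.inl x)
      rw [glue_φ] at this ⊢
      exact this
    · have := conn_apply_right (glue h₁ h₂ a).φ (sw (glue h₁ h₂ a).α c d) (Sum.inl x)
      have e : (glue h₁ h₂ a).α (Sum.inl x) = Sum.inl (m₁.α x) := glueα_inl a hx hx'
      have hne : ∀ c, (∀ x, c = Sum.inl x → x = a ∨ x = m₁.α a) →
          Sum.inl x ≠ c ∧ Sum.inl x ≠ (glue h₁ h₂ a).α c := by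
        intro c hc
        constructor
        · intro k
          rcases hc x k.symm with k | k
          exacts [hx k, hx' k]
        · intro k
          have : c = Sum.inl (m₁.α x) := by rw [← e, k, (glue h₁ h₂ a).involutive]
          rcases hc _ this with k | k
          · exact hx' (by rw [← k, m₁.involutive])
          · exact hx (m₁.α.injective k)
      rw [hs.sw_other (hne c hc).1 (hne d hd).1 (hne c hc).2 (hne d hd).2, e] at this
      exact this
  rintro (x | x) hx
  · exact absurd (key m₁.root x) hx
  · exact ⟨x, rfl⟩

/-- The two parts share only the ends of `a`. Hence `c` joins these two vertices, and it would be
parallel to `a` or to `α a` if it did not equal one of them. -/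
theorem parallel_glue_inl_inr {c : D₁} {d : D₂}
    (h : (glue h₁ h₂ a).Parallel (Sum.inl c) (Sum.inr d)) : c = a ∨ c = m₁.α a := by
  obtain ⟨-, h1, h2⟩ := h
  rw [glue_origin_α_inl, glue_origin_α_inr, glue_origin_inl_inr] at h2
  rw [glue_origin_inl_inr] at h1
  rcases h1 with ⟨h1, -⟩ | ⟨h1, -⟩
  · left
    by_contra hne
    rcases h2 with ⟨h2, -⟩ | ⟨h2, -⟩
    · exact h₁ c (h1.trans h2.symm)
    · exact not_parallel_of_mem_outer h₁ ha c ⟨Ne.symm hne, h1.symm, h2.symm⟩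
  · right
    by_contra hne
    rcases h2 with ⟨h2, -⟩ | ⟨h2, -⟩
    · refine not_parallel_of_mem_outer h₁ (apply_mem_outer ha) c ⟨Ne.symm hne, h1.symm, ?_⟩
      rw [m₁.involutive, h2]
    · exact h₁ c (h1.trans h2.symm)

/-- A cycle of two edges of the glued map lies in the first part or bounds a part of the second. -/
theorem parallel_glue_cases {c d : D₁ ⊕ D₂} (h : (glue h₁ h₂ a).Parallel c d) :
    (∃ c' d', c = Sum.inl c' ∧ d = Sum.inl d' ∧ m₁.Parallel c' d') ∨
      (glue h₁ h₂ a).inner c d ⊆ Set.range Sum.inr := by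
  rcases c with c | c <;> rcases d with d | d
  · exact Or.inl ⟨c, d, rfl, rfl, (parallel_glue_inl_inl h₁ h₂).1 h⟩
  · refine Or.inr (inner_glue_subset h₁ h₂ h ?_ (by simp))
    rintro x k
    rw [← Sum.inl_injective k]
    exact parallel_glue_inl_inr h₁ h₂ ha h
  · refine Or.inr (inner_glue_subset h₁ h₂ h (by simp) ?_)
    rintro x k
    rw [← Sum.inl_injective k]
    exact parallel_glue_inl_inr h₁ h₂ ha h.symm
  · exact Or.inr (inner_glue_subset h₁ h₂ h (by simp) (by simp))

theorem glue_maximal {c d : D₁ ⊕ D₂} (h : (glue h₁ h₂ a).Parallel c d)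
    (h' : Set.range Sum.inr ⊆ (glue h₁ h₂ a).inner c d) :
    (glue h₁ h₂ a).inner c d ⊆ Set.range Sum.inr := by
  rcases parallel_glue_cases h₁ h₂ ha h with ⟨c, d, rfl, rfl, k⟩ | k
  · rw [inner_glue_inl_inl h₁ h₂ ha k] at h' ⊢
    have := h' ⟨m₂.root, rfl⟩
    simp at this
  · exact k

theorem inl_inl_mem_maxBigons_glue {c d : D₁} :
    (Sum.inl c, Sum.inl d) ∈ (glue h₁ h₂ a).maxBigons ↔ (c, d) ∈ m₁.maxBigons := by
  rw [mem_maxBigons, mem_maxBigons, parallel_glue_inl_inl]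
  refine and_congr_right fun h => ?_
  rw [inner_glue_inl_inl h₁ h₂ ha h, Sum.inl_injective.mem_set_image]
  refine and_congr_right fun _ => ?_
  constructor
  · intro k c' d' h' hle
    have := k _ _ ((parallel_glue_inl_inl h₁ h₂).2 h')
    rw [inner_glue_inl_inl h₁ h₂ ha h', Set.image_subset_image_iff Sum.inl_injective,
      Set.image_subset_image_iff Sum.inl_injective] at this
    exact this hle
  · intro k c' d' h' hle
    rcases parallel_glue_cases h₁ h₂ ha h' with ⟨c', d', rfl, rfl, k'⟩ | k'
    · rw [inner_glue_inl_inl h₁ h₂ ha k', Set.image_subset_image_iff Sum.inl_injective] at hle ⊢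
      exact k _ _ k' hle
    · obtain ⟨x, hx⟩ := inner_nonempty h h₁
      have := k' (hle ⟨x, hx, rfl⟩)
      simp at this

omit ha in
theorem inner_glue_eq_of_maximal {c d : D₁ ⊕ D₂} (h : (c, d) ∈ (glue h₁ h₂ a).maxBigons)
    (h' : (glue h₁ h₂ a).inner c d ⊆ Set.range Sum.inr) :
    (glue h₁ h₂ a).inner c d = Set.range Sum.inr := by
  have := h.2.2 _ _ (parallel_glue_root h₁ h₂)
  rw [inner_glue_root] at this
  exact h'.antisymm (this h')

theorem inr_notMem_maxBigons_glue {c : D₂} {d : D₁ ⊕ D₂} :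
    (Sum.inr c, d) ∉ (glue h₁ h₂ a).maxBigons := by
  intro h
  rcases parallel_glue_cases h₁ h₂ ha h.1 with ⟨c, d, k, -⟩ | k
  · exact Sum.inr_ne_inl k
  · apply h.2.1
    change Sum.inr c ∈ (glue h₁ h₂ a).inner _ _
    rw [inner_glue_eq_of_maximal h₁ h₂ h k]
    exact ⟨c, rfl⟩

theorem inl_inr_mem_maxBigons_glue {c : D₁} {d : D₂} :
    (Sum.inl c, Sum.inr d) ∈ (glue h₁ h₂ a).maxBigons ↔
      (c = a ∧ d = m₂.root) ∨ (c = m₁.α a ∧ d = m₂.α m₂.root) := by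
  constructor
  · intro h
    have hI : (glue h₁ h₂ a).inner (Sum.inl c) (Sum.inr d) = Set.range Sum.inr := by
      rcases parallel_glue_cases h₁ h₂ ha h.1 with ⟨c, d, -, k, -⟩ | k
      · exact absurd k Sum.inr_ne_inl
      · exact inner_glue_eq_of_maximal h₁ h₂ h k
    have hs := h.1.switchable (glue_isLoopless h₁ h₂ a)
    -- Otherwise the switch would attach `α d`, a half-edge of `m₂`, to `c` on the root side,
    -- although all of `m₂` is in the region.
    have h1 : d = m₂.root ∨ d = m₂.α m₂.root := by
      by_contra! hd
      have k := conn_apply_right (glue h₁ h₂ a).φ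
        (sw (glue h₁ h₂ a).α (Sum.inl c) (Sum.inr d)) (Sum.inl c)
      rw [hs.sw_left, glue_α, glueα_inr a hd.1 hd.2] at k
      have k1 : Sum.inr (m₂.α d) ∈ (glue h₁ h₂ a).inner (Sum.inl c) (Sum.inr d) := by
        rw [hI]
        exact ⟨_, rfl⟩
      have k2 := h.2.1
      rw [mem_inner, not_not] at k2
      exact k1 (Setoid.trans' _ k2 k)
    have h2 := h.1.2.1
    rw [glue_origin_inl_inr] at h2
    rcases h1 with rfl | rfl <;> rcases parallel_glue_inl_inr h₁ h₂ ha h.1 with rfl | rfl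
    · exact Or.inl ⟨rfl, rfl⟩
    · rcases h2 with ⟨k, -⟩ | ⟨-, k⟩
      · exact absurd k.symm (h₁ _)
      · exact absurd k (h₂ _)
    · rcases h2 with ⟨-, k⟩ | ⟨k, -⟩
      · exact absurd k.symm (h₂ _)
      · exact absurd k (h₁ _)
    · exact Or.inr ⟨rfl, rfl⟩
  · rintro (⟨rfl, rfl⟩ | ⟨rfl, rfl⟩) <;> rw [mem_maxBigons]
    · rw [inner_glue_root]
      exact ⟨parallel_glue_root h₁ h₂, by simp, fun c d => glue_maximal h₁ h₂ ha⟩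
    · rw [inner_glue_root']
      exact ⟨parallel_glue_root' h₁ h₂, by simp, fun c d => glue_maximal h₁ h₂ ha⟩

/-- The new region contributes the glued pair and its reversal; thus each maximal region is counted
twice, just as each core edge is counted by its two half-edges. -/
theorem ncard_maxBigons_glue : (glue h₁ h₂ a).maxBigons.ncard = m₁.maxBigons.ncard + 2 := by
  have e : (glue h₁ h₂ a).maxBigons = Prod.map Sum.inl Sum.inl '' m₁.maxBigons ∪
      {(Sum.inl a, Sum.inr m₂.root), (Sum.inl (m₁.α a), Sum.inr (m₂.α m₂.root))} := by
    ext ⟨c | c, d | d⟩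
    · rw [inl_inl_mem_maxBigons_glue h₁ h₂ ha]
      simp
    · rw [inl_inr_mem_maxBigons_glue h₁ h₂ ha]
      simp
    · simp [inr_notMem_maxBigons_glue h₁ h₂ ha]
    · simp [inr_notMem_maxBigons_glue h₁ h₂ ha]
  rw [e, Set.ncard_union_eq, Set.ncard_image_of_injective _
    (Sum.inl_injective.prodMap Sum.inl_injective), Set.ncard_pair]
  · simpa using fun k : a = m₁.α a => absurd k.symm (m₁.fixedPointFree a)
  · rw [Set.disjoint_left]
    rintro _ ⟨⟨c, d⟩, -, rfl⟩
    simp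

/-- Only the two halves of the filled edge leave the set: the glued pair cuts each of them or its
partner off from the root. -/
theorem ncard_outer_glue : (glue h₁ h₂ a).outer.ncard + 2 = m₁.outer.ncard := by
  have e : (glue h₁ h₂ a).outer = Sum.inl '' (m₁.outer \ {a, m₁.α a}) := by
    have hr : ∀ {x}, x ∈ (glue h₁ h₂ a).outer →
        x ∉ Set.range Sum.inr ∧ (glue h₁ h₂ a).α x ∉ Set.range Sum.inr := by
      intro x hx
      have := hx _ _ (parallel_glue_root h₁ h₂)
      rwa [inner_glue_root] at this
    ext (x | x)
    · rw [Sum.inl_injective.mem_set_image]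
      constructor
      · intro hx
        have h1 : x ≠ a := by
          rintro rfl
          apply (hr hx).2
          rw [glue_α, glueα_left]
          exact ⟨_, rfl⟩
        have h2 : x ≠ m₁.α a := by
          rintro rfl
          apply (hr hx).2
          rw [glue_α, glueα_apply_left]
          exact ⟨_, rfl⟩
        refine ⟨fun c d h => ?_, by simp [h1, h2]⟩
        have := hx _ _ ((parallel_glue_inl_inl h₁ h₂).2 h)
        rwa [inner_glue_inl_inl h₁ h₂ ha h, glue_α, glueα_inl a h1 h2,
          Sum.inl_injective.mem_set_image, Sum.inl_injective.mem_set_image] at this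
      · rintro ⟨hx, hx'⟩
        simp only [Set.mem_insert_iff, Set.mem_singleton_iff, not_or] at hx'
        intro c d h
        rw [glue_α, glueα_inl a hx'.1 hx'.2]
        rcases parallel_glue_cases h₁ h₂ ha h with ⟨c, d, rfl, rfl, k⟩ | k
        · rw [inner_glue_inl_inl h₁ h₂ ha k, Sum.inl_injective.mem_set_image,
            Sum.inl_injective.mem_set_image]
          exact hx _ _ k
        · constructor <;> intro k' <;> have := k k' <;> simp at this
    · constructor
      · intro hx
        exact absurd ⟨x, rfl⟩ (hr hx).1
      · simp
  rw [e, Set.ncard_image_of_injective _ Sum.inl_injective,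
    ← Set.ncard_pair (m₁.fixedPointFree a).symm]
  refine Set.ncard_sdiff_add_ncard_of_subset ?_
  rintro x (rfl | rfl)
  exacts [ha, apply_mem_outer ha]

end Outer

end RootedPlanarMap

/-! ### Separability and pure gons of a glued map -/

namespace RootedPlanarMap

section Separable

variable {D : Type*}

/-- Separability in terms of sets of half-edges. -/
theorem isSeparable_iff {m : RootedPlanarMap D} : m.IsSeparable ↔
    ∃ X : Set D, (∀ x ∈ X, m.α x ∈ X) ∧ ∃ x ∈ X, ∃ y ∉ X, m.origin x = m.origin y ∧
      ∀ x' ∈ X, ∀ y' ∉ X, m.origin x' = m.origin y' → m.origin x' = m.origin x := by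
  constructor
  · rintro ⟨E₁, E₂, -, -, hu, hd, v, ⟨⟨e, he, x, hx, hxe⟩, e', he', y, hy, hye⟩, huniq⟩
    have h2 : ∀ e, e ∈ E₂ ↔ e ∉ E₁ := by
      intro e
      refine ⟨fun k k' => Set.disjoint_left.1 hd k' k, fun k => ?_⟩
      have : e ∈ E₁ ∪ E₂ := hu ▸ Set.mem_univ e
      exact this.resolve_left k
    have hα : ∀ x, m.edge (m.α x) = m.edge x := fun x =>
      Quotient.sound ((cyc m.α).symm' (cyc_self_apply m.α x))
    refine ⟨{x | m.edge x ∈ E₁}, fun x hx => ?_, x, ?_, y, ?_, hx.trans hy.symm, ?_⟩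
    · change m.edge (m.α x) ∈ E₁
      rwa [hα]
    · change m.edge x ∈ E₁
      rwa [hxe]
    · change m.edge y ∉ E₁
      rwa [hye, ← h2]
    · intro x' hx' y' hy' h
      rw [hx]
      exact huniq _ ⟨⟨_, hx', x', rfl, rfl⟩, _, (h2 _).2 hy', y', h.symm, rfl⟩
  · rintro ⟨X, hX, x, hx, y, hy, hxy, huniq⟩
    -- The kernel of membership has the classes `X` and its complement, so closure of `X` under `α`
    -- is a comparison with the cycles of `α`.
    let s : Setoid D := Setoid.ker fun x => x ∈ X
    have hs : cyc m.α ≤ s := cyc_le_iff.2 fun x => propext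
      ⟨fun k => hX x k, fun k => by have := hX _ k; rwa [m.involutive] at this⟩
    let E : Set m.Edge := {e | Quotient.lift (· ∈ X) (fun a b h => hs h) e}
    have hE : ∀ x, m.edge x ∈ E ↔ x ∈ X := fun x => Iff.rfl
    refine ⟨E, Eᶜ, ⟨m.edge x, hx⟩, ⟨m.edge y, hy⟩, Set.union_compl_self E, disjoint_compl_right,
      m.origin x, ⟨⟨_, hx, x, rfl, rfl⟩, _, hy, y, hxy.symm, rfl⟩, ?_⟩
    rintro _ ⟨⟨e, he, x', rfl, rfl⟩, e', he', y', hy', rfl⟩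
    exact huniq x' he y' he' hy'.symm

/-- A nontrivial set of edges of a connected map shares a vertex with its complement. -/
theorem exists_origin_eq (m : RootedPlanarMap D) {X : Set D} (hX : ∀ x ∈ X, m.α x ∈ X)
    (h1 : X.Nonempty) (h2 : Xᶜ.Nonempty) : ∃ x ∈ X, ∃ y ∉ X, m.origin x = m.origin y := by
  by_contra! h
  obtain ⟨x, hx⟩ := h1
  obtain ⟨y, hy⟩ := h2
  let s : Setoid D := Setoid.ker fun x => x ∈ X
  have key := connected_iff.1 m.connected x y
  have hs : conn m.σ m.α ≤ s := by
    refine conn_le_iff.2 ⟨fun x => ?_, fun x => propext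
      ⟨fun k => hX x k, fun k => by have := hX _ k; rwa [m.involutive] at this⟩⟩
    have ho : m.origin x = m.origin (m.σ x) := m.origin_eq.2 (cyc_self_apply m.σ x)
    refine propext ⟨fun k => ?_, fun k => ?_⟩
    · by_contra k'
      exact h x k _ k' ho
    · by_contra k'
      exact h _ k x k' ho.symm
  have : (x ∈ X) = (y ∈ X) := hs key
  exact hy (this ▸ hx)

/-- A map with more than one edge that has a loop is separable. -/
theorem isSeparable_of_loop {m : RootedPlanarMap D} {d : D} (hd : m.origin d = m.origin (m.α d))
    (h : ∃ x, x ≠ d ∧ x ≠ m.α d) : m.IsSeparable := by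
  rw [isSeparable_iff]
  have hX : ∀ x ∈ ({d, m.α d} : Set D), m.α x ∈ ({d, m.α d} : Set D) := by
    rintro x (rfl | rfl)
    · exact Or.inr rfl
    · rw [m.involutive]
      exact Or.inl rfl
  obtain ⟨z, hz⟩ := h
  obtain ⟨x, hx, y, hy, hxy⟩ := m.exists_origin_eq hX ⟨d, Or.inl rfl⟩
    ⟨z, by simpa using hz⟩
  refine ⟨_, hX, x, hx, y, hy, hxy, ?_⟩
  have : ∀ x ∈ ({d, m.α d} : Set D), m.origin x = m.origin d := by
    rintro x (rfl | rfl)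
    · rfl
    · exact hd.symm
  exact fun x' hx' _ _ _ => (this x' hx').trans (this x hx).symm

end Separable

variable {D₁ D₂ : Type*} [Finite D₁] [Finite D₂]

section

variable {m₁ : RootedPlanarMap D₁}
  {m₂ : RootedPlanarMap D₂} (h₁ : m₁.IsLoopless) (h₂ : m₂.IsLoopless) (a : D₁)

/-- Passing to the complement if necessary, the separating set can avoid `a`; then it survives a
gluing performed at `a`. -/
theorem exists_separating_notMem {D : Type*} {m : RootedPlanarMap D} (h : m.IsSeparable) (a : D) :
    ∃ X : Set D, (∀ x ∈ X, m.α x ∈ X) ∧ a ∉ X ∧ ∃ x ∈ X, ∃ y ∉ X, m.origin x = m.origin y ∧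
      ∀ x' ∈ X, ∀ y' ∉ X, m.origin x' = m.origin y' → m.origin x' = m.origin x := by
  obtain ⟨X, hX, x, hx, y, hy, hxy, huniq⟩ := isSeparable_iff.1 h
  by_cases ha : a ∈ X
  · refine ⟨Xᶜ, fun z hz k => hz ?_, fun k => k ha, y, hy, x, fun k => k hx, hxy.symm, ?_⟩
    · have := hX _ k
      rwa [m.involutive] at this
    · intro x' hx' y' hy' h
      rw [Set.mem_compl_iff, not_not] at hy'
      rw [h, huniq y' hy' x' hx' h.symm, hxy]
  · exact ⟨X, hX, ha, x, hx, y, hy, hxy, huniq⟩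

theorem glue_isSeparable_of_left (h : m₁.IsSeparable) : (glue h₁ h₂ a).IsSeparable := by
  obtain ⟨X, hX, ha, x, hx, y, hy, hxy, huniq⟩ := exists_separating_notMem h a
  have ha' : m₁.α a ∉ X := fun k => ha (by have := hX _ k; rwa [m₁.involutive] at this)
  rw [isSeparable_iff]
  refine ⟨Sum.inl '' X, ?_, Sum.inl x, ⟨x, hx, rfl⟩, Sum.inl y, by simpa using hy,
    (glue_origin_inl_inl h₁ h₂ a).2 hxy, ?_⟩
  · rintro _ ⟨z, hz, rfl⟩
    rw [glue_α, glueα_inl a (fun k => ha (k ▸ hz)) (fun k => ha' (k ▸ hz))]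
    exact ⟨_, hX z hz, rfl⟩
  · rintro _ ⟨z, hz, rfl⟩ (w | w) hw h
    · rw [glue_origin_inl_inl] at h ⊢
      exact huniq z hz w (fun k => hw ⟨w, k, rfl⟩) h
    · rw [glue_origin_inl_inr] at h
      rw [glue_origin_inl_inl]
      rcases h with ⟨h, -⟩ | ⟨h, -⟩
      · exact huniq z hz _ ha h
      · exact huniq z hz _ ha' h

theorem glue_isSeparable_of_right (h : m₂.IsSeparable) : (glue h₁ h₂ a).IsSeparable := by
  obtain ⟨X, hX, ha, x, hx, y, hy, hxy, huniq⟩ := exists_separating_notMem h m₂.root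
  have ha' : m₂.α m₂.root ∉ X := fun k => ha (by have := hX _ k; rwa [m₂.involutive] at this)
  rw [isSeparable_iff]
  refine ⟨Sum.inr '' X, ?_, Sum.inr x, ⟨x, hx, rfl⟩, Sum.inr y, by simpa using hy,
    (glue_origin_inr_inr h₁ h₂ a).2 hxy, ?_⟩
  · rintro _ ⟨z, hz, rfl⟩
    rw [glue_α, glueα_inr a (fun k => ha (k ▸ hz)) (fun k => ha' (k ▸ hz))]
    exact ⟨_, hX z hz, rfl⟩
  · rintro _ ⟨z, hz, rfl⟩ (w | w) hw h
    · rw [eq_comm, glue_origin_inl_inr] at h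
      rw [glue_origin_inr_inr]
      rcases h with ⟨-, h⟩ | ⟨-, h⟩
      · exact huniq z hz _ ha h
      · exact huniq z hz _ ha' h
    · rw [glue_origin_inr_inr] at h ⊢
      exact huniq z hz w (fun k => hw ⟨w, k, rfl⟩) h

/-- Connectedness provides a shared vertex for a nontrivial set, so it suffices to know that there
is at most one. This weaker hypothesis is what restricts to the parts of a glued map. -/
theorem eq_empty_or_univ_of_isTwoConnected {D : Type*} {m : RootedPlanarMap D}
    (h : m.IsTwoConnected) {X : Set D} (hX : ∀ x ∈ X, m.α x ∈ X)
    (huniq : ∀ x ∈ X, ∀ y ∉ X, m.origin x = m.origin y → ∀ x' ∈ X, ∀ y' ∉ X,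
      m.origin x' = m.origin y' → m.origin x' = m.origin x) : X = ∅ ∨ X = Set.univ := by
  by_contra! hne
  obtain ⟨x, hx, y, hy, hxy⟩ := m.exists_origin_eq hX hne.1 (Set.nonempty_compl.2 hne.2)
  exact h (isSeparable_iff.2 ⟨X, hX, x, hx, y, hy, hxy, huniq x hx y hy hxy⟩)

theorem glue_isTwoConnected (k₁ : m₁.IsTwoConnected) (k₂ : m₂.IsTwoConnected) :
    (glue h₁ h₂ a).IsTwoConnected := by
  intro h
  obtain ⟨X, hX, x, hx, y, hy, hxy, huniq⟩ := isSeparable_iff.1 h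
  have hu : ∀ x ∈ X, ∀ y ∉ X, (glue h₁ h₂ a).origin x = (glue h₁ h₂ a).origin y →
      ∀ x' ∈ X, ∀ y' ∉ X, (glue h₁ h₂ a).origin x' = (glue h₁ h₂ a).origin y' →
      (glue h₁ h₂ a).origin x' = (glue h₁ h₂ a).origin x := by
    intro x hx y hy hxy x' hx' y' hy' hxy'
    rw [huniq x hx y hy hxy, huniq x' hx' y' hy' hxy']
  have hX' : ∀ x, (glue h₁ h₂ a).α x ∈ X ↔ x ∈ X := fun x =>
    ⟨fun k => by have := hX _ k; rwa [(glue h₁ h₂ a).involutive] at this, hX x⟩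
  have e1 : Sum.inr (m₂.α m₂.root) ∈ X ↔ Sum.inl a ∈ X := by
    rw [← hX', glue_α, glueα_apply_right]
  have e2 : Sum.inl (m₁.α a) ∈ X ↔ Sum.inr m₂.root ∈ X := by
    rw [← hX', glue_α, glueα_apply_left]
  have o1 : (glue h₁ h₂ a).origin (Sum.inl a) = (glue h₁ h₂ a).origin (Sum.inr m₂.root) :=
    (glue_origin_inl_inr h₁ h₂ a).2 (Or.inl ⟨rfl, rfl⟩)
  have o2 : (glue h₁ h₂ a).origin (Sum.inl (m₁.α a)) =
      (glue h₁ h₂ a).origin (Sum.inr (m₂.α m₂.root)) :=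
    (glue_origin_inl_inr h₁ h₂ a).2 (Or.inr ⟨rfl, rfl⟩)
  -- If `X` contained only one of the two edges created by the gluing, both of their common end
  -- vertices would be shared with the complement; they are distinct, whereas only one shared vertex
  -- is allowed.
  have e3 : Sum.inl a ∈ X ↔ Sum.inr m₂.root ∈ X := by
    constructor
    · intro h1
      by_contra h2
      have := hu _ h1 _ h2 o1 _ (e1.2 h1) _ (fun k => h2 (e2.1 k)) o2.symm
      rw [o1, glue_origin_inr_inr] at this
      exact h₂ _ this.symm
    · intro h1
      by_contra h2
      have := hu _ h1 _ h2 o1.symm _ (e2.2 h1) _ (fun k => h2 (e1.1 k)) o2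
      rw [← o1, glue_origin_inl_inl] at this
      exact h₁ a this.symm
  have c1 : Sum.inl ⁻¹' X = (∅ : Set D₁) ∨ Sum.inl ⁻¹' X = (Set.univ : Set D₁) := by
    refine eq_empty_or_univ_of_isTwoConnected k₁ (fun z hz => ?_) ?_
    · by_cases z1 : z = a
      · rw [z1] at hz ⊢
        exact e2.2 (e3.1 hz)
      by_cases z2 : z = m₁.α a
      · rw [z2] at hz ⊢
        rw [m₁.involutive]
        exact e3.2 (e2.1 hz)
      have := hX _ hz
      rwa [glue_α, glueα_inl a z1 z2] at this
    · intro x hx y hy hxy x' hx' y' hy' hxy'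
      rw [← glue_origin_inl_inl h₁ h₂ a] at hxy hxy' ⊢
      exact hu _ hx _ hy hxy _ hx' _ hy' hxy'
  have c2 : Sum.inr ⁻¹' X = (∅ : Set D₂) ∨ Sum.inr ⁻¹' X = (Set.univ : Set D₂) := by
    refine eq_empty_or_univ_of_isTwoConnected k₂ (fun z hz => ?_) ?_
    · by_cases z1 : z = m₂.root
      · rw [z1] at hz ⊢
        exact e1.2 (e3.2 hz)
      by_cases z2 : z = m₂.α m₂.root
      · rw [z2] at hz ⊢
        rw [m₂.involutive]
        exact e3.1 (e1.1 hz)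
      have := hX _ hz
      rwa [glue_α, glueα_inr a z1 z2] at this
    · intro x hx y hy hxy x' hx' y' hy' hxy'
      rw [← glue_origin_inr_inr h₁ h₂ a] at hxy hxy' ⊢
      exact hu _ hx _ hy hxy _ hx' _ hy' hxy'
  have f1 : ∀ z, Sum.inl z ∈ X ↔ Sum.inl a ∈ X := by
    intro z
    rcases c1 with c1 | c1
    · exact iff_of_false (fun k => (c1 ▸ k : z ∈ (∅ : Set D₁))) (fun k => (c1 ▸ k : a ∈ (∅ : Set D₁)))
    · exact iff_of_true (c1.symm ▸ Set.mem_univ z : z ∈ Sum.inl ⁻¹' X)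
        (c1.symm ▸ Set.mem_univ a : a ∈ Sum.inl ⁻¹' X)
  have f2 : ∀ z, Sum.inr z ∈ X ↔ Sum.inr m₂.root ∈ X := by
    intro z
    rcases c2 with c2 | c2
    · exact iff_of_false (fun k => (c2 ▸ k : z ∈ (∅ : Set D₂)))
        (fun k => (c2 ▸ k : m₂.root ∈ (∅ : Set D₂)))
    · exact iff_of_true (c2.symm ▸ Set.mem_univ z : z ∈ Sum.inr ⁻¹' X)
        (c2.symm ▸ Set.mem_univ m₂.root : m₂.root ∈ Sum.inr ⁻¹' X)
  have f3 : ∀ z, z ∈ X ↔ Sum.inl a ∈ X := by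
    rintro (z | z)
    · exact f1 z
    · exact (f2 z).trans e3.symm
  exact hy ((f3 y).2 ((f3 x).1 hx))

theorem glue_isTwoConnected_iff :
    (glue h₁ h₂ a).IsTwoConnected ↔ m₁.IsTwoConnected ∧ m₂.IsTwoConnected :=
  ⟨fun h => ⟨fun k => h (glue_isSeparable_of_left h₁ h₂ a k),
    fun k => h (glue_isSeparable_of_right h₁ h₂ a k)⟩, fun h => glue_isTwoConnected h₁ h₂ a h.1 h.2⟩

/-- The vertices of the parts are vertices of the glued map. -/
theorem exists_vertex_map_left : ∃ f : m₁.Vertex → (glue h₁ h₂ a).Vertex, Function.Injective f ∧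
    ∀ x, f (m₁.origin x) = (glue h₁ h₂ a).origin (Sum.inl x) := by
  refine ⟨Quotient.lift (fun x => (glue h₁ h₂ a).origin (Sum.inl x)) fun x y h =>
    (glue_origin_inl_inl h₁ h₂ a).2 (Quotient.sound h), ?_, fun x => rfl⟩
  intro v w
  induction v using Quotient.inductionOn with | _ x
  induction w using Quotient.inductionOn with | _ y
  exact (glue_origin_inl_inl h₁ h₂ a).1

theorem exists_vertex_map_right : ∃ f : m₂.Vertex → (glue h₁ h₂ a).Vertex, Function.Injective f ∧
    ∀ x, f (m₂.origin x) = (glue h₁ h₂ a).origin (Sum.inr x) := by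
  refine ⟨Quotient.lift (fun x => (glue h₁ h₂ a).origin (Sum.inr x)) fun x y h =>
    (glue_origin_inr_inr h₁ h₂ a).2 (Quotient.sound h), ?_, fun x => rfl⟩
  intro v w
  induction v using Quotient.inductionOn with | _ x
  induction w using Quotient.inductionOn with | _ y
  exact (glue_origin_inr_inr h₁ h₂ a).1

theorem isPureGon_iff_of_injective {D D' : Type*} {m : RootedPlanarMap D}
    {m' : RootedPlanarMap D'} {i : D → D'} (hi : Function.Injective i) {f : m.Vertex → m'.Vertex}
    (hf : Function.Injective f) (hfi : ∀ x, f (m.origin x) = m'.origin (i x)) {F : m.Face}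
    {F' : m'.Face} (hF : {d | m'.face d = F'} = i '' {d | m.face d = F}) (ℓ : ℕ) :
    m'.IsPureGon ℓ F' ↔ m.IsPureGon ℓ F := by
  unfold IsPureGon degree faceVertices
  have : m'.origin '' (i '' {d | m.face d = F}) = f '' (m.origin '' {d | m.face d = F}) := by
    rw [Set.image_image, Set.image_image]
    simp only [hfi]
  rw [hF, this, Set.ncard_image_of_injective _ hi, Set.ncard_image_of_injective _ hf]

/-- Each face lies in one part with its half-edges unchanged, and the vertices of that part stay
distinct, so neither its degree nor its number of vertices changes. -/
theorem glue_pureGons (ℓ : ℕ) :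
    (glue h₁ h₂ a).pureGons ℓ = m₁.pureGons ℓ + m₂.pureGons ℓ := by
  have hc : cyc (glue h₁ h₂ a).φ = (cyc m₁.φ).sum (cyc m₂.φ) := by
    rw [glue_φ, cyc_sumCongr]
  have f1 : ∀ x y, (glue h₁ h₂ a).face (Sum.inl x) = (glue h₁ h₂ a).face (Sum.inl y) ↔
      m₁.face x = m₁.face y := by
    intro x y
    rw [face_eq, face_eq, hc, Setoid.sum_inl_inl]
  have f2 : ∀ x y, (glue h₁ h₂ a).face (Sum.inr x) = (glue h₁ h₂ a).face (Sum.inr y) ↔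
      m₂.face x = m₂.face y := by
    intro x y
    rw [face_eq, face_eq, hc, Setoid.sum_inr_inr]
  have f3 : ∀ x y, (glue h₁ h₂ a).face (Sum.inl x) ≠ (glue h₁ h₂ a).face (Sum.inr y) := by
    intro x y
    rw [Ne, face_eq, hc]
    exact Setoid.not_sum_inl_inr _ _
  obtain ⟨i, hi, hi'⟩ : ∃ i : m₁.Face → (glue h₁ h₂ a).Face, Function.Injective i ∧
      ∀ x, i (m₁.face x) = (glue h₁ h₂ a).face (Sum.inl x) := by
    refine ⟨Quotient.lift (fun x => (glue h₁ h₂ a).face (Sum.inl x)) fun x y h =>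
      (f1 x y).2 (Quotient.sound h), fun v w => ?_, fun x => rfl⟩
    induction v using Quotient.inductionOn with | _ x
    induction w using Quotient.inductionOn with | _ y
    exact (f1 x y).1
  obtain ⟨j, hj, hj'⟩ : ∃ i : m₂.Face → (glue h₁ h₂ a).Face, Function.Injective i ∧
      ∀ x, i (m₂.face x) = (glue h₁ h₂ a).face (Sum.inr x) := by
    refine ⟨Quotient.lift (fun x => (glue h₁ h₂ a).face (Sum.inr x)) fun x y h =>
      (f2 x y).2 (Quotient.sound h), fun v w => ?_, fun x => rfl⟩
    induction v using Quotient.inductionOn with | _ x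
    induction w using Quotient.inductionOn with | _ y
    exact (f2 x y).1
  obtain ⟨v, hv, hv'⟩ := exists_vertex_map_left h₁ h₂ a
  obtain ⟨w, hw, hw'⟩ := exists_vertex_map_right h₁ h₂ a
  have p1 : ∀ F, (glue h₁ h₂ a).IsPureGon ℓ (i F) ↔ m₁.IsPureGon ℓ F := by
    intro F
    refine isPureGon_iff_of_injective Sum.inl_injective hv hv' ?_ ℓ
    induction F using Quotient.inductionOn with | _ x
    ext (z | z)
    · rw [Sum.inl_injective.mem_set_image]
      change (glue h₁ h₂ a).face (Sum.inl z) = i (m₁.face x) ↔ m₁.face z = m₁.face x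
      rw [hi', f1]
    · simpa using fun k => f3 x z (k.trans (hi' x)).symm
  have p2 : ∀ F, (glue h₁ h₂ a).IsPureGon ℓ (j F) ↔ m₂.IsPureGon ℓ F := by
    intro F
    refine isPureGon_iff_of_injective Sum.inr_injective hw hw' ?_ ℓ
    induction F using Quotient.inductionOn with | _ x
    ext (z | z)
    · simpa using fun k => f3 z x (k.trans (hj' x))
    · rw [Sum.inr_injective.mem_set_image]
      change (glue h₁ h₂ a).face (Sum.inr z) = j (m₂.face x) ↔ m₂.face z = m₂.face x
      rw [hj', f2]
  have e : {F | (glue h₁ h₂ a).IsPureGon ℓ F} =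
      i '' {F | m₁.IsPureGon ℓ F} ∪ j '' {F | m₂.IsPureGon ℓ F} := by
    ext F
    constructor
    · intro h
      induction F using Quotient.inductionOn with | _ x
      rcases x with x | x
      · exact Or.inl ⟨m₁.face x, (p1 _).1 (by rw [hi']; exact h), hi' x⟩
      · exact Or.inr ⟨m₂.face x, (p2 _).1 (by rw [hj']; exact h), hj' x⟩
    · rintro (⟨F, h, rfl⟩ | ⟨F, h, rfl⟩)
      exacts [(p1 F).2 h, (p2 F).2 h]
  unfold pureGons
  rw [e, Set.ncard_union_eq, Set.ncard_image_of_injective _ hi, Set.ncard_image_of_injective _ hj]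
  rw [Set.disjoint_left]
  rintro _ ⟨F, -, rfl⟩ ⟨F', -, h⟩
  induction F using Quotient.inductionOn with | _ x
  induction F' using Quotient.inductionOn with | _ y
  exact f3 x y ((hi' x).symm.trans (h.symm.trans (hj' y)))

end

/-! ### Recovering the parts from a maximal region -/

section Cut

theorem origin_sw {D : Type*} {m : RootedPlanarMap D} {c d : D} (h : m.Parallel c d)
    (hl : m.IsLoopless) (x : D) : m.origin (sw m.α c d x) = m.origin (m.α x) := by
  have hs := h.switchable hl
  refine hs.cases_on (P := fun x => m.origin (sw m.α c d x) = m.origin (m.α x)) ?_ ?_ ?_ ?_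
    (fun x h1 h2 h3 h4 => ?_) x
  · rw [hs.sw_left, h.2.2]
  · rw [hs.sw_right, h.2.2]
  · rw [hs.sw_apply_left, m.involutive, h.2.1]
  · rw [hs.sw_apply_right, m.involutive, h.2.1]
  · rw [hs.sw_other h1 h2 h3 h4]

theorem exists_sumCongr {p : Perm (D₁ ⊕ D₂)} (h : ∀ x, p (Sum.inl x) ∉ Set.range Sum.inr) :
    ∃ p₁ p₂, p = sumCongr p₁ p₂ := by
  have : Set.MapsTo p (Set.range Sum.inl) (Set.range Sum.inl) := by
    rintro _ ⟨x, rfl⟩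
    have := h x
    rcases hp : p (Sum.inl x) with y | y
    · exact ⟨y, rfl⟩
    · exact absurd ⟨y, hp.symm⟩ this
  obtain ⟨⟨p₁, p₂⟩, h'⟩ := mem_sumCongrHom_range_of_perm_mapsTo_inl this
  exact ⟨p₁, p₂, h'.symm⟩

/-- A maximal pair of parallel edges decomposes a map as the result of gluing two maps. -/
theorem exists_glue {m : RootedPlanarMap (D₁ ⊕ D₂)} (hl : m.IsLoopless) {c d : D₁ ⊕ D₂}
    (h : (c, d) ∈ m.maxBigons) (hI : m.inner c d = Set.range Sum.inr) :
    ∃ (m₁ : RootedPlanarMap D₁) (m₂ : RootedPlanarMap D₂) (a : D₁) (h₁ : m₁.IsLoopless)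
      (h₂ : m₂.IsLoopless), a ∈ m₁.outer ∧ m = glue h₁ h₂ a ∧ c = Sum.inl a ∧
      d = Sum.inr m₂.root := by
  have hp := h.1
  have hc := h.2.1
  have hd : d ∈ m.inner c d := by
    by_contra hd
    exact hc ((mem_inner_iff_not_mem hp hl).2 hd)
  have hr : m.root ∉ m.inner c d := fun k => k (Setoid.refl' _ _)
  have hmem : ∀ x, x ∉ m.inner c d ↔ conn m.φ (sw m.α c d) m.root x := fun x => not_not
  have hcl : ∀ x y, conn m.φ (sw m.α c d) x y → x ∉ m.inner c d → y ∉ m.inner c d := by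
    intro x y hxy hx
    rw [hmem] at hx ⊢
    exact Setoid.trans' _ hx hxy
  change c ∉ m.inner c d at hc
  have hs := hp.switchable hl
  have hV := numClasses_sw hp hl
  have hor := conn_sw_or hp hl
  -- The switch preserves terminal vertices, so the vertices of the cut map refine those of `m`;
  -- hence the parts have no loops.
  have hle : cyc (sw m.α c d * m.φ⁻¹) ≤ cyc m.σ := by
    refine cyc_le_iff.2 fun x => m.origin_eq.1 ?_
    rw [Perm.mul_apply, origin_sw hp hl, m.α_φ_inv_apply]
    exact m.origin_eq.2 (cyc_self_apply m.σ x)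
  obtain ⟨p₁, p₂, ep⟩ := exists_sumCongr (p := m.φ) fun x => by
    rw [← hI]
    exact hcl _ _ (conn_apply_left _ _ (Sum.inl x)) (by rw [hI]; simp)
  obtain ⟨q₁, q₂, eq⟩ := exists_sumCongr (p := sw m.α c d) fun x => by
    rw [← hI]
    exact hcl _ _ (conn_apply_right _ _ (Sum.inl x)) (by rw [hI]; simp)
  rw [hI] at hc hd hr
  obtain ⟨r, rfl⟩ := hd
  obtain ⟨a, rfl⟩ : ∃ a, c = Sum.inl a := by
    rcases c with a | a
    · exact ⟨a, rfl⟩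
    · exact absurd ⟨a, rfl⟩ hc
  obtain ⟨s, hs'⟩ : ∃ s, m.root = Sum.inl s := by
    rcases hm : m.root with s | s
    · exact ⟨s, rfl⟩
    · exact absurd ⟨s, hm.symm⟩ hr
  have hinv := hs.sw_sw_apply
  have hne := hs.sw_ne_self
  have hss := hs.sw_sw
  have hos := origin_sw hp hl
  rw [eq] at hV hinv hne hss hle hor hos hmem
  rw [ep] at hV hle hor hmem
  rw [sumCongr_inv, sumCongr_mul, cyc_sumCongr] at hV hle
  rw [Setoid.numClasses_sum] at hV
  rw [conn_sumCongr] at hor hmem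
  have i₁ : ∀ x, q₁ (q₁ x) = x := fun x => Sum.inl_injective (hinv (Sum.inl x))
  have i₂ : ∀ x, q₂ (q₂ x) = x := fun x => Sum.inr_injective (hinv (Sum.inr x))
  have n₁ : ∀ x, q₁ x ≠ x := fun x k => hne (Sum.inl x) (congrArg Sum.inl k)
  have n₂ : ∀ x, q₂ x ≠ x := fun x k => hne (Sum.inr x) (congrArg Sum.inr k)
  have c₁ : ∀ x y, conn p₁ q₁ x y := by
    have : ∀ x, conn p₁ q₁ s x := by
      intro x
      have := (hmem (Sum.inl x)).1 (by rw [hI]; simp)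
      rwa [hs', Setoid.sum_inl_inl] at this
    exact fun x y => Setoid.trans' _ (Setoid.symm' _ (this x)) (this y)
  have c₂ : ∀ x y, conn p₂ q₂ x y := by
    have : ∀ x, conn p₂ q₂ r x := by
      intro x
      rcases hor (Sum.inr x) with k | k
      · exact absurd k (Setoid.not_sum_inl_inr _ _)
      · exact (Setoid.sum_inr_inr _ _).1 k
    exact fun x y => Setoid.trans' _ (Setoid.symm' _ (this x)) (this y)
  have u₁ := numClasses_cyc_add_le (q₁ * p₁⁻¹) q₁
  have u₂ := numClasses_cyc_add_le (q₂ * p₂⁻¹) q₂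
  rw [← conn_inv_mul, mul_inv_rev, inv_inv, inv_mul_cancel_right] at u₁ u₂
  have o₁ : (conn p₁ q₁).numClasses ≤ 1 := Setoid.numClasses_le_one c₁
  have o₂ : (conn p₂ q₂).numClasses ≤ 1 := Setoid.numClasses_le_one c₂
  have hE := m.euler_card
  have hF : (cyc m.φ).numClasses = (cyc p₁).numClasses + (cyc p₂).numClasses := by
    rw [ep, cyc_sumCongr, Setoid.numClasses_sum]
  have t₁ := two_mul_numClasses_cyc i₁ n₁
  have t₂ := two_mul_numClasses_cyc i₂ n₂
  have t := two_mul_numClasses_cyc m.involutive m.fixedPointFree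
  have hN : Nat.card (D₁ ⊕ D₂) = Nat.card D₁ + Nat.card D₂ := Nat.card_sum
  -- The Euler sums of the two parts add up to `Nat.card D₁ + Nat.card D₂ + 4`, and the genus
  -- inequality bounds each by its share, so both parts are planar.
  have E₁ : (cyc (q₁ * p₁⁻¹)).numClasses + (cyc q₁).numClasses + (cyc p₁).numClasses =
      Nat.card D₁ + 2 := by omega
  have E₂ : (cyc (q₂ * p₂⁻¹)).numClasses + (cyc q₂).numClasses + (cyc p₂).numClasses =
      Nat.card D₂ + 2 := by omega
  have l₁ : (ofFaces p₁ q₁ s i₁ n₁ c₁ E₁).IsLoopless := by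
    intro x k
    have k1 : cyc (q₁ * p₁⁻¹) x (q₁ x) := (origin_eq _).1 k
    have k2 := m.origin_eq.2 (hle (.inl k1))
    exact hl (Sum.inl x) (k2.trans (hos (Sum.inl x)))
  have l₂ : (ofFaces p₂ q₂ r i₂ n₂ c₂ E₂).IsLoopless := by
    intro x k
    have k1 : cyc (q₂ * p₂⁻¹) x (q₂ x) := (origin_eq _).1 k
    have k2 := m.origin_eq.2 (hle (.inr k1))
    exact hl (Sum.inr x) (k2.trans (hos (Sum.inr x)))
  have hg : m = glue l₁ l₂ a := by
    refine ext_faces ?_ ?_ hs'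
    · rw [glue_φ, ofFaces_φ, ofFaces_φ, ep]
    · rw [glue_α, glueα]
      exact hss.symm
  refine ⟨_, _, a, l₁, l₂, ?_, hg, rfl, rfl⟩
  rw [hg] at h
  exact mem_outer_of_mem_maxBigons l₁ l₂ h

/-- The face permutations can be read off directly and the involutions after switching back. The
root of the second part is the only datum that the glued map does not record. -/
theorem glue_injective {m₁ m₁' : RootedPlanarMap D₁} {m₂ m₂' : RootedPlanarMap D₂}
    {h₁ : m₁.IsLoopless} {h₂ : m₂.IsLoopless} {h₁' : m₁'.IsLoopless} {h₂' : m₂'.IsLoopless}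
    {a : D₁} (h : glue h₁ h₂ a = glue h₁' h₂' a) (hr : m₂.root = m₂'.root) :
    m₁ = m₁' ∧ m₂ = m₂' := by
  have e1 := glue_φ h₁ h₂ a
  rw [h, glue_φ] at e1
  have e2 := glue_α h₁ h₂ a
  rw [h, glue_α] at e2
  have e3 := sw_glueα (m₁ := m₁) (m₂ := m₂) a
  rw [← e2, hr, sw_glueα] at e3
  have e4 := glue_root h₁ h₂ a
  rw [h, glue_root] at e4
  have k1 := sumCongrHom_injective (a₁ := (m₁'.φ, m₂'.φ)) (a₂ := (m₁.φ, m₂.φ)) e1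
  have k2 := sumCongrHom_injective (a₁ := (m₁'.α, m₂'.α)) (a₂ := (m₁.α, m₂.α)) e3
  simp only [Prod.mk.injEq] at k1 k2
  exact ⟨ext_faces k1.1.symm k2.1.symm (Sum.inl_injective e4).symm,
    ext_faces k1.2.symm k2.2.symm hr⟩

end Cut

end RootedPlanarMap

/-! ### Relabelling and rigidity of rooted maps -/

namespace RootedPlanarMap

section Map

variable {D D' : Type*}

/-- Relabelling of the half-edges. -/
@[simps]
def map (e : D ≃ D') (m : RootedPlanarMap D) : RootedPlanarMap D' where
  σ := e.permCongr m.σ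
  α := e.permCongr m.α
  root := e m.root
  involutive d := by simp [m.involutive]
  fixedPointFree d := by
    rw [Equiv.permCongr_apply, Ne, ← Equiv.eq_symm_apply]
    exact m.fixedPointFree _
  connected := by
    rw [connected_iff]
    intro x y
    obtain ⟨x, rfl⟩ := e.surjective x
    obtain ⟨y, rfl⟩ := e.surjective y
    exact (conn_iff_of_conj e (by simp) (by simp) x y).2 (connected_iff.1 m.connected x y)
  euler := by
    have h1 := numClasses_cyc_of_conj (p := m.σ) (p' := e.permCongr m.σ) e (by simp)
    have h2 := numClasses_cyc_of_conj (p := m.α) (p' := e.permCongr m.α) e (by simp)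
    have h3 := numClasses_cyc_of_conj (p := m.σ⁻¹ * m.α)
      (p' := (e.permCongr m.σ)⁻¹ * e.permCongr m.α) e (fun x => by
        rw [Perm.mul_apply, Perm.mul_apply, Perm.eq_inv_iff_eq, permCongr_apply, permCongr_apply,
          symm_apply_apply, symm_apply_apply, perm_apply_inv])
    have h := m.euler
    change (cyc m.σ).numClasses + (cyc (m.σ⁻¹ * m.α)).numClasses = (cyc m.α).numClasses + 2 at h
    change (cyc (e.permCongr m.σ)).numClasses +
      (cyc ((e.permCongr m.σ)⁻¹ * e.permCongr m.α)).numClasses =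
      (cyc (e.permCongr m.α)).numClasses + 2
    omega

variable (e : D ≃ D') (m : RootedPlanarMap D)

theorem map_σ_conj (d : D) : e (m.σ d) = (m.map e).σ (e d) := by simp

theorem map_α_conj (d : D) : e (m.α d) = (m.map e).α (e d) := by simp

theorem iso_map : m.Iso (m.map e) := ⟨e, m.map_σ_conj e, m.map_α_conj e, rfl⟩

theorem map_map_symm : (m.map e).map e.symm = m :=
  RootedPlanarMap.ext (by ext; simp) (by ext; simp) (by simp)

theorem map_symm_map (m : RootedPlanarMap D') : (m.map e.symm).map e = m :=
  RootedPlanarMap.ext (by ext; simp) (by ext; simp) (by simp)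

theorem Iso.exists_eq_map {m : RootedPlanarMap D} {m' : RootedPlanarMap D'} (h : m.Iso m') :
    ∃ e : D ≃ D', m' = m.map e := by
  obtain ⟨e, hσ, hα, hr⟩ := h
  refine ⟨e, RootedPlanarMap.ext ?_ ?_ hr.symm⟩
  · ext x
    obtain ⟨x, rfl⟩ := e.surjective x
    rw [← hσ, ← map_σ_conj]
  · ext x
    obtain ⟨x, rfl⟩ := e.surjective x
    rw [← hα, ← map_α_conj]

/-- Relabelling as a bijection. -/
def mapEquiv : RootedPlanarMap D ≃ RootedPlanarMap D' where
  toFun := map e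
  invFun := map e.symm
  left_inv := map_map_symm e
  right_inv := map_symm_map e

/-- Rooted maps have no symmetries. -/
theorem map_left_injective : Function.Injective fun e : D ≃ D' => m.map e := by
  intro e e' h
  simp only at h
  have hσ : ∀ d, e (m.σ d) = (m.map e).σ (e d) := m.map_σ_conj e
  have hα : ∀ d, e (m.α d) = (m.map e).α (e d) := m.map_α_conj e
  have hr : e m.root = e' m.root := congrArg RootedPlanarMap.root h
  have hσ' : ∀ d, e' (m.σ d) = (m.map e).σ (e' d) := by
    rw [h]
    exact m.map_σ_conj e'
  have hα' : ∀ d, e' (m.α d) = (m.map e).α (e' d) := by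
    rw [h]
    exact m.map_α_conj e'
  -- The set on which `e` and `e'` agree is closed under `σ` and `α` and contains the root.
  let s : Setoid D := Setoid.ker fun x => e x = e' x
  have hs : conn m.σ m.α ≤ s := conn_le_iff.2
    ⟨fun x => by
      change (e x = e' x) = (e (m.σ x) = e' (m.σ x))
      rw [hσ, hσ', Equiv.apply_eq_iff_eq],
    fun x => by
      change (e x = e' x) = (e (m.α x) = e' (m.α x))
      rw [hα, hα', Equiv.apply_eq_iff_eq]⟩
  ext x
  have : (e m.root = e' m.root) = (e x = e' x) := hs (connected_iff.1 m.connected m.root x)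
  exact this ▸ hr

end Map

noncomputable instance {D : Type*} [Finite D] : Fintype (RootedPlanarMap D) := Fintype.ofFinite _

/-! ### Decomposition along a region, up to relabelling -/

section Decompose

variable {D : Type}

/-- The decomposition of a map along a maximal pair of parallel edges, up to relabelling. -/
theorem exists_map_glue {D₁ D₂ : Type} [Finite D₁] [Finite D₂] {m : RootedPlanarMap D}
    (hl : m.IsLoopless) {c d : D} (h : (c, d) ∈ m.maxBigons) (e : D₁ ⊕ D₂ ≃ D)
    (he : ∀ x, x ∈ m.inner c d ↔ ∃ y, e (Sum.inr y) = x) :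
    ∃ (m₁ : RootedPlanarMap D₁) (m₂ : RootedPlanarMap D₂) (a : D₁) (h₁ : m₁.IsLoopless)
      (h₂ : m₂.IsLoopless), a ∈ m₁.outer ∧ (glue h₁ h₂ a).map e = m ∧ e (Sum.inl a) = c ∧
      e (Sum.inr m₂.root) = d := by
  have hl' : (m.map e.symm).IsLoopless := hl.of_iso (m.iso_map e.symm)
  have h' := (mem_maxBigons_iff_of_conj (m.map_σ_conj e.symm) (m.map_α_conj e.symm) rfl c d).2 h
  have hI : (m.map e.symm).inner (e.symm c) (e.symm d) = Set.range Sum.inr := by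
    rw [inner_eq_image_of_conj (m.map_σ_conj e.symm) (m.map_α_conj e.symm) rfl]
    ext x
    rw [e.symm.image_eq_preimage_symm]
    simp [he]
  obtain ⟨m₁, m₂, a, h₁, h₂, ha, hm, hc, hd⟩ := exists_glue hl' h' hI
  refine ⟨m₁, m₂, a, h₁, h₂, ha, ?_, ?_, ?_⟩
  · rw [← hm, map_symm_map]
  · rw [← hc, e.apply_symm_apply]
  · rw [← hd, e.apply_symm_apply]

/-- The numbers of half-edges and of pairs of parallel half-edges that form the core are even, and
the core has at most as many edges as the map. -/
theorem exists_ncard_eq [Finite D] (m : RootedPlanarMap D) (hl : m.IsLoopless) :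
    ∃ k t, m.maxBigons.ncard = 2 * k ∧ m.outer.ncard = 2 * t ∧ 2 * (k + t) ≤ Nat.card D := by
  classical
  induction hn : m.maxBigons.ncard using Nat.strong_induction_on generalizing D with
  | _ n ih =>
    subst hn
    by_cases h : m.maxBigons = ∅
    · have hs := (isSimple_iff_maxBigons_eq_empty hl).2 h
      have h1 : m.outer.ncard = Nat.card D := by rw [outer_eq_univ hs, Set.ncard_univ]
      have h2 := two_mul_numClasses_cyc m.involutive m.fixedPointFree
      exact ⟨0, (cyc m.α).numClasses, by simp [h], by omega, by omega⟩
    · obtain ⟨⟨c, d⟩, hcd⟩ := Set.nonempty_iff_ne_empty.2 h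
      let e : {x // x ∉ m.inner c d} ⊕ {x // ¬ (x ∉ m.inner c d)} ≃ D :=
        Equiv.sumCompl (· ∉ m.inner c d)
      obtain ⟨m₁, m₂, a, h₁, h₂, ha, hm, -, -⟩ := exists_map_glue hl hcd e (fun x => by
        constructor
        · intro hx
          exact ⟨⟨x, not_not.2 hx⟩, rfl⟩
        · rintro ⟨y, rfl⟩
          exact not_not.1 y.2)
      have k1 := ncard_maxBigons_of_iso ((glue h₁ h₂ a).iso_map e)
      have k2 := ncard_outer_of_iso ((glue h₁ h₂ a).iso_map e)
      have k3 := ncard_maxBigons_glue h₁ h₂ ha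
      have k4 := ncard_outer_glue h₁ h₂ ha
      rw [hm] at k1 k2
      have k5 := Nat.card_congr e
      rw [Nat.card_sum] at k5
      obtain ⟨k, t, e1, e2, e3⟩ := ih _ (by omega) m₁ h₁ rfl
      -- Filling turns one unfilled edge into a region. The subtraction is genuine: `k4` gives `t ≥
      -- 1`.
      exact ⟨k + 1, t - 1, by omega, by omega, by omega⟩

end Decompose

/-! ### Double counting of marked regions -/

section Sums

variable {R : Type*} [CommRing R]

theorem sum_filter_mem {A B : Type*} [Fintype A] [Fintype B] (P : A → Prop) (S : A → Set B)
    (n : ℕ) (hn : ∀ x, P x → (S x).ncard = n) (f : A → R) [DecidablePred P]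
    [DecidablePred fun x : A × B => P x.1 ∧ x.2 ∈ S x.1] :
    ∑ x : A × B with P x.1 ∧ x.2 ∈ S x.1, f x.1 = n * ∑ x with P x, f x := by
  classical
  rw [Finset.sum_filter, Fintype.sum_prod_type, Finset.sum_filter, Finset.mul_sum]
  refine Finset.sum_congr rfl fun x _ => ?_
  by_cases hx : P x
  · simp only [hx, true_and, if_true]
    rw [← Finset.sum_filter, Finset.sum_const, nsmul_eq_mul, ← hn x hx, Set.ncard_eq_toFinset_card']
    congr 3
    ext y
    simp
  · simp [hx]

/-- An isomorphism-invariant property of loopless maps that holds for a glued map if and only if it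
holds for both parts. -/
structure IsGlueProperty (Q : ∀ {D : Type}, RootedPlanarMap D → Prop) : Prop where
  of_iso : ∀ {D D' : Type} {m : RootedPlanarMap D} {m' : RootedPlanarMap D'}, m.Iso m' → Q m → Q m'
  glue_iff : ∀ {D₁ D₂ : Type} [Finite D₁] [Finite D₂] {m₁ : RootedPlanarMap D₁}
    {m₂ : RootedPlanarMap D₂} (h₁ : m₁.IsLoopless) (h₂ : m₂.IsLoopless) (a : D₁),
    Q (glue h₁ h₂ a) ↔ Q m₁ ∧ Q m₂

/-- A multiplicative isomorphism-invariant weight. -/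
structure IsGlueWeight (w : ∀ {D : Type}, RootedPlanarMap D → R) : Prop where
  of_iso : ∀ {D D' : Type} {m : RootedPlanarMap D} {m' : RootedPlanarMap D'}, m.Iso m' → w m = w m'
  glue_eq : ∀ {D₁ D₂ : Type} [Finite D₁] [Finite D₂] {m₁ : RootedPlanarMap D₁}
    {m₂ : RootedPlanarMap D₂} (h₁ : m₁.IsLoopless) (h₂ : m₂.IsLoopless) (a : D₁),
    w (glue h₁ h₂ a) = w m₁ * w m₂

/-- The loopless maps with the property `Q` whose core has `k` half-edges that carry an inserted
map and `t` other half-edges. -/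
def HasCore (Q : ∀ {D : Type}, RootedPlanarMap D → Prop) (k t : ℕ) {D : Type}
    (m : RootedPlanarMap D) : Prop :=
  Q m ∧ m.IsLoopless ∧ m.maxBigons.ncard = k ∧ m.outer.ncard = t

theorem HasCore.of_iso {Q : ∀ {D : Type}, RootedPlanarMap D → Prop} (hQ : IsGlueProperty Q)
    {k t : ℕ} {D D' : Type} {m : RootedPlanarMap D} {m' : RootedPlanarMap D'} (h : m.Iso m')
    (hm : HasCore Q k t m) : HasCore Q k t m' :=
  ⟨hQ.of_iso h hm.1, hm.2.1.of_iso h, by rw [← ncard_maxBigons_of_iso h, hm.2.2.1],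
    by rw [← ncard_outer_of_iso h, hm.2.2.2]⟩

variable {Q : ∀ {D : Type}, RootedPlanarMap D → Prop} (hQ : IsGlueProperty Q)
  {w : ∀ {D : Type}, RootedPlanarMap D → R} (hw : IsGlueWeight w)

include hQ hw

open Classical in
-- Gluing is the bijection: a map on `A` with a marked unfilled half-edge and a map on the
-- complement correspond to a map with a marked maximal pair whose region is that complement. The
-- second half-edge of the pair is the root of the inserted map.
theorem sum_maxBigons_fiber {D : Type} [Fintype D] (k t : ℕ) (A : Finset D) :
    ∑ x : RootedPlanarMap D × D × D with
        (HasCore Q (k + 2) t x.1 ∧ x.2 ∈ x.1.maxBigons) ∧ ((x.1.inner x.2.1 x.2.2)ᶜ : Set D) = ↑A, w x.1 =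
      ((t + 2 : ℕ) * ∑ m : RootedPlanarMap A with HasCore Q k (t + 2) m, w m) *
        ∑ m : RootedPlanarMap {x // x ∉ A} with Q m ∧ m.IsLoopless, w m := by
  let e : A ⊕ {x // x ∉ A} ≃ D := Equiv.sumCompl (· ∈ A)
  rw [← sum_filter_mem (fun m : RootedPlanarMap A => HasCore Q k (t + 2) m) outer (t + 2)
    (fun m h => h.2.2.2) (fun m => w m), Finset.sum_mul_sum, ← Finset.sum_product']
  symm
  refine Finset.sum_bij (fun (x : (RootedPlanarMap A × A) × RootedPlanarMap {x // x ∉ A}) hx =>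
    have hx' := Finset.mem_product.1 hx
    have h₁ : x.1.1.IsLoopless := (Finset.mem_filter.1 hx'.1).2.1.2.1
    have h₂ : x.2.IsLoopless := (Finset.mem_filter.1 hx'.2).2.2
    ((glue h₁ h₂ x.1.2).map e, e (Sum.inl x.1.2), e (Sum.inr x.2.root))) ?_ ?_ ?_ ?_
  · rintro ⟨⟨m₁, a⟩, m₂⟩ hx
    simp only [Finset.mem_product, Finset.mem_filter, Finset.mem_univ, true_and] at hx
    obtain ⟨⟨⟨q₁, h₁, k₁, t₁⟩, ha⟩, q₂, h₂⟩ := hx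
    simp only [Finset.mem_filter, Finset.mem_univ, true_and]
    refine ⟨⟨?_, ?_⟩, ?_⟩
    · refine HasCore.of_iso hQ ((glue h₁ h₂ a).iso_map e) ⟨(hQ.glue_iff h₁ h₂ a).2 ⟨q₁, q₂⟩,
        glue_isLoopless h₁ h₂ a, ?_, ?_⟩
      · rw [ncard_maxBigons_glue h₁ h₂ ha, k₁]
      · have := ncard_outer_glue h₁ h₂ ha
        omega
    · rw [mem_maxBigons_iff_of_conj (map_σ_conj e _) (map_α_conj e _) rfl,
        inl_inr_mem_maxBigons_glue h₁ h₂ ha]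
      exact Or.inl ⟨rfl, rfl⟩
    · rw [inner_eq_image_of_conj (map_σ_conj e _) (map_α_conj e _) rfl, inner_glue_root]
      ext x
      obtain ⟨x, rfl⟩ := e.surjective x
      rw [Set.mem_compl_iff, e.injective.mem_set_image]
      rcases x with x | x
      · simp [e]
      · simpa [e] using x.2
  · rintro ⟨⟨m₁, a⟩, m₂⟩ hx ⟨⟨m₁', a'⟩, m₂'⟩ hx' h
    simp only [Prod.mk.injEq] at h
    obtain ⟨e1, e2, e3⟩ := h
    have e2 := Sum.inl_injective (e.injective e2)
    have e3 := Sum.inr_injective (e.injective e3)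
    have e1 := (mapEquiv e).injective e1
    subst e2
    obtain ⟨rfl, rfl⟩ := glue_injective e1 e3
    rfl
  · rintro ⟨m, c, d⟩ hx
    simp only [Finset.mem_filter, Finset.mem_univ, true_and] at hx
    obtain ⟨⟨⟨q, hl, hk, ht⟩, hcd⟩, hA⟩ := hx
    obtain ⟨m₁, m₂, a, h₁, h₂, ha, hm, hc, hd⟩ := exists_map_glue hl hcd e (fun x => by
      have : x ∈ m.inner c d ↔ x ∉ A := by
        rw [← Finset.mem_coe, ← hA, Set.mem_compl_iff, not_not]
      rw [this]
      constructor
      · intro hx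
        exact ⟨⟨x, hx⟩, rfl⟩
      · rintro ⟨y, rfl⟩
        exact y.2)
    have q' := (hQ.glue_iff h₁ h₂ a).1 (hQ.of_iso (by rw [← hm]; exact (iso_map e _).symm) q)
    have k1 := ncard_maxBigons_of_iso ((glue h₁ h₂ a).iso_map e)
    have k2 := ncard_outer_of_iso ((glue h₁ h₂ a).iso_map e)
    have k3 := ncard_maxBigons_glue h₁ h₂ ha
    have k4 := ncard_outer_glue h₁ h₂ ha
    rw [hm] at k1 k2
    refine ⟨((m₁, a), m₂), ?_, ?_⟩
    · simp only [Finset.mem_product, Finset.mem_filter, Finset.mem_univ, true_and]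
      exact ⟨⟨⟨q'.1, h₁, by omega, by omega⟩, ha⟩, q'.2, h₂⟩
    · simp only [hm, hc, hd]
  · rintro ⟨⟨m₁, a⟩, m₂⟩ hx
    rw [← hw.of_iso (iso_map e _), hw.glue_eq]

open Classical in
-- The left side counts maps with a marked maximal pair; these are sorted by the set `A` of
-- half-edges outside the region.
theorem sum_hasCore {D : Type} [Fintype D] (k t : ℕ) :
    (k + 2 : ℕ) * ∑ m : RootedPlanarMap D with HasCore Q (k + 2) t m, w m =
      ∑ A : Finset D, ((t + 2 : ℕ) * ∑ m : RootedPlanarMap A with HasCore Q k (t + 2) m, w m) *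
        ∑ m : RootedPlanarMap {x // x ∉ A} with Q m ∧ m.IsLoopless, w m := by
  rw [← sum_filter_mem (fun m : RootedPlanarMap D => HasCore Q (k + 2) t m) maxBigons (k + 2)
    (fun m h => h.2.2.1) (fun m => w m)]
  rw [← Finset.sum_fiberwise_of_maps_to (t := Finset.univ)
    (g := fun x : RootedPlanarMap D × D × D => (x.1.inner x.2.1 x.2.2)ᶜ.toFinset)
    (fun _ _ => Finset.mem_univ _)]
  refine Finset.sum_congr rfl fun A _ => ?_
  rw [← sum_maxBigons_fiber hQ hw k t A, Finset.filter_filter]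
  refine Finset.sum_congr (Finset.filter_congr fun x _ => and_congr_right fun _ => ?_) fun _ _ => rfl
  rw [← Finset.coe_inj, Set.coe_toFinset]

end Sums

end RootedPlanarMap

/-! ### From labelled maps to isomorphism classes -/

namespace RootedPlanarMap

section Labelled

variable {R : Type*} [CommRing R]

/-- Invariance of a function on rooted maps under isomorphism. -/
structure IsoInvariant (F : ∀ {D : Type}, RootedPlanarMap D → R) : Prop where
  eq : ∀ {D D' : Type} {m : RootedPlanarMap D} {m' : RootedPlanarMap D'}, m.Iso m' → F m = F m'

variable {F : ∀ {D : Type}, RootedPlanarMap D → R}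

theorem sum_eq_sum_fin (hF : IsoInvariant F) {D : Type} [Finite D] {N : ℕ} (hN : Nat.card D = N) :
    ∑ m : RootedPlanarMap D, F m = ∑ m : RootedPlanarMap (Fin N), F m := by
  subst hN
  exact Fintype.sum_equiv (mapEquiv (Finite.equivFin D)) _ _ fun m => hF.eq (m.iso_map _)

theorem sum_fin_odd {N : ℕ} (hN : Odd N) : ∑ m : RootedPlanarMap (Fin N), F m = 0 := by
  refine Finset.sum_eq_zero fun m _ => ?_
  have := two_mul_numClasses_cyc m.involutive m.fixedPointFree
  rw [Nat.card_fin] at this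
  obtain ⟨k, rfl⟩ := hN
  omega

/-- An isomorphism-invariant function on isomorphism classes. -/
def classLift (hF : IsoInvariant F) {n : ℕ} : MapClass n → R :=
  Quotient.lift (fun m => F m) fun _ _ h => hF.eq h

/-- The sum of an isomorphism-invariant function over the maps with `n` edges. -/
noncomputable def classSum (hF : IsoInvariant F) (n : ℕ) : R :=
  ∑ c : MapClass n, classLift hF c

/-- Every map with `n` edges has `(2 * n)!` labellings. -/
theorem sum_fin_eq (hF : IsoInvariant F) (n : ℕ) :
    ∑ m : RootedPlanarMap (Fin (2 * n)), F m = ((2 * n).factorial : R) * classSum hF n := by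
  classical
  let g : RootedPlanarMap (Fin (2 * n)) → MapClass n := fun m => Quotient.mk _ m
  refine (Finset.sum_fiberwise Finset.univ g fun m => F m).symm.trans ?_
  rw [classSum, Finset.mul_sum]
  refine Finset.sum_congr rfl fun c _ => ?_
  induction c using Quotient.inductionOn with | _ m
  have e : ({m' ∈ Finset.univ | g m' = g m} :
      Finset (RootedPlanarMap (Fin (2 * n)))) =
      Finset.univ.image fun e : Perm (Fin (2 * n)) => m.map e := by
    ext m'
    simp only [Finset.mem_filter, Finset.mem_univ, true_and, Finset.mem_image]
    constructor
    · intro h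
      obtain ⟨e, he⟩ := Iso.exists_eq_map (Iso.symm (Quotient.exact h))
      exact ⟨e, he.symm⟩
    · rintro ⟨e, rfl⟩
      exact Quotient.sound (m.iso_map e).symm
  have h : ∀ e : Perm (Fin (2 * n)), F (m.map e) = F m := fun e => (hF.eq (m.iso_map e)).symm
  refine (Finset.sum_congr e fun _ _ => rfl).trans ?_
  -- By rigidity, distinct permutations give distinct labellings.
  rw [Finset.sum_image fun e _ e' _ h => m.map_left_injective h]
  simp only [h]
  rw [Finset.sum_const, Finset.card_univ, Fintype.card_perm, Fintype.card_fin, nsmul_eq_mul]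
  rfl

theorem sum_range_even {f : ℕ → R} (hf : ∀ i, Odd i → f i = 0) (n : ℕ) :
    ∑ i ∈ Finset.range (2 * n + 1), f i = ∑ j ∈ Finset.range (n + 1), f (2 * j) := by
  induction n with
  | zero => simp
  | succ n ih =>
    rw [Finset.sum_range_succ _ (n + 1), ← ih, show 2 * (n + 1) + 1 = 2 * n + 1 + 1 + 1 by ring,
      Finset.sum_range_succ, Finset.sum_range_succ, hf (2 * n + 1) ⟨n, rfl⟩, add_zero]
    rfl

theorem sum_finset_card {N : ℕ} (g h : ℕ → R) :
    ∑ A : Finset (Fin N), g A.card * h (N - A.card) =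
      ∑ i ∈ Finset.range (N + 1), (N.choose i : R) * (g i * h (N - i)) := by
  have := Finset.sum_powerset_apply_card (fun i => g i * h (N - i))
    (x := (Finset.univ : Finset (Fin N)))
  rw [Finset.powerset_univ, Finset.card_univ, Fintype.card_fin] at this
  simpa only [nsmul_eq_mul] using this

end Labelled

/-! ### Generating functions by core type -/

section Series

variable {R : Type*} [CommRing R] {Q : ∀ {D : Type}, RootedPlanarMap D → Prop}
  {w : ∀ {D : Type}, RootedPlanarMap D → R}

open Classical in
/-- The weight of the maps with a core of the given type. -/
noncomputable def coreWeight (Q : ∀ {D : Type}, RootedPlanarMap D → Prop)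
    (w : ∀ {D : Type}, RootedPlanarMap D → R) (k t : ℕ) {D : Type} (m : RootedPlanarMap D) : R :=
  if HasCore Q k t m then w m else 0

open Classical in
/-- The weight of the loopless maps. -/
noncomputable def looplessWeight (Q : ∀ {D : Type}, RootedPlanarMap D → Prop)
    (w : ∀ {D : Type}, RootedPlanarMap D → R) {D : Type} (m : RootedPlanarMap D) : R :=
  if Q m ∧ m.IsLoopless then w m else 0

open Classical in
/-- The weight of the simple maps. -/
noncomputable def simpleWeight (Q : ∀ {D : Type}, RootedPlanarMap D → Prop)
    (w : ∀ {D : Type}, RootedPlanarMap D → R) {D : Type} (m : RootedPlanarMap D) : R :=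
  if Q m ∧ m.IsSimple then w m else 0

variable (hQ : IsGlueProperty Q) (hw : IsGlueWeight w)

include hQ hw

theorem isoInvariant_coreWeight (k t : ℕ) : IsoInvariant (coreWeight Q w k t) := by
  classical
  constructor
  intro D D' m m' h
  exact if_congr ⟨fun k => k.of_iso hQ h, fun k => k.of_iso hQ h.symm⟩ (hw.of_iso h) rfl

theorem isoInvariant_looplessWeight : IsoInvariant (looplessWeight Q w) := by
  classical
  constructor
  intro D D' m m' h
  exact if_congr ⟨fun k => ⟨hQ.of_iso h k.1, k.2.of_iso h⟩,
    fun k => ⟨hQ.of_iso h.symm k.1, k.2.of_iso h.symm⟩⟩ (hw.of_iso h) rfl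

theorem isoInvariant_simpleWeight : IsoInvariant (simpleWeight Q w) := by
  classical
  constructor
  intro D D' m m' h
  exact if_congr ⟨fun k => ⟨hQ.of_iso h k.1, k.2.of_iso h⟩,
    fun k => ⟨hQ.of_iso h.symm k.1, k.2.of_iso h.symm⟩⟩ (hw.of_iso h) rfl

theorem sum_fin_coreWeight (N k t : ℕ) :
    (k + 2 : ℕ) * ∑ m : RootedPlanarMap (Fin N), coreWeight Q w (k + 2) t m =
      ∑ i ∈ Finset.range (N + 1), (N.choose i : R) *
        (((t + 2 : ℕ) * ∑ m : RootedPlanarMap (Fin i), coreWeight Q w k (t + 2) m) *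
          ∑ m : RootedPlanarMap (Fin (N - i)), looplessWeight Q w m) := by
  classical
  rw [← sum_finset_card (fun i => (t + 2 : ℕ) * ∑ m : RootedPlanarMap (Fin i),
    coreWeight Q w k (t + 2) m) fun i => ∑ m : RootedPlanarMap (Fin i), looplessWeight Q w m]
  have h := sum_hasCore hQ hw (D := Fin N) k t
  simp only [Finset.sum_filter] at h
  unfold coreWeight looplessWeight
  rw [h]
  refine Finset.sum_congr rfl fun A _ => ?_
  have h1 := sum_eq_sum_fin (isoInvariant_coreWeight hQ hw k (t + 2)) (D := A) (N := A.card)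
    (by simp)
  have h2 := sum_eq_sum_fin (isoInvariant_looplessWeight hQ hw) (D := {x // x ∉ A})
    (N := N - A.card) (by simp [Fintype.card_subtype_compl])
  unfold coreWeight at h1
  unfold looplessWeight at h2
  rw [h1, h2]

/-- The generating function of the maps with a given number of core edges of each kind. -/
noncomputable def coreSeries (k t : ℕ) : PowerSeries R :=
  PowerSeries.mk (classSum (isoInvariant_coreWeight hQ hw (2 * k) (2 * t)))

/-- The generating function of the loopless maps. -/
noncomputable def looplessSeries : PowerSeries R :=
  PowerSeries.mk (classSum (isoInvariant_looplessWeight hQ hw))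

/-- The generating function of the simple maps. -/
noncomputable def simpleSeries : PowerSeries R :=
  PowerSeries.mk (classSum (isoInvariant_simpleWeight hQ hw))

/-- Without regions the map is simple and every half-edge is outer, so `t` is its number of edges.
-/
theorem coreSeries_zero (t : ℕ) : coreSeries hQ hw 0 t =
    PowerSeries.monomial t (PowerSeries.coeff t (simpleSeries hQ hw)) := by
  ext n
  rw [PowerSeries.coeff_monomial, coreSeries, simpleSeries, PowerSeries.coeff_mk,
    PowerSeries.coeff_mk]
  have key : ∀ m : RootedPlanarMap (Fin (2 * n)), HasCore Q (2 * 0) (2 * t) m ↔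
      n = t ∧ Q m ∧ m.IsSimple := by
    intro m
    constructor
    · rintro ⟨q, hl, h1, h2⟩
      rw [mul_zero, Set.ncard_eq_zero] at h1
      have hs := (isSimple_iff_maxBigons_eq_empty hl).2 h1
      rw [outer_eq_univ hs, Set.ncard_univ, Nat.card_fin] at h2
      exact ⟨by omega, q, hs⟩
    · rintro ⟨rfl, q, hs⟩
      refine ⟨q, hs.1, ?_, ?_⟩
      · rw [(isSimple_iff_maxBigons_eq_empty hs.1).1 hs, Set.ncard_empty]
      · rw [outer_eq_univ hs, Set.ncard_univ, Nat.card_fin]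
  split_ifs with h
  · subst h
    refine Finset.sum_congr rfl fun c _ => ?_
    induction c using Quotient.inductionOn with | _ m
    classical exact if_congr ((key m).trans (and_iff_right rfl)) rfl rfl
  · refine Finset.sum_eq_zero fun c _ => ?_
    induction c using Quotient.inductionOn with | _ m
    exact if_neg fun k => h ((key m).1 k).1

/-- Each loopless map has a unique core type, and its core has at most as many edges as the map, so
the sum over `j ≤ n` misses nothing. -/
theorem coeff_looplessSeries (n : ℕ) : PowerSeries.coeff n (looplessSeries hQ hw) =
    ∑ j ∈ Finset.range (n + 1), ∑ p ∈ Finset.HasAntidiagonal.antidiagonal j,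
      PowerSeries.coeff n (coreSeries hQ hw p.1 p.2) := by
  simp only [looplessSeries, coreSeries, PowerSeries.coeff_mk, classSum]
  rw [Finset.sum_congr rfl fun j _ => Finset.sum_comm, Finset.sum_comm]
  refine Finset.sum_congr rfl fun c _ => ?_
  induction c using Quotient.inductionOn with | _ m
  change looplessWeight Q w m = ∑ j ∈ Finset.range (n + 1), ∑ p ∈ Finset.HasAntidiagonal.antidiagonal j,
    coreWeight Q w (2 * p.1) (2 * p.2) m
  by_cases h : Q m ∧ m.IsLoopless
  · obtain ⟨k, t, hk, ht, hle⟩ := m.exists_ncard_eq h.2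
    rw [Nat.card_fin] at hle
    have key : ∀ p : ℕ × ℕ, HasCore Q (2 * p.1) (2 * p.2) m ↔ p = (k, t) := by
      rintro ⟨k', t'⟩
      constructor
      · rintro ⟨-, -, h1, h2⟩
        simp only at h1 h2
        rw [Prod.mk.injEq]
        omega
      · rintro ⟨⟩
        exact ⟨h.1, h.2, hk, ht⟩
    rw [Finset.sum_eq_single (k + t), Finset.sum_eq_single (k, t)]
    · rw [looplessWeight, coreWeight, if_pos h, if_pos ((key (k, t)).2 rfl)]
    · intro p _ hp
      exact if_neg fun h' => hp ((key p).1 h')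
    · intro hp
      exact absurd ((Finset.HasAntidiagonal.mem_antidiagonal (a := (k, t))).2 rfl) hp
    · intro j _ hj
      refine Finset.sum_eq_zero fun p hp => if_neg fun h' => hj ?_
      rw [← Finset.HasAntidiagonal.mem_antidiagonal.1 hp, (key p).1 h']
    · intro hp
      rw [Finset.mem_range] at hp
      omega
  · rw [looplessWeight, if_neg h, eq_comm]
    exact Finset.sum_eq_zero fun j _ => Finset.sum_eq_zero fun p _ =>
      if_neg fun h' => h ⟨h'.1, h'.2.1⟩

variable [IsDomain R] [CharZero R]

theorem classSum_coreWeight (n k t : ℕ) :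
    ((k + 1 : ℕ) : R) * classSum (isoInvariant_coreWeight hQ hw (2 * (k + 1)) (2 * t)) n =
      ∑ j ∈ Finset.range (n + 1), ((t + 1 : ℕ) : R) *
        (classSum (isoInvariant_coreWeight hQ hw (2 * k) (2 * (t + 1))) j *
          classSum (isoInvariant_looplessWeight hQ hw) (n - j)) := by
  have h := sum_fin_coreWeight hQ hw (2 * n) (2 * k) (2 * t)
  rw [sum_range_even (fun i hi => by rw [sum_fin_odd hi, mul_zero, zero_mul, mul_zero])] at h
  have e1 := sum_fin_eq (isoInvariant_coreWeight hQ hw (2 * (k + 1)) (2 * t)) n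
  rw [show 2 * k + 2 = 2 * (k + 1) by ring, e1] at h
  -- The 2 accounts for the two half-edge pairs of a region and the two half-edges of a core edge;
  -- the factorials of the two parts are absorbed by the binomial coefficient.
  have hne : (2 * ((2 * n).factorial : R)) ≠ 0 :=
    mul_ne_zero two_ne_zero (Nat.cast_ne_zero.2 (Nat.factorial_ne_zero _))
  refine mul_left_cancel₀ hne ?_
  calc _ = ((2 * (k + 1) : ℕ) : R) * (((2 * n).factorial : R) *
        classSum (isoInvariant_coreWeight hQ hw (2 * (k + 1)) (2 * t)) n) := by
        push_cast
        ring
    _ = _ := h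
    _ = _ := by
        rw [Finset.mul_sum]
        refine Finset.sum_congr rfl fun j hj => ?_
        have hj' : j ≤ n := Nat.lt_succ_iff.1 (Finset.mem_range.1 hj)
        rw [show 2 * n - 2 * j = 2 * (n - j) by omega, show 2 * t + 2 = 2 * (t + 1) by ring,
          sum_fin_eq (isoInvariant_coreWeight hQ hw (2 * k) (2 * (t + 1))),
          sum_fin_eq (isoInvariant_looplessWeight hQ hw)]
        have hc := Nat.choose_mul_factorial_mul_factorial (show 2 * j ≤ 2 * n by omega)
        rw [show 2 * n - 2 * j = 2 * (n - j) by omega] at hc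
        rw [← hc]
        push_cast
        ring

theorem succ_mul_coreSeries (k t : ℕ) :
    ((k + 1 : ℕ) : PowerSeries R) * coreSeries hQ hw (k + 1) t =
      ((t + 1 : ℕ) : PowerSeries R) * coreSeries hQ hw k (t + 1) * looplessSeries hQ hw := by
  ext n
  rw [mul_assoc, ← nsmul_eq_mul, ← nsmul_eq_mul, map_nsmul, map_nsmul, PowerSeries.coeff_mul,
    Finset.Nat.sum_antidiagonal_eq_sum_range_succ_mk, nsmul_eq_mul, nsmul_eq_mul, Finset.mul_sum]
  simp only [coreSeries, looplessSeries, PowerSeries.coeff_mk]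
  exact classSum_coreWeight hQ hw n k t

theorem coreSeries_eq (k t : ℕ) : coreSeries hQ hw k t =
    ((k + t).choose k : PowerSeries R) * coreSeries hQ hw 0 (k + t) * looplessSeries hQ hw ^ k := by
  induction k generalizing t with
  | zero => simp
  | succ k ih =>
    have : CharZero (PowerSeries R) := charZero_of_injective_ringHom PowerSeries.C_injective
    have hne : ((k + 1 : ℕ) : PowerSeries R) ≠ 0 := Nat.cast_ne_zero.2 (Nat.succ_ne_zero k)
    refine mul_left_cancel₀ hne ?_
    -- The recursion (k+1) binom(N,k+1) = (N-k) binom(N,k), with N = k+1+t, matches the factors of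
    -- `succ_mul_coreSeries`.
    have hc := Nat.choose_succ_right_eq (k + 1 + t) k
    rw [show k + 1 + t - k = t + 1 by omega] at hc
    have hc' := congrArg (Nat.cast : ℕ → PowerSeries R) hc
    push_cast at hc'
    rw [succ_mul_coreSeries, ih, show k + (t + 1) = k + 1 + t by ring]
    push_cast
    linear_combination -(coreSeries hQ hw 0 (k + 1 + t)) * looplessSeries hQ hw ^ (k + 1) * hc'

theorem looplessSeries_eq_subst : looplessSeries hQ hw =
    (simpleSeries hQ hw).subst (PowerSeries.X * (1 + looplessSeries hQ hw)) := by
  set M := looplessSeries hQ hw with hM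
  have hs : PowerSeries.HasSubst (PowerSeries.X * (1 + M)) :=
    PowerSeries.HasSubst.of_constantCoeff_zero' (by simp)
  ext n
  rw [PowerSeries.coeff_subst' hs, finsum_eq_sum_of_support_subset (s := Finset.range (n + 1)),
    hM, coeff_looplessSeries, ← hM]
  · refine Finset.sum_congr rfl fun j _ => ?_
    rw [smul_eq_mul, ← PowerSeries.coeff_C_mul, ← map_sum]
    congr 1
    -- The core types with k+t = j are the terms of the binomial expansion of (1+M)^j.
    rw [mul_pow, add_comm, Commute.add_pow' (Commute.one_right M), Finset.mul_sum, Finset.mul_sum]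
    refine Finset.sum_congr rfl fun p hp => ?_
    have hmon : ∀ a : R, PowerSeries.monomial j a = PowerSeries.C a * PowerSeries.X ^ j := by
      intro a
      ext i
      rw [PowerSeries.coeff_monomial, PowerSeries.coeff_C_mul, PowerSeries.coeff_X_pow, mul_ite,
        mul_one, mul_zero]
    rw [coreSeries_eq, coreSeries_zero, Finset.HasAntidiagonal.mem_antidiagonal.1 hp, hmon, ← hM,
      one_pow, mul_one, nsmul_eq_mul]
    ring
  · intro d hd
    by_contra hd'
    apply hd
    have : n < d := by simpa using hd'
    beta_reduce
    rw [mul_pow, PowerSeries.coeff_X_pow_mul', if_neg (by omega), smul_zero]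

end Series

end RootedPlanarMap

/-! ### The two instances -/

namespace RootedPlanarMap

/-- The monomial that records the numbers of pure `ℓ`-gons. -/
noncomputable def gonWeight (L : Finset ℕ) {D : Type} (m : RootedPlanarMap D) : MvPolynomial L ℤ :=
  ∏ ℓ : L, MvPolynomial.X ℓ ^ m.pureGons (ℓ : ℕ)

theorem isGlueWeight_gonWeight (L : Finset ℕ) : IsGlueWeight (gonWeight L) where
  of_iso h := Finset.prod_congr rfl fun ℓ _ => by rw [pureGons_eq_of_iso h]
  glue_eq h₁ h₂ a := by
    unfold gonWeight
    rw [← Finset.prod_mul_distrib]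
    exact Finset.prod_congr rfl fun ℓ _ => by rw [glue_pureGons, pow_add]

theorem isGlueProperty_true : IsGlueProperty fun {_} _ => True where
  of_iso _ _ := trivial
  glue_iff _ _ _ := by simp

theorem isGlueProperty_isTwoConnected : IsGlueProperty fun {_} m => m.IsTwoConnected where
  of_iso h k := fun k' => k (k'.of_iso h.symm)
  glue_iff h₁ h₂ a := glue_isTwoConnected_iff h₁ h₂ a

/-- The only `2`-connected map with a loop has one edge. -/
theorem isLoopless_of_isTwoConnected {n : ℕ} {m : RootedPlanarMap (Fin (2 * n))}
    (h : m.IsTwoConnected) (h' : n = 1 → m.IsLoopless) : m.IsLoopless := by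
  by_contra hl
  have hn : n ≠ 1 := fun k => hl (h' k)
  unfold IsLoopless at hl
  push Not at hl
  obtain ⟨d, hd⟩ := hl
  refine h (isSeparable_of_loop hd ?_)
  by_contra! hx
  have hle : (Finset.univ : Finset (Fin (2 * n))) ⊆ {d, m.α d} := by
    intro x _
    rw [Finset.mem_insert, Finset.mem_singleton]
    by_cases hxd : x = d
    · exact Or.inl hxd
    · exact Or.inr (hx x hxd)
  have h1 := (Finset.card_le_card hle).trans Finset.card_le_two
  rw [Finset.card_univ, Fintype.card_fin] at h1
  have := d.pos
  omega

theorem looplessSeries_eq_gonGF (L : Finset ℕ) {Q : ∀ {D : Type}, RootedPlanarMap D → Prop}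
    (hQ : IsGlueProperty Q) (C : ∀ n, MapClass n → Prop)
    (hC : ∀ n (m : RootedPlanarMap (Fin (2 * n))),
      C n (Quotient.mk _ m) ↔ Q m ∧ m.IsLoopless) :
    gonGF L C = looplessSeries hQ (isGlueWeight_gonWeight L) := by
  classical
  ext1 n
  rw [gonGF, looplessSeries, PowerSeries.coeff_mk, PowerSeries.coeff_mk, classSum,
    Finset.sum_filter]
  refine Finset.sum_congr rfl fun c _ => ?_
  induction c using Quotient.inductionOn with | _ m
  exact if_congr (hC n m) rfl rfl

theorem simpleSeries_eq_gonGF (L : Finset ℕ) {Q : ∀ {D : Type}, RootedPlanarMap D → Prop}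
    (hQ : IsGlueProperty Q) (C : ∀ n, MapClass n → Prop)
    (hC : ∀ n (m : RootedPlanarMap (Fin (2 * n))),
      C n (Quotient.mk _ m) ↔ Q m ∧ m.IsSimple) :
    gonGF L C = simpleSeries hQ (isGlueWeight_gonWeight L) := by
  classical
  ext1 n
  rw [gonGF, simpleSeries, PowerSeries.coeff_mk, PowerSeries.coeff_mk, classSum,
    Finset.sum_filter]
  refine Finset.sum_congr rfl fun c _ => ?_
  induction c using Quotient.inductionOn with | _ m
  exact if_congr (hC n m) rfl rfl

end RootedPlanarMap

open RootedPlanarMap in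
theorem mainTheorem6 (L : Finset ℕ) (hL : ∀ ℓ ∈ L, 1 ≤ ℓ) :
    M2l L = (M3 L).subst (PowerSeries.X * (1 + M2l L)) ∧
    M4 L = (M5 L).subst (PowerSeries.X * (1 + M4 L)) := by
  constructor
  · have h1 : M2l L = _ := looplessSeries_eq_gonGF L isGlueProperty_true _
      fun n m => (iff_of_eq (true_and _)).symm
    have h2 : M3 L = _ := simpleSeries_eq_gonGF L isGlueProperty_true _
      fun n m => (iff_of_eq (true_and _)).symm
    rw [h1, h2]
    exact looplessSeries_eq_subst _ _
  · have h1 : M4 L = _ := looplessSeries_eq_gonGF L isGlueProperty_isTwoConnected _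
      fun n m => ⟨fun h => ⟨h.1, isLoopless_of_isTwoConnected h.1 h.2⟩, fun h => ⟨h.1, fun _ => h.2⟩⟩
    have h2 : M5 L = _ := simpleSeries_eq_gonGF L isGlueProperty_isTwoConnected _
      fun n m => Iff.rfl
    rw [h1, h2]
    exact looplessSeries_eq_subst _ _
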